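/- Let $\Phi$ be the standard normal distribution function and let $\pi_0\equiv 1,\pi_1,\pi_2,\dots$ be an orthonormal system in $L^2[0,1]$. Fix $K\ge 1$ and put $$c_{1k}=\int_0^1\pi_k(z)\,\Phi^{-1}(z)\,dz,\qquad c_{2k}=\int_0^1\pi_k(z)\,\bigl(\Phi^{-1}(z)\bigr)^2dz,\qquad \Sigma=\Bigl(\delta_{kl}-c_{1k}c_{1l}-\tfrac12c_{2k}c_{2l}\Bigr)_{1\le k,l\le K}.$$ Consider a sequence of one-way layouts with $J\ge1$ groups of sizes $N_1,\dots,N_J$, where $N=\sum_{j}N_j$ ($J$ and the $N_j$ may vary along the sequence), and errors $e_{ij}$ ($1\le i\le N_j$, $1\le j\le J$). Assume (A.1) that the $e_{ij}$ are i.i.d. with a continuous distribution function, and (A.2) that $\pi_1,\dots,\pi_K$ are twice differentiable with bounded first and second derivatives. Assume the null hypothesis $e_{ij}\sim N(0,1)$. For residuals $\hat e_{ij}$ and a $K\times K$ matrix $S$ write $$\hat Z_{ij}=\Phi(\hat e_{ij}),\qquad \bar\pi=\frac1N\sum_{j=1}^J\sum_{i=1}^{N_j}\bigl(\pi_1(\hat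 Z_{ij}),\dots,\pi_K(\hat Z_{ij})\bigr)^\top,\qquad \hat\Psi_K^2(S)=\bar\pi^\top S^{-1}\bar\pi .$$ Let $\chi^2_K$ denote the chi-square distribution with $K$ degrees of freedom. Then $\Sigma$ is invertible, and the following hold. 1. (Common mean and variance.) Let $Y_{ij}=\mu+\sigma e_{ij}$ with $\sigma>0$, $\hat\mu=N^{-1}\sum_{j,i}Y_{ij}$, $\hat\sigma^2=N^{-1}\sum_{j,i}(Y_{ij}-\hat\mu)^2$ and $\hat e_{ij}=(Y_{ij}-\hat\mu)/\hat\sigma$. Then $N\hat\Psi_K^2(\Sigma)\to_d\chi^2_K$ as $N\to\infty$. 2. (Different means, common variance.) Let $Y_{ij}=\mu_j+\sigma e_{ij}$ with $\sigma>0$, $\hat\mu_j=N_j^{-1}\sum_iY_{ij}$, $\hat\sigma^2=N^{-1}\sum_{j,i}(Y_{ij}-\hat\mu_j)^2$ and $\hat e_{ij}=(Y_{ij}-\hat\mu_j)/\hat\sigma$. Then $N\hat\Psi_K^2(\Sigma)\to_d\chi^2_K$ as $\min_jN_j\to\infty$, $J=o(N^{1/2})$ and $N_j/N_\ell\to p_{j,\ell}\in(0,\infty)$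 for all $j,\ell$. 3. (Common mean, different variances.) Let $Y_{ij}=\mu+\sigma_je_{ij}$ with $\sigma_j>0$, $\hat\mu=J^{-1}\sum_jN_j^{-1}\sum_iY_{ij}$, $\hat\sigma_j^2=N_j^{-1}\sum_i(Y_{ij}-\hat\mu)^2$ and $\hat e_{ij}=(Y_{ij}-\hat\mu)/\hat\sigma_j$. For weights $p=(p_j)$, $q=(q_j)$ let $\Omega^{(j)}(p,q)$ be the matrix with entries $$\delta_{kl}-\frac{2c_{1k}c_{1l}\sigma_j}{q_j}\sum_{\ell=1}^J\frac{p_\ell}{\sigma_\ell}+\frac{c_{1k}c_{1l}\sigma_j^2}{q_j^2}\Bigl(\sum_{\ell=1}^J\frac{p_\ell}{\sigma_\ell}\Bigr)^2-\frac{c_{2k}c_{2l}}2 ,\qquad 1\le k,l\le K,$$ and put $M(p,q)=\sum_{j=1}^Jp_j\,\Omega^{(j)}(p,q)$. Suppose that the conditions of part 2 hold and that $N_j/N\to p_j\in[0,\infty)$ and $JN_j/N\to q_j\in(0,\infty)$ for all $j$. Let $\hat p_j=N_j/N$ and $\hat q_j=JN_j/N$. (a) If $J$ is eventually constant, then $M(p,q)$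 is invertible and $N\hat\Psi_K^2(M(p,q))\to_d\chi^2_K$. (b) If either $J$ is eventually constant, or $J\to\infty$ with $0<\inf_j\sigma_j\le\sup_j\sigma_j<\infty$ and $JN_j/N\ge c$ for some constant $c>0$ and all groups $j$ of all sufficiently late layouts, then $M(\hat p,\hat q)$ is eventually invertible and $N\hat\Psi_K^2(M(\hat p,\hat q))\to_d\chi^2_K$. -/

import Mathlib

open MeasureTheory ProbabilityTheory Filter Topology Asymptotics

namespace SmoothAnova

noncomputable section

/-- The standard normal distribution function. -/
def Phi (x : ℝ) : ℝ := cdf (gaussianReal 0 1) x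

/-- The inverse of `Phi`; it is the genuine inverse on the range `(0, 1)` of `Phi`. -/
def PhiInv : ℝ → ℝ := Function.invFun Phi

/-- The chi-square distribution with `K` degrees of freedom: the law of the sum of the squares of
`K` independent standard normal variables. -/
def chiSquared (K : ℕ) : Measure ℝ :=
  (Measure.pi fun _ : Fin K => gaussianReal 0 1).map fun x => ∑ k, x k ^ 2

instance (K : ℕ) : IsProbabilityMeasure (chiSquared K) :=
  Measure.isProbabilityMeasure_map
    (Finset.measurable_sum _ fun k _ => (measurable_pi_apply k).pow_const 2).aemeasurable

/-! ### Basis functions -/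

/-- `π 0, π 1, …` is an orthonormal system in `L²[0,1]` whose first element is the constant `1`. -/
structure IsOrthonormalSystem (π : ℕ → ℝ → ℝ) : Prop where
  memLp : ∀ k, MemLp (π k) 2 (volume.restrict (Set.Icc (0 : ℝ) 1))
  zero : ∀ z ∈ Set.Icc (0 : ℝ) 1, π 0 z = 1
  orthonormal : ∀ k l, ∫ z in (0 : ℝ)..1, π k z * π l z = if k = l then 1 else 0

/-- Assumption A.2: `π 1, …, π K` are twice differentiable on `(0, 1)` with bounded first and second
derivatives. -/
def AssumptionA2 (K : ℕ) (π : ℕ → ℝ → ℝ) : Prop :=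
  ∀ k, 1 ≤ k → k ≤ K →
    DifferentiableOn ℝ (π k) (Set.Ioo 0 1) ∧
    DifferentiableOn ℝ (deriv (π k)) (Set.Ioo 0 1) ∧
    ∃ B : ℝ, ∀ z ∈ Set.Ioo (0 : ℝ) 1, |deriv (π k) z| ≤ B ∧ |deriv (deriv (π k)) z| ≤ B

/-- `c_{1k} = ∫₀¹ π_k(z) Φ⁻¹(z) dz`. -/
def c1 (π : ℕ → ℝ → ℝ) (k : ℕ) : ℝ := ∫ z in (0 : ℝ)..1, π k z * PhiInv z

/-- `c_{2k} = ∫₀¹ π_k(z) (Φ⁻¹(z))² dz`. -/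
def c2 (π : ℕ → ℝ → ℝ) (k : ℕ) : ℝ := ∫ z in (0 : ℝ)..1, π k z * PhiInv z ^ 2

/-! ### One-way layouts

A layout has `J` groups, numbered `j = 0, …, J - 1`, and group `j` has `m j` observations, numbered
`i = 0, …, m j - 1`. An array `y j i` is only ever used at these indices. -/

/-- The total sample size `N`. -/
def total (J : ℕ) (m : ℕ → ℕ) : ℕ := ∑ j ∈ Finset.range J, m j

/-- Assumption A.1: the errors `e j i` of the layout are independent and identically distributed,
with common law `ν`, whose distribution function is continuous. -/
structure AssumptionA1 {Ω : Type*} [MeasurableSpace Ω] (J : ℕ) (m : ℕ → ℕ) (e : ℕ → ℕ → Ω → ℝ)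
    (P : Measure Ω) (ν : Measure ℝ) : Prop where
  indep : iIndepFun (fun a : (Σ j : Fin J, Fin (m j)) => e a.1 a.2) P
  law : ∀ j < J, ∀ i < m j, HasLaw (e j i) ν P
  continuous_cdf : Continuous (cdf ν)

/-- The mean of group `j`. -/
def groupMean (m : ℕ → ℕ) (y : ℕ → ℕ → ℝ) (j : ℕ) : ℝ :=
  (∑ i ∈ Finset.range (m j), y j i) / m j

/-- The mean of the whole sample. -/
def grandMean (J : ℕ) (m : ℕ → ℕ) (y : ℕ → ℕ → ℝ) : ℝ :=
  (∑ j ∈ Finset.range J, ∑ i ∈ Finset.range (m j), y j i) / total J m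

/-- The unweighted average of the group means. -/
def meanOfMeans (J : ℕ) (m : ℕ → ℕ) (y : ℕ → ℕ → ℝ) : ℝ :=
  (∑ j ∈ Finset.range J, groupMean m y j) / J

/-- The pooled standard deviation about group-wise centres `b j`. -/
def pooledSd (J : ℕ) (m : ℕ → ℕ) (y : ℕ → ℕ → ℝ) (b : ℕ → ℝ) : ℝ :=
  √((∑ j ∈ Finset.range J, ∑ i ∈ Finset.range (m j), (y j i - b j) ^ 2) / total J m)

/-- The standard deviation of group `j` about the centre `b`. -/
def groupSd (m : ℕ → ℕ) (y : ℕ → ℕ → ℝ) (b : ℝ) (j : ℕ) : ℝ :=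
  √((∑ i ∈ Finset.range (m j), (y j i - b) ^ 2) / m j)

/-- Residuals `ê` in the model with a common mean and a common variance. -/
def residSame (J : ℕ) (m : ℕ → ℕ) (y : ℕ → ℕ → ℝ) (j i : ℕ) : ℝ :=
  (y j i - grandMean J m y) / pooledSd J m y (fun _ => grandMean J m y)

/-- Residuals `ê` in the model with different means and a common variance. -/
def residMeans (J : ℕ) (m : ℕ → ℕ) (y : ℕ → ℕ → ℝ) (j i : ℕ) : ℝ :=
  (y j i - groupMean m y j) / pooledSd J m y (groupMean m y)

/-- Residuals `ê` in the model with a common mean and different variances. -/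
def residVars (J : ℕ) (m : ℕ → ℕ) (y : ℕ → ℕ → ℝ) (j i : ℕ) : ℝ :=
  (y j i - meanOfMeans J m y) / groupSd m y (meanOfMeans J m y) j

/-! ### The test statistic -/

/-- The vector `N⁻¹ ∑_j ∑_i π(Ẑ_ij)` with `Ẑ_ij = Φ(ê_ij)`; its entry `k : Fin K` belongs to the
basis function number `k + 1`. -/
def avgPi (π : ℕ → ℝ → ℝ) (K J : ℕ) (m : ℕ → ℕ) (eHat : ℕ → ℕ → ℝ) : Fin K → ℝ := fun k =>
  (∑ j ∈ Finset.range J, ∑ i ∈ Finset.range (m j), π (k + 1) (Phi (eHat j i))) / total J m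

/-- The quadratic form `Ψ̂²_K = vᵀ S⁻¹ v` of the averaged vector `v` with normalizing matrix `S`. -/
def psiSq (π : ℕ → ℝ → ℝ) (K J : ℕ) (m : ℕ → ℕ) (S : Matrix (Fin K) (Fin K) ℝ)
    (eHat : ℕ → ℕ → ℝ) : ℝ :=
  avgPi π K J m eHat ⬝ᵥ S⁻¹.mulVec (avgPi π K J m eHat)

/-- `Σ = (δ_kl - c_{1k} c_{1l} - c_{2k} c_{2l} / 2)`. -/
def sigmaMat (π : ℕ → ℝ → ℝ) (K : ℕ) : Matrix (Fin K) (Fin K) ℝ := fun k l =>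
  (if k = l then 1 else 0) - c1 π (k + 1) * c1 π (l + 1) - c2 π (k + 1) * c2 π (l + 1) / 2

/-- The matrix `Ω^{(j)}` of the model with different variances `σ j ^ 2` and weights `p`, `q`. -/
def omegaMat (π : ℕ → ℝ → ℝ) (K J : ℕ) (σ p q : ℕ → ℝ) (j : ℕ) : Matrix (Fin K) (Fin K) ℝ :=
  fun k l =>
    (if k = l then 1 else 0)
      - 2 * c1 π (k + 1) * c1 π (l + 1) * σ j / q j * ∑ r ∈ Finset.range J, p r / σ r
      + c1 π (k + 1) * c1 π (l + 1) * σ j ^ 2 / q j ^ 2 * (∑ r ∈ Finset.range J, p r / σ r) ^ 2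
      - c2 π (k + 1) * c2 π (l + 1) / 2

/-- The normalizing matrix `∑_j p_j Ω^{(j)}`. -/
def omegaMix (π : ℕ → ℝ → ℝ) (K J : ℕ) (σ p q : ℕ → ℝ) : Matrix (Fin K) (Fin K) ℝ :=
  ∑ j ∈ Finset.range J, p j • omegaMat π K J σ p q j

/-- `p̂_j = N_j / N`. -/
def pHat (J : ℕ) (m : ℕ → ℕ) (j : ℕ) : ℝ := m j / total J m

/-- `q̂_j = J N_j / N`. -/
def qHat (J : ℕ) (m : ℕ → ℕ) (j : ℕ) : ℝ := J * m j / total J m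

/-! ### Asymptotic regimes for a sequence of layouts -/

/-- `min_j N_j → ∞`, `J = o(N^{1/2})` and `N_j / N_l → p_{jl} ∈ (0, ∞)` for all groups `j`, `l`.
The number of groups may vary along the sequence; a limit that concerns given groups is taken along
those layouts in which they occur. -/
structure GroupRegime (J : ℕ → ℕ) (m : ℕ → ℕ → ℕ) : Prop where
  pos : ∀ n, 0 < J n
  size : ∀ M : ℕ, ∀ᶠ n in atTop, ∀ j < J n, M ≤ m n j
  groups : (fun n => (J n : ℝ)) =o[atTop] fun n => √(total (J n) (m n) : ℝ)
  ratio : ∀ j l : ℕ, ∃ r : ℝ, 0 < r ∧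
    Tendsto (fun n => (m n j : ℝ) / m n l) (atTop ⊓ 𝓟 {n | j < J n ∧ l < J n}) (𝓝 r)

/-- Moreover `N_j / N → p_j ∈ [0, ∞)` and `J N_j / N → q_j ∈ (0, ∞)` for all groups `j`. -/
structure WeightRegime (J : ℕ → ℕ) (m : ℕ → ℕ → ℕ) (p q : ℕ → ℝ) : Prop extends
    GroupRegime J m where
  p_nonneg : ∀ j, 0 ≤ p j
  q_pos : ∀ j, 0 < q j
  p_lim : ∀ j, Tendsto (fun n => pHat (J n) (m n) j) (atTop ⊓ 𝓟 {n | j < J n}) (𝓝 (p j))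
  q_lim : ∀ j, Tendsto (fun n => qHat (J n) (m n) j) (atTop ⊓ 𝓟 {n | j < J n}) (𝓝 (q j))

end

end SmoothAnova

/-! Write x for the standard normal errors and g_k = π_k ∘ Φ. By A.2 the g_k are bounded with
bounded Lipschitz derivative; under N(0,1) they are centred and orthonormal. Stein's identity gives
c_{1k} = E[g_k(X)X] = E[g_k'(X)] and c_{2k} = E[g_k(X)X²] = E[g_k'(X)X].

In every model a residual is (x - d)/s, where d is a linear statistic of the errors and s is the
root mean square of x - d, over the whole sample or over one group. Taylor's formula turns ∑ g_k((x
- d)/s) into ∑ (g_k(x) - c_{1k} d - c_{2k}(x² - 1)/2) plus a remainder (`group_expansion`) of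
stochastic order at most the number of groups, which J = o(√N) makes negligible against √N. Moreover
∑ d = ∑ w x with bounded deterministic weights w, equal to 1 in the first two models.

So √N π̄ behaves like a normalized sum of independent vectors with entries g_k(x) - c_{1k} w x -
c_{2k}(x² - 1)/2. Their average covariance is δ_kl + t c_{1k}c_{1l} - c_{2k}c_{2l}/2, where t is the
average of w² - 2w = (w - 1)² - 1, hence t ≥ -1. At t = -1 this is Σ, the Gram matrix of the g_k
after projecting off x and x² - 1. It is positive definite because a bounded function cannot be a
nonconstant quadratic polynomial (`covForm_pos`), and it bounds the matrices for all t ≥ -1 from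
below.

When J → ∞ the normalizing matrices S_n need not converge. Therefore S_n⁻¹ = BₙᵀBₙ is factored with
uniformly bounded Bₙ (`exists_whitening`), and Bₙ √N π̄ is shown to be asymptotically N(0, I): the
direction z becomes Bₙᵀz, of limiting variance |z|², and characteristic functions are compared
summand by summand (`IsGaussianSample.norm_charFun_sum_sub_le`). Continuous mapping then gives χ²_K
(`tendstoInDistribution_quadForm`). -/

namespace SmoothAnova

/-! ### The standard normal distribution function -/

theorem Phi_eq_integral (x : ℝ) : Phi x = ∫ t in Set.Iic x, gaussianPDFReal 0 1 t := by
  rw [Phi, cdf_eq_real, measureReal_def, gaussianReal_apply_eq_integral _ one_ne_zero,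
    ENNReal.toReal_ofReal]
  exact integral_nonneg fun t => gaussianPDFReal_nonneg _ _ _

theorem continuous_gaussianPDFReal : Continuous (gaussianPDFReal 0 1) := by
  unfold gaussianPDFReal
  fun_prop

theorem hasDerivAt_Phi (x : ℝ) : HasDerivAt Phi (gaussianPDFReal 0 1 x) x := by
  have h : Phi = fun y => Phi 0 + ∫ t in (0 : ℝ)..y, gaussianPDFReal 0 1 t := by
    ext y
    rw [← intervalIntegral.integral_Iic_sub_Iic (integrable_gaussianPDFReal 0 1).integrableOn
      (integrable_gaussianPDFReal 0 1).integrableOn, Phi_eq_integral, Phi_eq_integral]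
    ring
  rw [h]
  refine HasDerivAt.const_add _ ?_
  exact intervalIntegral.integral_hasDerivAt_right
    (continuous_gaussianPDFReal.intervalIntegrable _ _)
    (continuous_gaussianPDFReal.stronglyMeasurableAtFilter _ _)
    continuous_gaussianPDFReal.continuousAt

theorem continuous_Phi : Continuous Phi :=
  continuous_iff_continuousAt.2 fun x => (hasDerivAt_Phi x).continuousAt

theorem strictMono_Phi : StrictMono Phi :=
  strictMono_of_deriv_pos fun x => by
    rw [(hasDerivAt_Phi x).deriv]
    exact gaussianPDFReal_pos _ _ _ one_ne_zero

theorem Phi_mem_Ioo (x : ℝ) : Phi x ∈ Set.Ioo (0 : ℝ) 1 :=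
  ⟨(cdf_nonneg _ (x - 1)).trans_lt (strictMono_Phi (by linarith)),
    (strictMono_Phi (by linarith : x < x + 1)).trans_le (cdf_le_one _ _)⟩

theorem range_Phi : Set.range Phi = Set.Ioo 0 1 := by
  refine Set.Subset.antisymm (Set.range_subset_iff.2 Phi_mem_Ioo) fun z hz => ?_
  have h0 : ∀ᶠ x in atBot, Phi x < z := (tendsto_cdf_atBot _).eventually_lt_const hz.1
  have h1 : ∀ᶠ x in atTop, z < Phi x := (tendsto_cdf_atTop _).eventually_const_lt hz.2
  obtain ⟨a, ha⟩ := h0.exists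
  obtain ⟨b, hb⟩ := h1.exists
  exact mem_range_of_exists_le_of_exists_ge continuous_Phi ⟨a, ha.le⟩ ⟨b, hb.le⟩

theorem PhiInv_Phi (x : ℝ) : PhiInv (Phi x) = x :=
  Function.leftInverse_invFun strictMono_Phi.injective x

/-- `Phi` maps the standard normal distribution to the uniform distribution. -/
theorem integral_unit_eq (f : ℝ → ℝ) :
    ∫ z in (0 : ℝ)..1, f z = ∫ x, f (Phi x) ∂gaussianReal 0 1 := by
  rw [intervalIntegral.integral_of_le zero_le_one, integral_Ioc_eq_integral_Ioo, ← range_Phi,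
    ← Set.image_univ, integral_image_eq_integral_abs_deriv_smul MeasurableSet.univ
      (fun x _ => (hasDerivAt_Phi x).hasDerivWithinAt) strictMono_Phi.injective.injOn,
    integral_gaussianReal_eq_integral_smul one_ne_zero, Measure.restrict_univ]
  simp only [abs_of_nonneg (gaussianPDFReal_nonneg _ _ _)]

/-! ### Functions of polynomial growth -/

/-- Measurable functions of at most polynomial growth. -/
def PolyGrowth (f : ℝ → ℝ) : Prop :=
  Measurable f ∧ ∃ C : ℝ, ∃ m : ℕ, 0 ≤ C ∧ ∀ x, |f x| ≤ C * (1 + x ^ 2) ^ m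

namespace PolyGrowth

variable {f g : ℝ → ℝ}

theorem of_bounded (hf : Measurable f) {C : ℝ} (h : ∀ x, |f x| ≤ C) : PolyGrowth f :=
  ⟨hf, C, 0, (abs_nonneg _).trans (h 0), fun x => by simpa using h x⟩

theorem const (c : ℝ) : PolyGrowth fun _ => c := of_bounded measurable_const fun _ => le_rfl

theorem id : PolyGrowth fun x => x :=
  ⟨measurable_id, 1, 1, zero_le_one, fun x => by
    rw [abs_le]; constructor <;> nlinarith [sq_nonneg (x - 1), sq_nonneg (x + 1)]⟩

theorem add (hf : PolyGrowth f) (hg : PolyGrowth g) : PolyGrowth fun x => f x + g x := by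
  obtain ⟨hf, C, m, hC, hf'⟩ := hf
  obtain ⟨hg, D, k, hD, hg'⟩ := hg
  refine ⟨hf.add hg, C + D, m + k, add_nonneg hC hD, fun x => ?_⟩
  have h1 : (1 : ℝ) ≤ 1 + x ^ 2 := by nlinarith [sq_nonneg x]
  have h2 : (1 + x ^ 2) ^ m ≤ (1 + x ^ 2) ^ (m + k) := pow_le_pow_right₀ h1 (by omega)
  have h3 : (1 + x ^ 2) ^ k ≤ (1 + x ^ 2) ^ (m + k) := pow_le_pow_right₀ h1 (by omega)
  calc |f x + g x| ≤ |f x| + |g x| := abs_add_le _ _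
    _ ≤ C * (1 + x ^ 2) ^ m + D * (1 + x ^ 2) ^ k := add_le_add (hf' x) (hg' x)
    _ ≤ C * (1 + x ^ 2) ^ (m + k) + D * (1 + x ^ 2) ^ (m + k) := by gcongr
    _ = _ := by ring

theorem mul (hf : PolyGrowth f) (hg : PolyGrowth g) : PolyGrowth fun x => f x * g x := by
  obtain ⟨hf, C, m, hC, hf'⟩ := hf
  obtain ⟨hg, D, k, hD, hg'⟩ := hg
  refine ⟨hf.mul hg, C * D, m + k, mul_nonneg hC hD, fun x => ?_⟩
  calc |f x * g x| = |f x| * |g x| := abs_mul _ _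
    _ ≤ (C * (1 + x ^ 2) ^ m) * (D * (1 + x ^ 2) ^ k) :=
      mul_le_mul (hf' x) (hg' x) (abs_nonneg _) (by positivity)
    _ = _ := by rw [pow_add]; ring

theorem const_mul (c : ℝ) (hf : PolyGrowth f) : PolyGrowth fun x => c * f x := (const c).mul hf

theorem neg (hf : PolyGrowth f) : PolyGrowth fun x => -f x := by
  simpa using hf.const_mul (-1)

theorem sub (hf : PolyGrowth f) (hg : PolyGrowth g) : PolyGrowth fun x => f x - g x := by
  simpa [sub_eq_add_neg] using hf.add hg.neg

theorem div_const (hf : PolyGrowth f) (c : ℝ) : PolyGrowth fun x => f x / c := by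
  simpa [div_eq_inv_mul] using hf.const_mul c⁻¹

theorem pow (hf : PolyGrowth f) (n : ℕ) : PolyGrowth fun x => f x ^ n := by
  induction n with
  | zero => simpa using const 1
  | succ n ih => simpa [pow_succ] using ih.mul hf

theorem abs (hf : PolyGrowth f) : PolyGrowth fun x => |f x| := by
  obtain ⟨hf, C, m, hC, hf'⟩ := hf
  exact ⟨hf.norm, C, m, hC, fun x => by rw [abs_abs]; exact hf' x⟩

theorem sum {κ : Type*} (s : Finset κ) {f : κ → ℝ → ℝ} (hf : ∀ k ∈ s, PolyGrowth (f k)) :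
    PolyGrowth fun x => ∑ k ∈ s, f k x := by
  classical
  induction s using Finset.induction_on with
  | empty => simpa using const 0
  | insert a s ha ih =>
    simp only [Finset.sum_insert ha]
    exact (hf a (by simp)).add (ih fun k hk => hf k (by simp [hk]))

theorem integrable (hf : PolyGrowth f) : Integrable f (gaussianReal 0 1) := by
  obtain ⟨hf, C, m, hC, hf'⟩ := hf
  have h : Integrable (fun x : ℝ => C * (1 + x ^ 2) ^ m) (gaussianReal 0 1) := by
    refine Integrable.const_mul ?_ _
    have h2 : MemLp (fun x : ℝ => x) (2 * m : ℕ) (gaussianReal 0 1) :=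
      memLp_id_gaussianReal' _ (ENNReal.natCast_ne_top _)
    have h3 : Integrable (fun x : ℝ => ‖x‖ ^ (2 * m)) (gaussianReal 0 1) := h2.integrable_norm_pow'
    -- The domination (1 + x²)^m ≤ 2^m (x^(2m) + 1) follows by comparing x² with 1.
    refine Integrable.mono' ((h3.add (integrable_const 1)).const_mul (2 ^ m))
      (by fun_prop) (ae_of_all _ fun x => ?_)
    change _ ≤ 2 ^ m * (‖x‖ ^ (2 * m) + 1)
    rw [Real.norm_of_nonneg (by positivity), pow_mul, Real.norm_eq_abs, sq_abs]
    rcases le_total (x ^ 2) 1 with hx | hx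
    · calc (1 + x ^ 2) ^ m ≤ 2 ^ m := pow_le_pow_left₀ (by positivity) (by linarith) _
        _ ≤ 2 ^ m * ((x ^ 2) ^ m + 1) := by
          have : 0 ≤ (x ^ 2) ^ m := by positivity
          have h2 : (0 : ℝ) < 2 ^ m := by positivity
          nlinarith
    · calc (1 + x ^ 2) ^ m ≤ (2 * x ^ 2) ^ m :=
            pow_le_pow_left₀ (by positivity) (by linarith) _
        _ ≤ 2 ^ m * ((x ^ 2) ^ m + 1) := by
          rw [mul_pow]
          have h2 : (0 : ℝ) < 2 ^ m := by positivity
          nlinarith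
  exact h.mono' hf.aestronglyMeasurable (ae_of_all _ hf')

end PolyGrowth

/-! ### Stein's identity and moments of the normal law. -/

theorem hasDerivAt_gaussianPDFReal (x : ℝ) :
    HasDerivAt (gaussianPDFReal 0 1) (-(x * gaussianPDFReal 0 1 x)) x := by
  have h : HasDerivAt (fun x : ℝ => -(x - 0) ^ 2 / (2 * ((1 : NNReal) : ℝ))) (-x) x := by
    have := (((hasDerivAt_id x).sub_const 0).pow 2).neg.div_const (2 * ((1 : NNReal) : ℝ))
    convert! this using 1
    simp
    ring
  have := (h.exp).const_mul (√(2 * Real.pi * ((1 : NNReal) : ℝ)))⁻¹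
  convert! this using 1
  simp [gaussianPDFReal]
  ring

theorem integrable_gaussian_iff {f : ℝ → ℝ} :
    Integrable f (gaussianReal 0 1) ↔ Integrable (fun x => gaussianPDFReal 0 1 x * f x) := by
  rw [gaussianReal_of_var_ne_zero _ one_ne_zero,
    integrable_withDensity_iff_integrable_smul' (measurable_gaussianPDF _ _)
      (ae_of_all _ fun _ => gaussianPDF_lt_top)]
  simp [toReal_gaussianPDF]

/-- Stein's identity. -/
theorem integral_deriv_gaussian {f f' : ℝ → ℝ} (hd : ∀ x, HasDerivAt f (f' x) x)
    (hf : PolyGrowth f) (hf' : PolyGrowth f') :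
    ∫ x, f' x ∂gaussianReal 0 1 = ∫ x, f x * x ∂gaussianReal 0 1 := by
  have h0 := integrable_gaussian_iff.1 hf.integrable
  have h1 := integrable_gaussian_iff.1 hf'.integrable
  have h2 := integrable_gaussian_iff.1 (hf.mul .id).integrable
  have := integral_mul_deriv_eq_deriv_mul_of_integrable (u := f) (v := gaussianPDFReal 0 1)
    (u' := f') (v' := fun x => -(x * gaussianPDFReal 0 1 x)) (fun x _ => hd x)
    (fun x _ => hasDerivAt_gaussianPDFReal x)
    (by refine h2.neg.congr (ae_of_all _ fun x => ?_); simp; ring)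
    (by refine h1.congr (ae_of_all _ fun x => ?_); simp; ring)
    (by refine h0.congr (ae_of_all _ fun x => ?_); simp; ring)
  rw [integral_gaussianReal_eq_integral_smul one_ne_zero,
    integral_gaussianReal_eq_integral_smul one_ne_zero]
  have e1 : ∫ x, gaussianPDFReal 0 1 x • f' x = ∫ x, f' x * gaussianPDFReal 0 1 x := by
    congr with x; simp; ring
  have e2 : ∫ x, gaussianPDFReal 0 1 x • (f x * x) = -∫ x, f x * -(x * gaussianPDFReal 0 1 x) := by
    rw [← integral_neg]; congr with x; simp; ring
  rw [e1, e2, this, neg_neg]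

theorem integral_gaussian_one : ∫ x, x ∂gaussianReal 0 1 = 0 := integral_id_gaussianReal

theorem integral_gaussian_sq : ∫ x, x ^ 2 ∂gaussianReal 0 1 = 1 := by
  have := integral_deriv_gaussian (f := fun x => x) (f' := fun _ => 1) (fun x => hasDerivAt_id x)
    .id (.const 1)
  simpa [pow_two] using this.symm

theorem integral_gaussian_cube : ∫ x, x ^ 3 ∂gaussianReal 0 1 = 0 := by
  have := integral_deriv_gaussian (f := fun x => x ^ 2) (f' := fun x => 2 * x)
    (fun x => by simpa using hasDerivAt_pow 2 x) (.pow .id 2) (.const_mul 2 .id)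
  rw [integral_const_mul, integral_gaussian_one] at this
  simpa [pow_succ] using this.symm

theorem integral_gaussian_fourth : ∫ x, x ^ 4 ∂gaussianReal 0 1 = 3 := by
  have := integral_deriv_gaussian (f := fun x => x ^ 3) (f' := fun x => 3 * x ^ 2)
    (fun x => by simpa using hasDerivAt_pow 3 x) (.pow .id 3) (.const_mul 3 (.pow .id 2))
  rw [integral_const_mul, integral_gaussian_sq] at this
  simpa [pow_succ] using this.symm

/-! ### Test functions -/

/-- Bounded, centred functions with bounded Lipschitz derivative. -/
structure IsTestFn (g g' : ℝ → ℝ) (L : ℝ) : Prop where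
  hasDerivAt : ∀ x, HasDerivAt g (g' x) x
  abs_le : ∀ x, |g x| ≤ L
  abs_deriv_le : ∀ x, |g' x| ≤ L
  lipschitz : ∀ x y, |g' x - g' y| ≤ L * |x - y|
  integral_eq_zero : ∫ x, g x ∂gaussianReal 0 1 = 0

/-- With the next lemma, this controls the density and its derivative in the chain rule for π_k ∘ Φ.
-/
theorem gaussianPDFReal_le_one (x : ℝ) : gaussianPDFReal 0 1 x ≤ 1 := by
  have h1 : (√(2 * Real.pi * ((1 : NNReal) : ℝ)))⁻¹ ≤ 1 := by
    refine inv_le_one_of_one_le₀ (Real.one_le_sqrt.2 ?_)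
    have := Real.pi_gt_three
    simp; linarith
  have h2 : Real.exp (-(x - 0) ^ 2 / (2 * ((1 : NNReal) : ℝ))) ≤ 1 := by
    rw [Real.exp_le_one_iff]
    simp
    nlinarith [sq_nonneg x]
  rw [gaussianPDFReal]
  exact mul_le_one₀ h1 (Real.exp_pos _).le h2

theorem abs_mul_gaussianPDFReal_le_one (x : ℝ) : |x * gaussianPDFReal 0 1 x| ≤ 1 := by
  have h1 : (√(2 * Real.pi * ((1 : NNReal) : ℝ)))⁻¹ ≤ 1 := by
    refine inv_le_one_of_one_le₀ (Real.one_le_sqrt.2 ?_)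
    have := Real.pi_gt_three
    simp; linarith
  have h2 : |x| * Real.exp (-(x - 0) ^ 2 / (2 * ((1 : NNReal) : ℝ))) ≤ 1 := by
    have e : -(x - 0) ^ 2 / (2 * ((1 : NNReal) : ℝ)) = -(x ^ 2 / 2) := by simp; ring
    rw [e, Real.exp_neg, mul_inv_le_iff₀ (Real.exp_pos _), one_mul]
    have := Real.add_one_le_exp (x ^ 2 / 2)
    nlinarith [sq_nonneg (|x| - 1), sq_abs x]
  rw [abs_mul, abs_of_nonneg (gaussianPDFReal_nonneg 0 1 x), gaussianPDFReal]
  calc _ = (√(2 * Real.pi * ((1 : NNReal) : ℝ)))⁻¹ *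
        (|x| * Real.exp (-(x - 0) ^ 2 / (2 * ((1 : NNReal) : ℝ)))) := by ring
    _ ≤ 1 := mul_le_one₀ h1 (by positivity) h2

namespace IsTestFn

variable {g g' : ℝ → ℝ} {L : ℝ}

theorem nonneg (h : IsTestFn g g' L) : 0 ≤ L := (abs_nonneg _).trans (h.abs_le 0)

theorem mono (h : IsTestFn g g' L) {L' : ℝ} (hL : L ≤ L') : IsTestFn g g' L' where
  hasDerivAt := h.hasDerivAt
  abs_le x := (h.abs_le x).trans hL
  abs_deriv_le x := (h.abs_deriv_le x).trans hL
  lipschitz x y := (h.lipschitz x y).trans (by gcongr)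
  integral_eq_zero := h.integral_eq_zero

theorem continuous (h : IsTestFn g g' L) : Continuous g :=
  continuous_iff_continuousAt.2 fun x => (h.hasDerivAt x).continuousAt

theorem continuous_deriv (h : IsTestFn g g' L) : Continuous g' :=
  (LipschitzWith.of_dist_le_mul (K := ⟨L, h.nonneg⟩) fun x y => by
    exact h.lipschitz x y).continuous

theorem polyGrowth (h : IsTestFn g g' L) : PolyGrowth g :=
  .of_bounded h.continuous.measurable h.abs_le

theorem polyGrowth_deriv (h : IsTestFn g g' L) : PolyGrowth g' :=
  .of_bounded h.continuous_deriv.measurable h.abs_deriv_le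

/-- Identifies the mean of g', which a shift of the observations produces, with c₁. -/
theorem integral_deriv (h : IsTestFn g g' L) :
    ∫ x, g' x ∂gaussianReal 0 1 = ∫ x, g x * x ∂gaussianReal 0 1 :=
  integral_deriv_gaussian h.hasDerivAt h.polyGrowth h.polyGrowth_deriv

/-- Stein's identity for g(x)x; the extra term ∫ g vanishes since g is centred. The left side is
what a change of scale produces, the right side is c₂. -/
theorem integral_deriv_mul (h : IsTestFn g g' L) :
    ∫ x, g' x * x ∂gaussianReal 0 1 = ∫ x, g x * x ^ 2 ∂gaussianReal 0 1 := by
  have := integral_deriv_gaussian (f := fun x => g x * x) (f' := fun x => g' x * x + g x)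
    (fun x => by
      have := (h.hasDerivAt x).mul (hasDerivAt_id' x)
      rwa [mul_one] at this)
    (h.polyGrowth.mul .id) ((h.polyGrowth_deriv.mul .id).add h.polyGrowth)
  rw [integral_add (h.polyGrowth_deriv.mul .id).integrable h.polyGrowth.integrable,
    h.integral_eq_zero, add_zero] at this
  rw [this]
  congr with x
  ring

/-- Taylor's formula of order two. -/
theorem taylor (h : IsTestFn g g' L) (x y : ℝ) :
    |g y - g x - g' x * (y - x)| ≤ L * (y - x) ^ 2 := by
  have key : ∀ z ∈ Set.uIcc x y, ‖g' z - g' x‖ ≤ L * |y - x| := fun z hz => by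
    refine (h.lipschitz z x).trans ?_
    have : |z - x| ≤ |y - x| := Set.abs_sub_left_of_mem_uIcc hz
    have := h.nonneg
    gcongr
  -- Mean value inequality for z ↦ g z - g' x * z; the constant L instead of L/2 suffices.
  have := (convex_uIcc x y).norm_image_sub_le_of_norm_hasDerivWithin_le
    (f := fun z => g z - g' x * z) (f' := fun z => g' z - g' x)
    (fun z _ => by
      have := (h.hasDerivAt z).sub ((hasDerivAt_id' z).const_mul (g' x))
      rw [mul_one] at this
      exact this.hasDerivWithinAt)
    key Set.left_mem_uIcc Set.right_mem_uIcc
  rw [Real.norm_eq_abs, Real.norm_eq_abs, mul_assoc, abs_mul_abs_self] at this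
  calc _ = |g y - g' x * y - (g x - g' x * x)| := by congr 1; ring
    _ ≤ _ := this
    _ = _ := by ring

end IsTestFn

/-- With φ the normal density, (π_k ∘ Φ)' = π_k'(Φ)φ and (π_k ∘ Φ)'' = π_k''(Φ)φ² - π_k'(Φ)xφ are
bounded because φ and xφ are. Boundedness of π_k itself comes from its bounded derivative on (0, 1),
and centring is orthogonality to π_0 = 1. -/
theorem exists_isTestFn {K : ℕ} {π : ℕ → ℝ → ℝ} (hπ : IsOrthonormalSystem π)
    (hA2 : AssumptionA2 K π) {k : ℕ} (h1 : 1 ≤ k) (hk : k ≤ K) :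
    ∃ (g' : ℝ → ℝ) (L : ℝ), IsTestFn (fun x => π k (Phi x)) g' L := by
  obtain ⟨hd1, hd2, B, hB⟩ := hA2 k h1 hk
  have hB0 : 0 ≤ B := (abs_nonneg _).trans (hB (1 / 2) (by norm_num)).1
  have hder1 : ∀ z ∈ Set.Ioo (0 : ℝ) 1, HasDerivAt (π k) (deriv (π k) z) z := fun z hz =>
    ((hd1 z hz).differentiableAt (Ioo_mem_nhds hz.1 hz.2)).hasDerivAt
  have hder2 : ∀ z ∈ Set.Ioo (0 : ℝ) 1, HasDerivAt (deriv (π k)) (deriv (deriv (π k)) z) z :=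
    fun z hz => ((hd2 z hz).differentiableAt (Ioo_mem_nhds hz.1 hz.2)).hasDerivAt
  have hπb : ∀ z ∈ Set.Ioo (0 : ℝ) 1, |π k z| ≤ |π k (1 / 2)| + B := fun z hz => by
    have := (convex_Ioo (0 : ℝ) 1).norm_image_sub_le_of_norm_hasDerivWithin_le
      (f := π k) (fun z hz => (hder1 z hz).hasDerivWithinAt) (fun z hz => (hB z hz).1)
      (x := 1 / 2) (by norm_num) hz
    rw [Real.norm_eq_abs, Real.norm_eq_abs] at this
    have h2 : |z - 1 / 2| ≤ 1 := by rw [abs_le]; constructor <;> linarith [hz.1, hz.2]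
    have h3 := abs_sub_abs_le_abs_sub (π k z) (π k (1 / 2))
    nlinarith
  set p := gaussianPDFReal 0 1
  have hp : ∀ x, |p x| ≤ 1 := fun x => by
    rw [abs_of_nonneg (gaussianPDFReal_nonneg _ _ _)]; exact gaussianPDFReal_le_one x
  have hg : ∀ x, HasDerivAt (fun x => π k (Phi x)) (deriv (π k) (Phi x) * p x) x := fun x =>
    (hder1 _ (Phi_mem_Ioo x)).comp x (hasDerivAt_Phi x)
  have hg' : ∀ x, HasDerivAt (fun x => deriv (π k) (Phi x) * p x)
      (deriv (deriv (π k)) (Phi x) * p x * p x + deriv (π k) (Phi x) * -(x * p x)) x := fun x =>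
    ((hder2 _ (Phi_mem_Ioo x)).comp x (hasDerivAt_Phi x)).mul (hasDerivAt_gaussianPDFReal x)
  refine ⟨fun x => deriv (π k) (Phi x) * p x, |π k (1 / 2)| + 2 * B, ?_⟩
  refine ⟨hg, fun x => (hπb _ (Phi_mem_Ioo x)).trans (by linarith), fun x => ?_, fun x y => ?_, ?_⟩
  · rw [abs_mul]
    calc _ ≤ B * 1 := mul_le_mul (hB _ (Phi_mem_Ioo x)).1 (hp x) (abs_nonneg _) hB0
      _ ≤ _ := by linarith [abs_nonneg (π k (1 / 2))]
  · have := convex_univ.norm_image_sub_le_of_norm_hasDerivWithin_le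
      (C := |π k (1 / 2)| + 2 * B) (fun z _ => (hg' z).hasDerivWithinAt) (fun z _ => ?_)
      (Set.mem_univ y) (Set.mem_univ x)
    · exact this
    · rw [Real.norm_eq_abs]
      have a1 := (hB _ (Phi_mem_Ioo z)).1
      have a2 := (hB _ (Phi_mem_Ioo z)).2
      calc _ ≤ |deriv (deriv (π k)) (Phi z) * p z * p z| + |deriv (π k) (Phi z) * -(z * p z)| :=
            abs_add_le _ _
        _ = |deriv (deriv (π k)) (Phi z)| * |p z| * |p z| + |deriv (π k) (Phi z)| * |z * p z| := by
            rw [abs_mul, abs_mul, abs_mul, abs_neg]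
        _ ≤ B * 1 * 1 + B * 1 := by
            gcongr
            · exact hp z
            · exact hp z
            · exact abs_mul_gaussianPDFReal_le_one z
        _ ≤ _ := by linarith [abs_nonneg (π k (1 / 2))]
  · have h0 := (hπ.orthonormal k 0).trans (if_neg (by omega))
    rw [← integral_unit_eq]
    refine Eq.trans ?_ h0
    rw [intervalIntegral.integral_of_le zero_le_one, intervalIntegral.integral_of_le zero_le_one]
    refine setIntegral_congr_fun measurableSet_Ioc fun z hz => ?_
    simp [hπ.zero z ⟨hz.1.le, hz.2⟩]

/-! ### Expansion of the statistic in one group -/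

-- Taylor expansion of g at x, with increment (ρ - 1)x - ρd where ρ = v^(-1/2) and v is the mean of
-- (x - d)². Since ρ - 1 ≈ -(v - 1)/2 and n(v - 1) ≈ ∑ (x² - 1), replacing ∑ g'(x)x by n c₂ produces
-- the correction c₂(x² - 1)/2. The terms in c₁ cancel on the left, so c₁ is arbitrary here.
set_option maxHeartbeats 400000 in
theorem group_expansion {ι : Type*} {g g' : ℝ → ℝ} {L c₁ c₂ : ℝ} (hg : IsTestFn g g' L)
    (hc₂ : |c₂| ≤ L) (s : Finset ι) (x d : ι → ℝ) (hs : 0 < s.card)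
    (hT : |∑ a ∈ s, (x a ^ 2 - 1)| ≤ (s.card : ℝ) / 8) (hD : ∑ a ∈ s, d a ^ 2 ≤ (s.card : ℝ) / 64) :
    |∑ a ∈ s, (g ((x a - d a) / √((∑ a ∈ s, (x a - d a) ^ 2) / (s.card : ℝ))) - g (x a) + c₁ * d a
        + c₂ * (x a ^ 2 - 1) / 2) - c₂ * ∑ a ∈ s, x a * d a + ∑ a ∈ s, (g' (x a) - c₁) * d a| ≤
      (70 * L + 15) * ((∑ a ∈ s, (x a ^ 2 - 1)) ^ 2 / (s.card : ℝ) +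
        (∑ a ∈ s, (g' (x a) * x a - c₂)) ^ 2 / (s.card : ℝ) + ∑ a ∈ s, d a ^ 2) := by
  set n : ℝ := (s.card : ℝ)
  have hn : 0 < n := Nat.cast_pos.2 hs
  set T := ∑ a ∈ s, (x a ^ 2 - 1) with hTdef
  set H := ∑ a ∈ s, (g' (x a) * x a - c₂) with hHdef
  set D := ∑ a ∈ s, d a ^ 2
  set E := ∑ a ∈ s, x a * d a
  have hL := hg.nonneg
  have hD0 : 0 ≤ D := Finset.sum_nonneg fun _ _ => sq_nonneg _
  have hX : ∑ a ∈ s, x a ^ 2 = T + n := by simp [hTdef, Finset.sum_sub_distrib, n]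
  have hH : ∑ a ∈ s, g' (x a) * x a = H + n * c₂ := by
    simp [hHdef, Finset.sum_sub_distrib, n]
  have hXle : ∑ a ∈ s, x a ^ 2 ≤ 9 / 8 * n := by rw [hX]; linarith [(abs_le.1 hT).2]
  have hE2 : E ^ 2 ≤ 9 / 8 * n * D :=
    (Finset.sum_mul_sq_le_sq_mul_sq s x d).trans (by gcongr)
  set v := (∑ a ∈ s, (x a - d a) ^ 2) / n with hv
  have hnv : n * (v - 1) = T - 2 * E + D := by
    have : ∑ a ∈ s, (x a - d a) ^ 2 = T + n - 2 * E + D := by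
      rw [← hX, Finset.mul_sum, ← Finset.sum_sub_distrib, ← Finset.sum_add_distrib]
      exact Finset.sum_congr rfl fun a _ => by ring
    rw [hv, this]
    field_simp
    ring
  set q := v - 1 with hq
  -- E² ≤ 9n²/512 < n²/49. Together with the bounds on T and D this confines v to [1/2, 3/2], so the
  -- scale stays away from 0.
  have hEn : |E| ≤ n / 7 := by
    refine abs_le_of_sq_le_sq ?_ (by positivity)
    linarith [mul_le_mul_of_nonneg_left hD hn.le, sq_nonneg n]
  have hqn : |n * q| ≤ n * (1 / 2) := by
    rw [hnv]
    rw [abs_le] at hT hEn ⊢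
    constructor <;> linarith [hT.1, hT.2, hEn.1, hEn.2]
  have hqabs : |q| ≤ 1 / 2 := by
    rw [abs_mul, abs_of_pos hn] at hqn
    exact le_of_mul_le_mul_left hqn hn
  -- By (a + b + c)² ≤ 3(a² + b² + c²); the term 12E² contributes 27/2 to the coefficient of D and
  -- 3D² contributes 3/64.
  have hnq2 : n * q ^ 2 ≤ 3 * (T ^ 2 / n) + 14 * D := by
    have h1 : n * q ^ 2 = (T - 2 * E + D) ^ 2 / n := by rw [← hnv]; field_simp
    have h2 : (T - 2 * E + D) ^ 2 ≤ 3 * T ^ 2 + (12 * E ^ 2 + 3 * D ^ 2) := by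
      linarith [sq_nonneg (T + 2 * E), sq_nonneg (T - D), sq_nonneg (2 * E + D)]
    have h3 : D ^ 2 ≤ n / 64 * D := by
      rw [sq]; exact mul_le_mul_of_nonneg_right hD hD0
    rw [h1, div_le_iff₀ hn]
    have h4 : (3 * (T ^ 2 / n) + 14 * D) * n = 3 * T ^ 2 + 14 * D * n := by field_simp
    rw [h4]
    linarith [mul_nonneg hD0 hn.le]
  set τ := √v with hτ
  have hv1 : 1 / 2 ≤ v := by linarith [(abs_le.1 hqabs).1]
  have hτ2 : τ ^ 2 = v := Real.sq_sqrt (by linarith)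
  have hτ7 : 7 / 10 ≤ τ := Real.le_sqrt_of_sq_le (by linarith)
  have hτ0 : 0 < τ := by linarith
  set ρ := 1 / τ with hρ
  have hqτ : q = τ ^ 2 - 1 := by rw [hτ2]
  have hρ1 : |ρ - 1| ≤ |q| := by
    have : ρ - 1 = -q * (1 / (τ * (1 + τ))) := by rw [hqτ, hρ]; field_simp; ring
    rw [this, abs_mul, abs_neg]
    refine mul_le_of_le_one_right (abs_nonneg _) ?_
    rw [abs_of_nonneg (by positivity), div_le_one (by positivity)]
    have : 7 / 10 * (1 + τ) ≤ τ * (1 + τ) := by gcongr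
    linarith
  -- Second order expansion of v^(-1/2) at v = 1, with the exact remainder written in terms of τ =
  -- √v.
  have hρ2 : |ρ - 1 + q / 2| ≤ q ^ 2 := by
    have : ρ - 1 + q / 2 = q ^ 2 * ((τ + 2) / (2 * τ * (1 + τ) ^ 2)) := by
      rw [hqτ, hρ]; field_simp; ring
    rw [this, abs_mul, abs_of_nonneg (sq_nonneg q)]
    refine mul_le_of_le_one_right (sq_nonneg _) ?_
    rw [abs_of_nonneg (by positivity), div_le_one (by positivity)]
    have h1 : 17 / 10 * (1 + τ) ≤ (1 + τ) ^ 2 := by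
      rw [sq]; gcongr; linarith
    have h2 : 14 / 10 * (1 + τ) ^ 2 ≤ 2 * τ * (1 + τ) ^ 2 := by gcongr; linarith
    linarith
  have hρsq : ρ ^ 2 ≤ 21 / 10 := by
    rw [hρ, div_pow, div_le_iff₀ (by positivity), hτ2]
    linarith
  have hρq : (ρ - 1) ^ 2 ≤ q ^ 2 := sq_le_sq.2 hρ1
  set R : ι → ℝ := fun a =>
    g ((x a - d a) / τ) - g (x a) - g' (x a) * ((x a - d a) / τ - x a) with hR
  have hdiff : ∀ a, (x a - d a) / τ - x a = (ρ - 1) * x a - ρ * d a := fun a => by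
    rw [hρ]; field_simp; ring
  have hRsum : |∑ a ∈ s, R a| ≤ L * (9 / 4 * (n * q ^ 2) + 42 / 10 * D) := by
    have h1 : ∀ a, |R a| ≤ L * (2 * (q ^ 2 * x a ^ 2) + 42 / 10 * d a ^ 2) := fun a => by
      refine (hg.taylor _ _).trans ?_
      rw [hdiff]
      gcongr
      have e1 : ((ρ - 1) * x a - ρ * d a) ^ 2 ≤
          2 * ((ρ - 1) ^ 2 * x a ^ 2) + 2 * (ρ ^ 2 * d a ^ 2) := by
        linarith [sq_nonneg ((ρ - 1) * x a + ρ * d a)]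
      have e2 := mul_le_mul_of_nonneg_right hρq (sq_nonneg (x a))
      have e3 := mul_le_mul_of_nonneg_right hρsq (sq_nonneg (d a))
      linarith
    refine (Finset.abs_sum_le_sum_abs _ _).trans ((Finset.sum_le_sum fun a _ => h1 a).trans ?_)
    rw [← Finset.mul_sum, Finset.sum_add_distrib, ← Finset.mul_sum, ← Finset.mul_sum,
      ← Finset.mul_sum]
    refine mul_le_mul_of_nonneg_left ?_ hL
    linarith [mul_le_mul_of_nonneg_left hXle (sq_nonneg q)]
  set F' := ∑ a ∈ s, g' (x a) * d a with hF'
  have hF'2 : F' ^ 2 ≤ L ^ 2 * n * D := by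
    refine (Finset.sum_mul_sq_le_sq_mul_sq s (fun a => g' (x a)) d).trans ?_
    refine mul_le_mul_of_nonneg_right ?_ hD0
    calc ∑ a ∈ s, g' (x a) ^ 2 ≤ ∑ a ∈ s, L ^ 2 :=
          Finset.sum_le_sum fun a _ => sq_le_sq.2 (by
            rw [abs_of_nonneg hL]; exact hg.abs_deriv_le _)
      _ = L ^ 2 * n := by simp [n, mul_comm]
  have hqF : |(ρ - 1) * F'| ≤ L * (n * q ^ 2 + D) := by
    refine abs_le_of_sq_le_sq ?_ (by positivity)
    calc ((ρ - 1) * F') ^ 2 = (ρ - 1) ^ 2 * F' ^ 2 := by ring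
      _ ≤ q ^ 2 * (L ^ 2 * n * D) := by gcongr
      _ ≤ (L * (n * q ^ 2 + D)) ^ 2 := by
        have : 0 ≤ n * q ^ 2 := by positivity
        have h3 : n * q ^ 2 * D ≤ (n * q ^ 2 + D) ^ 2 := by
          linarith [mul_nonneg this hD0, sq_nonneg (n * q ^ 2), sq_nonneg D]
        linarith [mul_le_mul_of_nonneg_left h3 (sq_nonneg L)]
  have hqH : |(ρ - 1) * H| ≤ n * q ^ 2 + H ^ 2 / n := by
    refine abs_le_of_sq_le_sq ?_ (by positivity)
    have h0 : n * q ^ 2 * (H ^ 2 / n) = q ^ 2 * H ^ 2 := by field_simp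
    have h1 : 0 ≤ n * q ^ 2 := by positivity
    have h2 : 0 ≤ H ^ 2 / n := by positivity
    calc ((ρ - 1) * H) ^ 2 = (ρ - 1) ^ 2 * H ^ 2 := by ring
      _ ≤ q ^ 2 * H ^ 2 := by gcongr
      _ ≤ _ := by
        linarith [sq_nonneg (n * q ^ 2), sq_nonneg (H ^ 2 / n), mul_nonneg h1 h2]
  -- Exact decomposition: Taylor remainder, fluctuation of g'(x)x about c₂, second order error of ρ,
  -- and products of small terms. Only the linear parts in q and d have been moved to the left.
  have hid : ∑ a ∈ s, (g ((x a - d a) / τ) - g (x a) + c₁ * d a + c₂ * (x a ^ 2 - 1) / 2)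
      - c₂ * E + ∑ a ∈ s, (g' (x a) - c₁) * d a =
      ∑ a ∈ s, R a + (ρ - 1) * H + c₂ * (n * (ρ - 1 + q / 2)) - c₂ / 2 * D - (ρ - 1) * F' := by
    have e1 : ∑ a ∈ s, (g ((x a - d a) / τ) - g (x a) + c₁ * d a + c₂ * (x a ^ 2 - 1) / 2) =
        ∑ a ∈ s, R a + ((ρ - 1) * ∑ a ∈ s, g' (x a) * x a - ρ * F') + c₁ * ∑ a ∈ s, d a
          + c₂ / 2 * T := by
      rw [hTdef, hF', Finset.mul_sum, Finset.mul_sum, Finset.mul_sum, Finset.mul_sum,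
        ← Finset.sum_sub_distrib, ← Finset.sum_add_distrib, ← Finset.sum_add_distrib,
        ← Finset.sum_add_distrib]
      refine Finset.sum_congr rfl fun a _ => ?_
      simp only [hR, hdiff]
      ring
    have e2 : ∑ a ∈ s, (g' (x a) - c₁) * d a = F' - c₁ * ∑ a ∈ s, d a := by
      rw [hF', Finset.mul_sum, ← Finset.sum_sub_distrib]
      exact Finset.sum_congr rfl fun a _ => by ring
    rw [e1, e2, hH]
    linear_combination (-c₂ / 2) * hnv
  rw [hid]
  have hc2a : |c₂ * (n * (ρ - 1 + q / 2))| ≤ L * (n * q ^ 2) := by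
    rw [abs_mul, abs_mul, abs_of_pos hn]
    gcongr
  have hc2b : |c₂ / 2 * D| ≤ L * D := by
    rw [abs_mul, abs_of_nonneg hD0, abs_div, abs_two]
    gcongr
    linarith [abs_nonneg c₂]
  have htri : |∑ a ∈ s, R a + (ρ - 1) * H + c₂ * (n * (ρ - 1 + q / 2)) - c₂ / 2 * D
      - (ρ - 1) * F'| ≤ |∑ a ∈ s, R a| + |(ρ - 1) * H| + |c₂ * (n * (ρ - 1 + q / 2))|
        + |c₂ / 2 * D| + |(ρ - 1) * F'| := by
    refine (abs_sub _ _).trans ?_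
    gcongr
    refine (abs_sub _ _).trans ?_
    gcongr
    exact abs_add_three _ _ _
  refine htri.trans ?_
  have hTn : 0 ≤ T ^ 2 / n := by positivity
  have hHn : 0 ≤ H ^ 2 / n := by positivity
  -- The total factor of n q² is 17/4 L + 1, so D receives at most (17/4 · 14 + 31/5)L + 14 ≤ 70L +
  -- 15.
  have hLq := mul_le_mul_of_nonneg_left hnq2 hL
  linarith [mul_nonneg hL hTn, mul_nonneg hL hHn, mul_nonneg hL hD0]

/-! ### Moments -/

theorem integral_centred_sq {f : ℝ → ℝ} (hf : PolyGrowth f) {c : ℝ}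
    (hc : ∫ x, f x ∂gaussianReal 0 1 = c) :
    ∫ x, (f x - c) ^ 2 ∂gaussianReal 0 1 = ∫ x, f x ^ 2 ∂gaussianReal 0 1 - c ^ 2 := by
  have h : ∀ x, (f x - c) ^ 2 = f x ^ 2 - 2 * c * f x + c ^ 2 := fun x => by ring
  simp_rw [h]
  rw [integral_add ((hf.pow 2).sub (hf.const_mul _)).integrable (integrable_const _),
    integral_sub (hf.pow 2).integrable (hf.const_mul _).integrable, integral_const_mul, hc]
  simp
  ring

theorem integral_centred {f : ℝ → ℝ} (hf : PolyGrowth f) {c : ℝ}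
    (hc : ∫ x, f x ∂gaussianReal 0 1 = c) : ∫ x, (f x - c) ∂gaussianReal 0 1 = 0 := by
  rw [integral_sub hf.integrable (integrable_const _), hc]
  simp

theorem integral_sq_sub_one : ∫ x, (x ^ 2 - 1) ∂gaussianReal 0 1 = 0 :=
  integral_centred (.pow .id 2) integral_gaussian_sq

theorem integral_sq_sub_one_sq : ∫ x, (x ^ 2 - 1) ^ 2 ∂gaussianReal 0 1 = 2 := by
  rw [integral_centred_sq (.pow .id 2) integral_gaussian_sq]
  simp_rw [← pow_mul]
  rw [integral_gaussian_fourth]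
  norm_num

namespace IsTestFn

variable {g g' : ℝ → ℝ} {L : ℝ}

/-- Supplies the hypothesis on c₂ in `group_expansion`, since E X² = 1. -/
theorem abs_integral_mul_sq_le (h : IsTestFn g g' L) :
    |∫ x, g x * x ^ 2 ∂gaussianReal 0 1| ≤ L := by
  refine (abs_integral_le_integral_abs).trans ?_
  calc ∫ x, |g x * x ^ 2| ∂gaussianReal 0 1 ≤ ∫ x, L * x ^ 2 ∂gaussianReal 0 1 := by
        refine integral_mono (h.polyGrowth.mul (.pow .id 2)).abs.integrable
          (PolyGrowth.const_mul L (.pow .id 2)).integrable fun x => ?_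
        simp only
        rw [abs_mul, abs_of_nonneg (sq_nonneg x)]
        exact mul_le_mul_of_nonneg_right (h.abs_le x) (sq_nonneg x)
    _ = L := by rw [integral_const_mul, integral_gaussian_sq, mul_one]

/-- A variance is at most the second moment. This bounds the fluctuation of g'(X) about c₁; the
analogue for g'(X)X about c₂ follows. -/
theorem integral_deriv_centred_sq_le (h : IsTestFn g g' L) :
    ∫ x, (g' x - ∫ y, g y * y ∂gaussianReal 0 1) ^ 2 ∂gaussianReal 0 1 ≤ L ^ 2 := by
  rw [integral_centred_sq h.polyGrowth_deriv h.integral_deriv]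
  refine (sub_le_self _ (sq_nonneg _)).trans ?_
  calc ∫ x, g' x ^ 2 ∂gaussianReal 0 1 ≤ ∫ _, L ^ 2 ∂gaussianReal 0 1 :=
        integral_mono (h.polyGrowth_deriv.pow 2).integrable (integrable_const _) fun x =>
          sq_le_sq.2 ((h.abs_deriv_le x).trans (le_abs_self _))
    _ = L ^ 2 := by simp

theorem integral_deriv_mul_centred_sq_le (h : IsTestFn g g' L) :
    ∫ x, (g' x * x - ∫ y, g y * y ^ 2 ∂gaussianReal 0 1) ^ 2 ∂gaussianReal 0 1 ≤ L ^ 2 := by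
  rw [integral_centred_sq (h.polyGrowth_deriv.mul .id) h.integral_deriv_mul]
  refine (sub_le_self _ (sq_nonneg _)).trans ?_
  calc ∫ x, (g' x * x) ^ 2 ∂gaussianReal 0 1 ≤ ∫ x, L ^ 2 * x ^ 2 ∂gaussianReal 0 1 := by
        refine integral_mono ((h.polyGrowth_deriv.mul .id).pow 2).integrable
          (PolyGrowth.const_mul _ (.pow .id 2)).integrable fun x => ?_
        simp only
        rw [mul_pow]
        exact mul_le_mul_of_nonneg_right (sq_le_sq.2 ((h.abs_deriv_le x).trans (le_abs_self _)))
          (sq_nonneg x)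
    _ = L ^ 2 := by rw [integral_const_mul, integral_gaussian_sq, mul_one]

end IsTestFn

/-- A finite family of independent standard normal variables. -/
structure IsGaussianSample {ι Ω : Type*} [MeasurableSpace Ω] (X : ι → Ω → ℝ) (P : Measure Ω) :
    Prop where
  indep : iIndepFun X P
  law : ∀ a, HasLaw (X a) (gaussianReal 0 1) P

namespace IsGaussianSample

variable {ι Ω : Type*} [MeasurableSpace Ω] {X : ι → Ω → ℝ} {P : Measure Ω}

theorem integrable_comp (hX : IsGaussianSample X P) (a : ι) {f : ℝ → ℝ} (hf : PolyGrowth f) :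
    Integrable (fun ω => f (X a ω)) P := by
  have h := hf.integrable
  rw [← (hX.law a).map_eq] at h
  exact h.comp_aemeasurable (hX.law a).aemeasurable

theorem integral_comp (hX : IsGaussianSample X P) (a : ι) {f : ℝ → ℝ} (hf : Measurable f) :
    ∫ ω, f (X a ω) ∂P = ∫ x, f x ∂gaussianReal 0 1 :=
  (hX.law a).integral_comp hf.aestronglyMeasurable

theorem memLp_comp (hX : IsGaussianSample X P) (a : ι) {f : ℝ → ℝ} (hf : PolyGrowth f) :
    MemLp (fun ω => f (X a ω)) 2 P :=
  (memLp_two_iff_integrable_sq (hX.integrable_comp a hf).aestronglyMeasurable).2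
    (hX.integrable_comp a (hf.pow 2))

theorem memLp_sum (hX : IsGaussianSample X P) {f : ℝ → ℝ} (hf : PolyGrowth f) (s : Finset ι)
    (w : ι → ℝ) : MemLp (fun ω => ∑ a ∈ s, w a * f (X a ω)) 2 P :=
  memLp_finsetSum s fun a _ => (hX.memLp_comp a hf).const_mul (w a)

theorem integrable_sum_sq (hX : IsGaussianSample X P) {f : ℝ → ℝ} (hf : PolyGrowth f)
    (s : Finset ι) (w : ι → ℝ) : Integrable (fun ω => (∑ a ∈ s, w a * f (X a ω)) ^ 2) P :=
  (hX.memLp_sum hf s w).integrable_sq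

/-- Independence and centring remove the cross terms. All orders of magnitude in the remainder come
from this formula. -/
theorem integral_sum_sq (hX : IsGaussianSample X P) {f : ℝ → ℝ} (hf : PolyGrowth f)
    (h0 : ∫ x, f x ∂gaussianReal 0 1 = 0) (s : Finset ι) (w : ι → ℝ) :
    ∫ ω, (∑ a ∈ s, w a * f (X a ω)) ^ 2 ∂P =
      (∑ a ∈ s, w a ^ 2) * ∫ x, f x ^ 2 ∂gaussianReal 0 1 := by
  have hm : ∀ a, ∫ ω, w a * f (X a ω) ∂P = 0 := fun a => by
    rw [integral_const_mul, hX.integral_comp a hf.1, h0, mul_zero]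
  have hL : ∀ a, MemLp (fun ω => w a * f (X a ω)) 2 P := fun a =>
    (hX.memLp_comp a hf).const_mul (w a)
  have hP := hX.indep.isProbabilityMeasure
  have hS : ∫ ω, (∑ a ∈ s, fun ω => w a * f (X a ω)) ω ∂P = 0 := by
    simp only [Finset.sum_apply]
    rw [integral_finsetSum s fun a _ => (hL a).integrable one_le_two]
    exact Finset.sum_eq_zero fun a _ => hm a
  have hv := IndepFun.variance_sum (μ := P) (X := fun a ω => w a * f (X a ω)) (s := s)
    (fun a _ => hL a) fun a _ b _ hab => (hX.indep.indepFun hab).comp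
      (φ := fun x => w a * f x) (ψ := fun x => w b * f x)
      (hf.1.const_mul _) (hf.1.const_mul _)
  rw [variance_of_integral_eq_zero (Finset.aemeasurable_sum s fun a _ => (hL a).aemeasurable) hS]
    at hv
  simp only [Finset.sum_apply] at hv
  rw [hv, Finset.sum_mul]
  refine Finset.sum_congr rfl fun a _ => ?_
  rw [variance_of_integral_eq_zero (hL a).aemeasurable (hm a)]
  simp_rw [mul_pow]
  rw [integral_const_mul, hX.integral_comp a (hf.pow 2).1]

theorem integrable_sum_sq' (hX : IsGaussianSample X P) {f : ℝ → ℝ} (hf : PolyGrowth f)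
    (s : Finset ι) : Integrable (fun ω => (∑ a ∈ s, f (X a ω)) ^ 2) P := by
  simpa using hX.integrable_sum_sq hf s fun _ => 1

theorem integral_sum_sq' (hX : IsGaussianSample X P) {f : ℝ → ℝ} (hf : PolyGrowth f)
    (h0 : ∫ x, f x ∂gaussianReal 0 1 = 0) (s : Finset ι) :
    ∫ ω, (∑ a ∈ s, f (X a ω)) ^ 2 ∂P = s.card * ∫ x, f x ^ 2 ∂gaussianReal 0 1 := by
  simpa using hX.integral_sum_sq hf h0 s fun _ => 1

end IsGaussianSample

theorem measureReal_le_div {Ω : Type*} [MeasurableSpace Ω] {P : Measure Ω} {Q : Ω → ℝ}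
    (hQ0 : ∀ ω, 0 ≤ Q ω) (hQ : Integrable Q P) {ε : ℝ} (hε : 0 < ε) :
    P.real {ω | ε ≤ Q ω} ≤ (∫ ω, Q ω ∂P) / ε := by
  rw [le_div_iff₀' hε]
  exact mul_meas_ge_le_integral_of_nonneg (ae_of_all _ hQ0) hQ ε

theorem measureReal_iUnion_le' {Ω κ : Type*} [Fintype κ] [MeasurableSpace Ω] {P : Measure Ω}
    [IsProbabilityMeasure P] (A : κ → Set Ω) : P.real (⋃ k, A k) ≤ ∑ k, P.real (A k) := by
  simpa using measureReal_iUnion_fintype_le A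

/-! ### The remainder of the expansion -/

section Remainder

variable {ι κ Ω : Type*} [Fintype ι] [Fintype κ] [DecidableEq κ] [MeasurableSpace Ω]
  {X : ι → Ω → ℝ} {P : Measure Ω} {g g' : ℝ → ℝ} {L : ℝ}

/-- The observations in group `k`. -/
def fiber (r : ι → κ) (k : κ) : Finset ι := Finset.univ.filter fun a => r a = k

theorem sum_fiber (r : ι → κ) (f : ι → ℝ) : ∑ k, ∑ a ∈ fiber r k, f a = ∑ a, f a :=
  Finset.sum_fiberwise _ _ _

theorem sum_card_fiber (r : ι → κ) : ∑ k, ((fiber r k).card : ℝ) = Fintype.card ι := by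
  have := sum_fiber r fun _ => 1
  simpa using this

/-- Standardization with centres `d` and with a common scale in each group. -/
noncomputable def standardize (r : ι → κ) (x d : ι → ℝ) (a : ι) : ℝ :=
  (x a - d a) / √((∑ b ∈ fiber r (r a), (x b - d b) ^ 2) / ((fiber r (r a)).card : ℝ))

/-- The remainder of the first order expansion of the sum of `g` over standardized observations. -/
noncomputable def remainder (g : ℝ → ℝ) (r : ι → κ) (x d : ι → ℝ) : ℝ :=
  ∑ a, (g (standardize r x d a) - g (x a) + (∫ y, g y * y ∂gaussianReal 0 1) * d a
    + (∫ y, g y * y ^ 2 ∂gaussianReal 0 1) * (x a ^ 2 - 1) / 2)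

/-- Sums `group_expansion` over the groups. The terms linear in d are added up before absolute
values are taken, which retains cancellation between groups. -/
theorem remainder_le (hg : IsTestFn g g' L) (r : ι → κ) (x d : ι → ℝ)
    (hr : ∀ k, 0 < (fiber r k).card)
    (hT : ∀ k, |∑ a ∈ fiber r k, (x a ^ 2 - 1)| ≤ ((fiber r k).card : ℝ) / 8)
    (hD : ∀ k, ∑ a ∈ fiber r k, d a ^ 2 ≤ ((fiber r k).card : ℝ) / 64) :
    |remainder g r x d| ≤ (71 * L + 16) *
      (∑ k, ((∑ a ∈ fiber r k, (x a ^ 2 - 1)) ^ 2 / ((fiber r k).card : ℝ) +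
        (∑ a ∈ fiber r k, (g' (x a) * x a - ∫ y, g y * y ^ 2 ∂gaussianReal 0 1)) ^ 2 /
          ((fiber r k).card : ℝ)) + (∑ a, d a ^ 2 + |∑ a, x a * d a| +
            |∑ a, (g' (x a) - ∫ y, g y * y ∂gaussianReal 0 1) * d a|)) := by
  have hL := hg.nonneg
  have hc := hg.abs_integral_mul_sq_le
  set c₁ := ∫ y, g y * y ∂gaussianReal 0 1
  set c₂ := ∫ y, g y * y ^ 2 ∂gaussianReal 0 1
  set T : κ → ℝ := fun k => (∑ a ∈ fiber r k, (x a ^ 2 - 1)) ^ 2 / ((fiber r k).card : ℝ)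
  set H : κ → ℝ := fun k => (∑ a ∈ fiber r k, (g' (x a) * x a - c₂)) ^ 2 /
    ((fiber r k).card : ℝ)
  set D := ∑ a, d a ^ 2
  set E := ∑ a, x a * d a
  set F := ∑ a, (g' (x a) - c₁) * d a
  have hTH : 0 ≤ ∑ k, (T k + H k) := Finset.sum_nonneg fun k _ => by positivity
  have hgroup : ∀ k, |∑ a ∈ fiber r k, (g (standardize r x d a) - g (x a) + c₁ * d a
      + c₂ * (x a ^ 2 - 1) / 2) - c₂ * ∑ a ∈ fiber r k, x a * d a
      + ∑ a ∈ fiber r k, (g' (x a) - c₁) * d a| ≤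
      (70 * L + 15) * (T k + H k + ∑ a ∈ fiber r k, d a ^ 2) := fun k => by
    have := group_expansion (c₁ := c₁) hg hc (fiber r k) x d (hr k) (hT k) (hD k)
    have e : ∑ a ∈ fiber r k, (g (standardize r x d a) - g (x a) + c₁ * d a
        + c₂ * (x a ^ 2 - 1) / 2) = ∑ a ∈ fiber r k, (g ((x a - d a) /
          √((∑ b ∈ fiber r k, (x b - d b) ^ 2) / ((fiber r k).card : ℝ))) - g (x a) + c₁ * d a
        + c₂ * (x a ^ 2 - 1) / 2) := by
      refine Finset.sum_congr rfl fun a ha => ?_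
      have hk : r a = k := by simpa [fiber] using ha
      rw [standardize, hk]
    rw [e]
    exact this
  have htot : |remainder g r x d - c₂ * E + F| ≤
      (70 * L + 15) * (∑ k, (T k + H k) + D) := by
    have e : remainder g r x d - c₂ * E + F = ∑ k, (∑ a ∈ fiber r k,
        (g (standardize r x d a) - g (x a) + c₁ * d a
        + c₂ * (x a ^ 2 - 1) / 2) - c₂ * ∑ a ∈ fiber r k, x a * d a
        + ∑ a ∈ fiber r k, (g' (x a) - c₁) * d a) := by
      rw [Finset.sum_add_distrib, Finset.sum_sub_distrib, ← Finset.mul_sum, sum_fiber, sum_fiber,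
        sum_fiber]
      rfl
    rw [e]
    refine (Finset.abs_sum_le_sum_abs _ _).trans ((Finset.sum_le_sum fun k _ => hgroup k).trans ?_)
    rw [← Finset.mul_sum, Finset.sum_add_distrib, sum_fiber]
  have hD0 : 0 ≤ D := Finset.sum_nonneg fun _ _ => sq_nonneg _
  have hcE : |c₂ * E| ≤ L * |E| := by rw [abs_mul]; gcongr
  have h1 : |remainder g r x d| ≤ |remainder g r x d - c₂ * E + F| + |c₂ * E| + |F| := by
    have : remainder g r x d = (remainder g r x d - c₂ * E + F) + c₂ * E - F := by ring
    calc |remainder g r x d| = |(remainder g r x d - c₂ * E + F) + c₂ * E - F| := by rw [← this]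
      _ ≤ _ := (abs_sub _ _).trans (by gcongr; exact abs_add_le _ _)
  have hE0 := abs_nonneg E
  have hF0 := abs_nonneg F
  linarith [mul_nonneg hL hE0, mul_nonneg hL hF0, mul_nonneg hL hTH, mul_nonneg hL hD0]

/-- A bound in probability for the remainder. -/
theorem measureReal_remainder_le [IsProbabilityMeasure P] (hX : IsGaussianSample X P)
    (hg : IsTestFn g g' L) (r : ι → κ) (hr : ∀ k, 0 < (fiber r k).card) (d : ι → Ω → ℝ)
    {Q : Ω → ℝ} (hQ : Integrable Q P)
    (hdQ : ∀ ω, ∑ a, d a ω ^ 2 + |∑ a, X a ω * d a ω| +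
      |∑ a, (g' (X a ω) - ∫ y, g y * y ∂gaussianReal 0 1) * d a ω| ≤ Q ω)
    {B : Set Ω} (hB : ∀ ω, ω ∉ B → ∀ k, ∑ a ∈ fiber r k, d a ω ^ 2 ≤ ((fiber r k).card : ℝ) / 64)
    {ε : ℝ} (hε : 0 < ε) :
    P.real {ω | ε ≤ |remainder g r (fun a => X a ω) fun a => d a ω|} ≤
      P.real B + ∑ k, 128 / ((fiber r k).card : ℝ) +
        (71 * L + 16) * ((2 + L ^ 2) * Fintype.card κ + ∫ ω, Q ω ∂P) / ε := by
  have hL := hg.nonneg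
  set c₂ := ∫ y, g y * y ^ 2 ∂gaussianReal 0 1
  have hsq : PolyGrowth fun x : ℝ => x ^ 2 - 1 := (PolyGrowth.pow .id 2).sub (.const 1)
  have hgx : PolyGrowth fun x => g' x * x - c₂ := (hg.polyGrowth_deriv.mul .id).sub (.const _)
  set T : κ → Ω → ℝ := fun k ω => ∑ a ∈ fiber r k, (X a ω ^ 2 - 1)
  set H : κ → Ω → ℝ := fun k ω => ∑ a ∈ fiber r k, (g' (X a ω) * X a ω - c₂)
  have hTi : ∀ k, Integrable (fun ω => T k ω ^ 2) P := fun k => hX.integrable_sum_sq' hsq _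
  have hHi : ∀ k, Integrable (fun ω => H k ω ^ 2) P := fun k => hX.integrable_sum_sq' hgx _
  have hT2 : ∀ k, ∫ ω, T k ω ^ 2 ∂P = (fiber r k).card * 2 := fun k => by
    rw [hX.integral_sum_sq' hsq integral_sq_sub_one, integral_sq_sub_one_sq]
  have hH2 : ∀ k, ∫ ω, H k ω ^ 2 ∂P ≤ (fiber r k).card * L ^ 2 := fun k => by
    rw [hX.integral_sum_sq' hgx
      (integral_centred (hg.polyGrowth_deriv.mul .id) hg.integral_deriv_mul)]
    exact mul_le_mul_of_nonneg_left hg.integral_deriv_mul_centred_sq_le (Nat.cast_nonneg _)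
  have hn : ∀ k, (0 : ℝ) < (fiber r k).card := fun k => Nat.cast_pos.2 (hr k)
  set W : Ω → ℝ := fun ω => (71 * L + 16) *
    (∑ k, (T k ω ^ 2 / ((fiber r k).card : ℝ) + H k ω ^ 2 / ((fiber r k).card : ℝ)) + Q ω)
  have hQ0 : ∀ ω, 0 ≤ Q ω := fun ω => by
    refine le_trans ?_ (hdQ ω)
    have : 0 ≤ ∑ a, d a ω ^ 2 := Finset.sum_nonneg fun _ _ => sq_nonneg _
    positivity
  have hW0 : ∀ ω, 0 ≤ W ω := fun ω =>
    mul_nonneg (by positivity)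
      (add_nonneg (Finset.sum_nonneg fun k _ => by positivity) (hQ0 ω))
  have hTHi : ∀ k, Integrable (fun ω => T k ω ^ 2 / ((fiber r k).card : ℝ) +
      H k ω ^ 2 / ((fiber r k).card : ℝ)) P := fun k => ((hTi k).div_const _).add ((hHi k).div_const _)
  have hsi : Integrable (fun ω => ∑ k, (T k ω ^ 2 / ((fiber r k).card : ℝ) +
      H k ω ^ 2 / ((fiber r k).card : ℝ))) P :=
    integrable_finsetSum _ fun k _ => hTHi k
  have hWi : Integrable W P := (hsi.add hQ).const_mul _
  have hWint : ∫ ω, W ω ∂P ≤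
      (71 * L + 16) * ((2 + L ^ 2) * Fintype.card κ + ∫ ω, Q ω ∂P) := by
    rw [integral_const_mul, integral_add hsi hQ, integral_finsetSum _ fun k _ => hTHi k]
    have : ∑ k, ∫ ω, (T k ω ^ 2 / ((fiber r k).card : ℝ) + H k ω ^ 2 / ((fiber r k).card : ℝ)) ∂P
        ≤ ∑ _k : κ, (2 + L ^ 2) := by
      refine Finset.sum_le_sum fun k _ => ?_
      rw [integral_add ((hTi k).div_const _) ((hHi k).div_const _), integral_div, integral_div,
        hT2]
      have h1 : ((fiber r k).card : ℝ) * 2 / (fiber r k).card = 2 := by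
        field_simp [(hn k).ne']
      have h2 : (∫ ω, H k ω ^ 2 ∂P) / ((fiber r k).card : ℝ) ≤ L ^ 2 := by
        rw [div_le_iff₀ (hn k), mul_comm]
        exact hH2 k
      linarith
    rw [Finset.sum_const, Finset.card_univ, nsmul_eq_mul, mul_comm (Fintype.card κ : ℝ)] at this
    gcongr
  -- Chebyshev's inequality with E T² = 2n gives 2n/(n/8)² = 128/n.
  set A : κ → Set Ω := fun k => {ω | ((fiber r k).card / 8 : ℝ) ^ 2 ≤ T k ω ^ 2}
  have hA : ∀ k, P.real (A k) ≤ 128 / ((fiber r k).card : ℝ) := fun k => by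
    have h1 := hn k
    refine (measureReal_le_div (fun ω => sq_nonneg (T k ω)) (hTi k) (by positivity)).trans ?_
    rw [hT2]
    apply le_of_eq
    field_simp
    norm_num
  -- Off B and all A k the hypotheses of `remainder_le` hold and the remainder is at most W, to
  -- which Markov's inequality applies.
  have hsub : {ω | ε ≤ |remainder g r (fun a => X a ω) fun a => d a ω|} ⊆
      (B ∪ ⋃ k, A k) ∪ {ω | ε ≤ W ω} := by
    intro ω hω
    by_contra hcon
    simp only [Set.mem_union, Set.mem_iUnion, Set.mem_ofPred_eq, not_or, not_exists, A] at hcon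
    obtain ⟨⟨hωB, hωA⟩, hωW⟩ := hcon
    refine hωW (le_trans hω ?_)
    refine (remainder_le hg r _ _ hr (fun k => ?_) (hB ω hωB)).trans ?_
    · have h1 := (hωA k)
      have h2 := hn k
      exact abs_le_of_sq_le_sq (le_of_not_ge h1) (by positivity)
    · have := hdQ ω
      simp only [W]
      gcongr
  calc P.real {ω | ε ≤ |remainder g r (fun a => X a ω) fun a => d a ω|}
      ≤ P.real ((B ∪ ⋃ k, A k) ∪ {ω | ε ≤ W ω}) := measureReal_mono hsub
    _ ≤ (P.real B + ∑ k, P.real (A k)) + P.real {ω | ε ≤ W ω} := by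
        refine (measureReal_union_le _ _).trans ?_
        gcongr
        refine (measureReal_union_le _ _).trans ?_
        gcongr
        exact measureReal_iUnion_le' A
    _ ≤ _ := by
        refine add_le_add (add_le_add le_rfl (Finset.sum_le_sum fun k _ => hA k)) ?_
        refine (measureReal_le_div hW0 hWi hε).trans ?_
        gcongr

end Remainder

/-! ### Remainder bounds for the two kinds of estimated centres. -/

section Centres

variable {ι κ Ω : Type*} [Fintype ι] [Fintype κ] [DecidableEq κ] [MeasurableSpace Ω]
  {X : ι → Ω → ℝ} {P : Measure Ω} {g g' : ℝ → ℝ} {L : ℝ}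

theorem sum_mul_comp (r : ι → κ) (f : ι → ℝ) (h : κ → ℝ) :
    ∑ a, f a * h (r a) = ∑ k, (∑ a ∈ fiber r k, f a) * h k := by
  rw [← sum_fiber r]
  refine Finset.sum_congr rfl fun k _ => ?_
  rw [Finset.sum_mul]
  refine Finset.sum_congr rfl fun a ha => ?_
  have hk : r a = k := by simpa [fiber] using ha
  rw [hk]

theorem sum_comp (r : ι → κ) (h : κ → ℝ) :
    ∑ a, h (r a) = ∑ k, ((fiber r k).card : ℝ) * h k := by
  simpa using sum_mul_comp r (fun _ => 1) h

/-- Group means. -/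
noncomputable def fiberMean (r : ι → κ) (x : ι → ℝ) (k : κ) : ℝ :=
  (∑ a ∈ fiber r k, x a) / ((fiber r k).card : ℝ)

theorem sum_fiberMean (r : ι → κ) (hr : ∀ k, 0 < (fiber r k).card) (x : ι → ℝ) :
    ∑ a, fiberMean r x (r a) = ∑ a, x a := by
  rw [sum_comp, ← sum_fiber r x]
  refine Finset.sum_congr rfl fun k _ => ?_
  have : ((fiber r k).card : ℝ) ≠ 0 := Nat.cast_ne_zero.2 (hr k).ne'
  rw [fiberMean]
  field_simp

/-- The remainder when the observations are centred at the means of the groups given by `r` and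
standardized with one common scale. -/
theorem measureReal_remainder_groupMeans_le [IsProbabilityMeasure P] (hX : IsGaussianSample X P)
    (hg : IsTestFn g g' L) (r : ι → κ) (hr : ∀ k, 0 < (fiber r k).card) (hι : 0 < Fintype.card ι)
    {ε : ℝ} (hε : 0 < ε) :
    P.real {ω | ε ≤ |remainder g (fun _ => ()) (fun a => X a ω)
        fun a => fiberMean r (fun b => X b ω) (r a)|} ≤
      64 * Fintype.card κ / Fintype.card ι + 128 / Fintype.card ι +
        (71 * L + 16) * ((2 + L ^ 2) + (3 + L ^ 2) * Fintype.card κ) / ε := by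
  have hL := hg.nonneg
  set c₁ := ∫ y, g y * y ∂gaussianReal 0 1
  have hn : ∀ k, (0 : ℝ) < (fiber r k).card := fun k => Nat.cast_pos.2 (hr k)
  have hN : (0 : ℝ) < Fintype.card ι := Nat.cast_pos.2 hι
  set S : κ → Ω → ℝ := fun k ω => ∑ a ∈ fiber r k, X a ω with hS
  set G : κ → Ω → ℝ := fun k ω => ∑ a ∈ fiber r k, (g' (X a ω) - c₁)
  have hgc : PolyGrowth fun x => g' x - c₁ := hg.polyGrowth_deriv.sub (.const _)
  have hSi : ∀ k, Integrable (fun ω => S k ω ^ 2) P := fun k => hX.integrable_sum_sq' .id _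
  have hGi : ∀ k, Integrable (fun ω => G k ω ^ 2) P := fun k => hX.integrable_sum_sq' hgc _
  have hS2 : ∀ k, ∫ ω, S k ω ^ 2 ∂P = (fiber r k).card := fun k => by
    rw [hX.integral_sum_sq' .id integral_gaussian_one, integral_gaussian_sq, mul_one]
  have hG2 : ∀ k, ∫ ω, G k ω ^ 2 ∂P ≤ (fiber r k).card * L ^ 2 := fun k => by
    rw [hX.integral_sum_sq' hgc (integral_centred hg.polyGrowth_deriv hg.integral_deriv)]
    exact mul_le_mul_of_nonneg_left hg.integral_deriv_centred_sq_le (Nat.cast_nonneg _)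
  set D : Ω → ℝ := fun ω => ∑ k, S k ω ^ 2 / ((fiber r k).card : ℝ)
  have hD0 : ∀ ω, 0 ≤ D ω := fun ω => Finset.sum_nonneg fun k _ => by positivity
  have hDi : Integrable D P := integrable_finsetSum _ fun k _ => (hSi k).div_const _
  have hDint : ∫ ω, D ω ∂P = Fintype.card κ := by
    rw [integral_finsetSum _ fun k _ => (hSi k).div_const _]
    simp_rw [integral_div, hS2]
    simp [(hn _).ne']
  set V : Ω → ℝ := fun ω => ∑ k, G k ω ^ 2 / ((fiber r k).card : ℝ)
  have hVi : Integrable V P := integrable_finsetSum _ fun k _ => (hGi k).div_const _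
  have hVint : ∫ ω, V ω ∂P ≤ L ^ 2 * Fintype.card κ := by
    rw [integral_finsetSum _ fun k _ => (hGi k).div_const _]
    refine (Finset.sum_le_sum (g := fun _ => L ^ 2) fun k _ => ?_).trans ?_
    · rw [integral_div, div_le_iff₀ (hn k), mul_comm]
      exact hG2 k
    · simp [mul_comm]
  -- The vector of group means is the orthogonal projection of x onto functions constant on groups,
  -- so ∑ d² and ∑ x d both equal D, whose mean is the number of groups.
  have hdd : ∀ ω, ∑ a, fiberMean r (fun b => X b ω) (r a) ^ 2 = D ω := fun ω => by
    rw [sum_comp r fun k => fiberMean r (fun b => X b ω) k ^ 2]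
    refine Finset.sum_congr rfl fun k _ => ?_
    have := (hn k).ne'
    simp only [fiberMean, S]
    field_simp
  have hxd : ∀ ω, ∑ a, X a ω * fiberMean r (fun b => X b ω) (r a) = D ω := fun ω => by
    rw [sum_mul_comp r (fun a => X a ω) (fiberMean r fun b => X b ω)]
    refine Finset.sum_congr rfl fun k _ => ?_
    simp only [fiberMean, S]
    ring
  have hgd : ∀ ω, |∑ a, (g' (X a ω) - c₁) * fiberMean r (fun b => X b ω) (r a)| ≤ V ω + D ω :=
    fun ω => by
      rw [sum_mul_comp r (fun a => g' (X a ω) - c₁) (fiberMean r fun b => X b ω),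
        ← Finset.sum_add_distrib]
      refine (Finset.abs_sum_le_sum_abs _ _).trans (Finset.sum_le_sum fun k _ => ?_)
      have h1 : (∑ a ∈ fiber r k, (g' (X a ω) - c₁)) * fiberMean r (fun b => X b ω) k =
          G k ω * S k ω / ((fiber r k).card : ℝ) := by
        simp only [fiberMean, S, G]; ring
      rw [h1, abs_div, abs_of_pos (hn k), ← add_div]
      gcongr
      rw [abs_le]
      constructor <;> nlinarith [sq_nonneg (G k ω + S k ω), sq_nonneg (G k ω - S k ω)]
  have hB := measureReal_le_div hD0 hDi (show (0 : ℝ) < Fintype.card ι / 64 by positivity)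
  have hcard : ∀ k, (fiber (fun _ : ι => ()) k).card = Fintype.card ι := fun k => by
    simp [fiber]
  -- One common scale means that the groups of `remainder` are the single fibre over `Unit`; r only
  -- determines the centres.
  have main := measureReal_remainder_le hX hg (fun _ : ι => ()) (fun k => by rwa [hcard])
    (fun a ω => fiberMean r (fun b => X b ω) (r a)) (Q := fun ω => 3 * D ω + V ω)
    ((hDi.const_mul 3).add hVi)
    (fun ω => by
      have h1 := hgd ω
      rw [hdd, hxd, abs_of_nonneg (hD0 ω)]
      linarith)
    (B := {ω | (Fintype.card ι : ℝ) / 64 ≤ D ω})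
    (fun ω hω k => by
      rw [hcard]
      have : ∑ a ∈ fiber (fun _ : ι => ()) k, fiberMean r (fun b => X b ω) (r a) ^ 2 = D ω := by
        rw [← hdd]; simp [fiber]
      rw [this]
      exact (lt_of_not_ge hω).le) hε
  refine main.trans ?_
  have h2 : ∫ ω, (3 * D ω + V ω) ∂P ≤ (3 + L ^ 2) * Fintype.card κ := by
    rw [integral_add (hDi.const_mul 3) hVi, integral_const_mul, hDint]
    linarith
  simp only [hcard]
  refine add_le_add (add_le_add ?_ ?_) ?_
  · refine hB.trans (le_of_eq ?_)
    rw [hDint]; field_simp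
  · simp
  · simp only [Fintype.card_unit, Nat.cast_one, mul_one]
    gcongr

/-- The remainder when the observations are centred at a common point `δ / σ k` and every group is
standardized with its own scale. -/
theorem measureReal_remainder_groupScales_le [IsProbabilityMeasure P] (hX : IsGaussianSample X P)
    (hg : IsTestFn g g' L) (r : ι → κ) (hr : ∀ k, 0 < (fiber r k).card) (hκ : 0 < Fintype.card κ)
    {σ : κ → ℝ} {α β c : ℝ} (hα : 0 < α) (hσ : ∀ k, α ≤ σ k ∧ σ k ≤ β) (hc : 0 < c)
    (hq : ∀ k, c ≤ Fintype.card κ * ((fiber r k).card : ℝ) / Fintype.card ι)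
    {ε : ℝ} (hε : 0 < ε) :
    P.real {ω | ε ≤ |remainder g r (fun a => X a ω)
        fun a => (∑ k, σ k * fiberMean r (fun b => X b ω) k) / Fintype.card κ / σ (r a)|} ≤
      64 * β ^ 2 / (c * α ^ 2) / Fintype.card ι +
        128 / c * Fintype.card κ ^ 2 / Fintype.card ι +
        (71 * L + 16) * ((2 + L ^ 2) * Fintype.card κ +
          ((2 + 1 / α ^ 2) * (β ^ 2 / c) + (1 + L ^ 2) / α ^ 2)) / ε := by
  have hL := hg.nonneg
  set c₁ := ∫ y, g y * y ∂gaussianReal 0 1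
  have hn : ∀ k, (0 : ℝ) < (fiber r k).card := fun k => Nat.cast_pos.2 (hr k)
  set N : ℝ := (Fintype.card ι : ℝ) with hNdef
  set J : ℝ := (Fintype.card κ : ℝ) with hJdef
  have hJ : 0 < J := Nat.cast_pos.2 hκ
  have hNsum : ∑ k, ((fiber r k).card : ℝ) = N := sum_card_fiber r
  have hN : 0 < N := by
    have : Nonempty κ := Fintype.card_pos_iff.1 hκ
    rw [← hNsum]
    exact Finset.sum_pos (fun k _ => hn k) Finset.univ_nonempty
  have hσ0 : ∀ k, 0 < σ k := fun k => hα.trans_le (hσ k).1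
  -- The bound c on J n_k / N prevents small groups from dominating the unweighted mean of means.
  have hinv : ∀ k, 1 / ((fiber r k).card : ℝ) ≤ J / (c * N) := fun k => by
    have h1 := hq k
    rw [le_div_iff₀ hN] at h1
    rw [div_le_div_iff₀ (hn k) (by positivity)]
    linarith
  set u : ι → ℝ := fun a => σ (r a) / (J * ((fiber r (r a)).card : ℝ)) with hu
  set δ : Ω → ℝ := fun ω => ∑ a, u a * X a ω with hδ
  have hδeq : ∀ ω, (∑ k, σ k * fiberMean r (fun b => X b ω) k) / J = δ ω := fun ω => by
    have : δ ω = ∑ a, X a ω * (σ (r a) / (J * ((fiber r (r a)).card : ℝ))) :=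
      Finset.sum_congr rfl fun a _ => mul_comm (u a) (X a ω)
    rw [this, sum_mul_comp r (fun a => X a ω) fun k => σ k / (J * ((fiber r k).card : ℝ)),
      Finset.sum_div]
    refine Finset.sum_congr rfl fun k _ => ?_
    simp only [fiberMean]
    have := (hn k).ne'
    field_simp
  have hδi : Integrable (fun ω => δ ω ^ 2) P := hX.integrable_sum_sq .id _ u
  -- The estimated centre has variance of order 1/N: J terms, each at most β²/J² · J/(cN).
  have hδ2 : ∫ ω, δ ω ^ 2 ∂P ≤ β ^ 2 / c / N := by
    rw [hX.integral_sum_sq .id integral_gaussian_one, integral_gaussian_sq, mul_one,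
      sum_comp r fun k => (σ k / (J * ((fiber r k).card : ℝ))) ^ 2]
    calc ∑ k, ((fiber r k).card : ℝ) * (σ k / (J * ((fiber r k).card : ℝ))) ^ 2
        ≤ ∑ _k : κ, β ^ 2 / J ^ 2 * (J / (c * N)) := by
          refine Finset.sum_le_sum fun k _ => ?_
          have e : ((fiber r k).card : ℝ) * (σ k / (J * ((fiber r k).card : ℝ))) ^ 2 =
              σ k ^ 2 / J ^ 2 * (1 / ((fiber r k).card : ℝ)) := by
            have := (hn k).ne'
            field_simp
          rw [e]
          have h1 := hinv k
          have h2 := (hσ k).2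
          have h3 := hσ0 k
          gcongr
      _ = β ^ 2 / c / N := by
          rw [Finset.sum_const, Finset.card_univ, nsmul_eq_mul]
          rw [← hJdef]
          field_simp
  have hsinv : ∑ a, (1 / σ (r a)) ^ 2 ≤ N / α ^ 2 := by
    calc ∑ a, (1 / σ (r a)) ^ 2 ≤ ∑ _a : ι, (1 / α) ^ 2 := by
          refine Finset.sum_le_sum fun a _ => ?_
          have h1 := (hσ (r a)).1
          have h2 := hσ0 (r a)
          gcongr
      _ = N / α ^ 2 := by
          rw [Finset.sum_const, Finset.card_univ, nsmul_eq_mul, ← hNdef]; field_simp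
  have hgc : PolyGrowth fun x => g' x - c₁ := hg.polyGrowth_deriv.sub (.const _)
  set U : Ω → ℝ := fun ω => ∑ a, 1 / σ (r a) * X a ω
  set G : Ω → ℝ := fun ω => ∑ a, 1 / σ (r a) * (g' (X a ω) - c₁)
  have hUi : Integrable (fun ω => U ω ^ 2) P := hX.integrable_sum_sq .id _ _
  have hGi : Integrable (fun ω => G ω ^ 2) P := hX.integrable_sum_sq hgc _ _
  have hU2 : ∫ ω, U ω ^ 2 ∂P ≤ N / α ^ 2 := by
    rw [hX.integral_sum_sq .id integral_gaussian_one, integral_gaussian_sq, mul_one]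
    exact hsinv
  have hG2 : ∫ ω, G ω ^ 2 ∂P ≤ N / α ^ 2 * L ^ 2 := by
    rw [hX.integral_sum_sq hgc (integral_centred hg.polyGrowth_deriv hg.integral_deriv)]
    exact mul_le_mul hsinv hg.integral_deriv_centred_sq_le
      (integral_nonneg fun x => sq_nonneg _) (by positivity)
  set Q : Ω → ℝ := fun ω => (2 + 1 / α ^ 2) * (N * δ ω ^ 2) + (U ω ^ 2 / N + G ω ^ 2 / N)
  have hQi : Integrable Q P :=
    ((hδi.const_mul N).const_mul _).add ((hUi.div_const N).add (hGi.div_const N))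
  have hQint : ∫ ω, Q ω ∂P ≤ (2 + 1 / α ^ 2) * (β ^ 2 / c) + (1 + L ^ 2) / α ^ 2 := by
    have hUG : Integrable (fun ω => U ω ^ 2 / N + G ω ^ 2 / N) P :=
      (hUi.div_const N).add (hGi.div_const N)
    simp only [Q]
    rw [integral_add ((hδi.const_mul N).const_mul _) hUG, integral_add (hUi.div_const N) (hGi.div_const N), integral_const_mul, integral_const_mul,
      integral_div, integral_div]
    have h1 : N * ∫ ω, δ ω ^ 2 ∂P ≤ β ^ 2 / c := by
      rw [le_div_iff₀ hN] at hδ2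
      linarith
    have h2 : (∫ ω, U ω ^ 2 ∂P) / N + (∫ ω, G ω ^ 2 ∂P) / N ≤ (1 + L ^ 2) / α ^ 2 := by
      rw [← add_div, div_le_iff₀ hN]
      have : (1 + L ^ 2) / α ^ 2 * N = N / α ^ 2 + N / α ^ 2 * L ^ 2 := by ring
      linarith
    gcongr
  -- The weights N and 1/N balance δ² ~ 1/N against U², G² ~ N, so that both terms have bounded
  -- mean.
  have hprod : ∀ a b : ℝ, |a * b| ≤ N * a ^ 2 + b ^ 2 / N := fun a b => by
    have e : b ^ 2 / N * N = b ^ 2 := by field_simp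
    refine abs_le_of_sq_le_sq ?_ (by positivity)
    have h1 : 0 ≤ N * a ^ 2 := by positivity
    have h2 : 0 ≤ b ^ 2 / N := by positivity
    have h3 : (a * b) ^ 2 = N * a ^ 2 * (b ^ 2 / N) := by field_simp
    rw [h3]
    generalize N * a ^ 2 = p at h1 ⊢
    generalize b ^ 2 / N = q at h2 ⊢
    nlinarith [mul_nonneg h1 h2, sq_nonneg p, sq_nonneg q]
  simp only [hδeq]
  -- If δ² < α²/64 then (δ/σ)² ≤ 1/64 for each observation, as σ ≥ α.
  have hB := measureReal_le_div (fun ω => sq_nonneg (δ ω)) hδi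
    (show (0 : ℝ) < α ^ 2 / 64 by positivity)
  have main := measureReal_remainder_le hX hg r hr (fun a ω => δ ω / σ (r a)) (Q := Q) hQi
    (fun ω => by
      have h1 : ∑ a, (δ ω / σ (r a)) ^ 2 ≤ 1 / α ^ 2 * (N * δ ω ^ 2) := by
        have e : ∑ a, (δ ω / σ (r a)) ^ 2 = δ ω ^ 2 * ∑ a, (1 / σ (r a)) ^ 2 := by
          rw [Finset.mul_sum]
          exact Finset.sum_congr rfl fun a _ => by ring
        rw [e]
        calc _ ≤ δ ω ^ 2 * (N / α ^ 2) := by gcongr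
          _ = _ := by ring
      have h2 : |∑ a, X a ω * (δ ω / σ (r a))| ≤ N * δ ω ^ 2 + U ω ^ 2 / N := by
        have e : ∑ a, X a ω * (δ ω / σ (r a)) = δ ω * U ω := by
          simp only [U]
          rw [Finset.mul_sum]
          exact Finset.sum_congr rfl fun a _ => by ring
        rw [e]
        exact hprod _ _
      have h3 : |∑ a, (g' (X a ω) - c₁) * (δ ω / σ (r a))| ≤ N * δ ω ^ 2 + G ω ^ 2 / N := by
        have e : ∑ a, (g' (X a ω) - c₁) * (δ ω / σ (r a)) = δ ω * G ω := by
          simp only [G]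
          rw [Finset.mul_sum]
          exact Finset.sum_congr rfl fun a _ => by ring
        rw [e]
        exact hprod _ _
      simp only [Q]
      linarith)
    (B := {ω | α ^ 2 / 64 ≤ δ ω ^ 2})
    (fun ω hω k => by
      have h1 : δ ω ^ 2 ≤ α ^ 2 / 64 := (lt_of_not_ge hω).le
      calc ∑ a ∈ fiber r k, (δ ω / σ (r a)) ^ 2 ≤ ∑ a ∈ fiber r k, (1 / 64 : ℝ) := by
            refine Finset.sum_le_sum fun a _ => ?_
            have h2 := (hσ (r a)).1
            have h3 := hσ0 (r a)
            rw [div_pow, div_le_iff₀ (by positivity)]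
            have : α ^ 2 ≤ σ (r a) ^ 2 := by gcongr
            linarith
        _ = _ := by simp; ring) hε
  refine main.trans ?_
  refine add_le_add (add_le_add ?_ ?_) ?_
  · refine hB.trans ?_
    rw [div_le_iff₀ (by positivity)]
    refine hδ2.trans (le_of_eq ?_)
    field_simp
  · calc ∑ k, 128 / ((fiber r k).card : ℝ) ≤ ∑ _k : κ, 128 * (J / (c * N)) := by
          refine Finset.sum_le_sum fun k _ => ?_
          have := hinv k
          calc (128 : ℝ) / ((fiber r k).card : ℝ) = 128 * (1 / ((fiber r k).card : ℝ)) := by ring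
            _ ≤ _ := by gcongr
      _ = 128 / c * J ^ 2 / N := by
          rw [Finset.sum_const, Finset.card_univ, nsmul_eq_mul, ← hJdef]; field_simp
  · gcongr

end Centres

/-! ### The covariance matrix -/

section CovMat

variable {K : ℕ}

/-- The matrix with entries `δ_kl + t * c_k * c_l - d_k * d_l / 2`. -/
noncomputable def covMat (c d : Fin K → ℝ) (t : ℝ) : Matrix (Fin K) (Fin K) ℝ := fun k l =>
  (if k = l then 1 else 0) + t * (c k * c l) - d k * d l / 2

/-- The quadratic form of `covMat`. -/
noncomputable def covForm (c d : Fin K → ℝ) (t : ℝ) (u : Fin K → ℝ) : ℝ :=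
  ∑ k, u k ^ 2 + t * (∑ k, u k * c k) ^ 2 - (∑ k, u k * d k) ^ 2 / 2

theorem dotProduct_covMat_mulVec (c d : Fin K → ℝ) (t : ℝ) (u : Fin K → ℝ) :
    u ⬝ᵥ (covMat c d t).mulVec u = covForm c d t u := by
  have h1 : ∀ k, u k * ∑ l, covMat c d t k l * u l =
      u k ^ 2 + t * (u k * c k * ∑ l, u l * c l) - u k * d k * (∑ l, u l * d l) / 2 := fun k => by
    have h2 : ∀ l, covMat c d t k l * u l =
        (if k = l then u l else 0) + t * c k * (u l * c l) - d k / 2 * (u l * d l) := fun l => by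
      simp only [covMat]
      split_ifs <;> ring
    simp_rw [h2]
    rw [Finset.sum_sub_distrib, Finset.sum_add_distrib, ← Finset.mul_sum, ← Finset.mul_sum,
      Finset.sum_ite_eq]
    simp only [Finset.mem_univ, if_true]
    ring
  simp only [dotProduct, Matrix.mulVec]
  simp_rw [h1]
  rw [Finset.sum_sub_distrib, Finset.sum_add_distrib, ← Finset.mul_sum, ← Finset.sum_mul,
    ← Finset.sum_div, ← Finset.sum_mul, covForm]
  ring

theorem covMat_isHermitian (c d : Fin K → ℝ) (t : ℝ) : (covMat c d t).IsHermitian := by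
  ext k l
  simp only [Matrix.conjTranspose_apply, covMat, star_trivial, eq_comm (a := l)]
  ring

/-- Carries lower bounds at t = -1 over to all t ≥ -1. -/
theorem covForm_mono (c d : Fin K → ℝ) (u : Fin K → ℝ) {s t : ℝ} (h : s ≤ t) :
    covForm c d s u ≤ covForm c d t u := by
  unfold covForm
  have := mul_le_mul_of_nonneg_right h (sq_nonneg (∑ k, u k * c k))
  linarith

variable {g g' : Fin K → ℝ → ℝ} {L : ℝ}

/-- A linear combination of the functions `g k`, corrected for the estimation of a mean (with
weight `w`) and of a variance. -/
noncomputable def projFn (g : Fin K → ℝ → ℝ) (u : Fin K → ℝ) (w x : ℝ) : ℝ :=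
  ∑ k, u k * (g k x - (∫ y, g k y * y ∂gaussianReal 0 1) * (w * x)
    - (∫ y, g k y * y ^ 2 ∂gaussianReal 0 1) * (x ^ 2 - 1) / 2)

theorem projFn_eq (g : Fin K → ℝ → ℝ) (u : Fin K → ℝ) (w x : ℝ) :
    projFn g u w x = ∑ k, u k * g k x - (∑ k, u k * ∫ y, g k y * y ∂gaussianReal 0 1) * (w * x)
      - (∑ k, u k * ∫ y, g k y * y ^ 2 ∂gaussianReal 0 1) * ((x ^ 2 - 1) / 2) := by
  rw [projFn, Finset.sum_mul, Finset.sum_mul, ← Finset.sum_sub_distrib, ← Finset.sum_sub_distrib]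
  exact Finset.sum_congr rfl fun k _ => by ring

theorem polyGrowth_projFn (hg : ∀ k, IsTestFn (g k) (g' k) L) (u : Fin K → ℝ) (w : ℝ) :
    PolyGrowth (projFn g u w) := by
  refine PolyGrowth.sum _ fun k _ => .const_mul _ (((hg k).polyGrowth.sub
    (.const_mul _ (.const_mul _ .id))).sub ?_)
  simpa only [mul_div_assoc] using
    PolyGrowth.const_mul _ (PolyGrowth.div_const (.sub (.pow .id 2) (.const 1)) 2)

theorem integral_sum_mul_sq (hg : ∀ k, IsTestFn (g k) (g' k) L)
    (horth : ∀ k l, ∫ x, g k x * g l x ∂gaussianReal 0 1 = if k = l then 1 else 0)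
    (u : Fin K → ℝ) : ∫ x, (∑ k, u k * g k x) ^ 2 ∂gaussianReal 0 1 = ∑ k, u k ^ 2 := by
  have h1 : ∀ x, (∑ k, u k * g k x) ^ 2 = ∑ k, ∑ l, u k * u l * (g k x * g l x) := fun x => by
    rw [sq, Finset.sum_mul_sum]
    exact Finset.sum_congr rfl fun k _ => Finset.sum_congr rfl fun l _ => by ring
  have hi : ∀ k l, PolyGrowth fun x => u k * u l * (g k x * g l x) := fun k l =>
    .const_mul _ ((hg k).polyGrowth.mul (hg l).polyGrowth)
  simp_rw [h1]
  rw [integral_finsetSum _ fun k _ => (PolyGrowth.sum _ fun l _ => hi k l).integrable]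
  refine Finset.sum_congr rfl fun k _ => ?_
  rw [integral_finsetSum _ fun l _ => (hi k l).integrable]
  simp_rw [integral_const_mul, horth]
  simp [sq]

theorem integral_projFn (hg : ∀ k, IsTestFn (g k) (g' k) L) (u : Fin K → ℝ) (w : ℝ) :
    ∫ x, projFn g u w x ∂gaussianReal 0 1 = 0 := by
  simp_rw [projFn_eq]
  have hG : PolyGrowth fun x => ∑ k, u k * g k x :=
    .sum _ fun k _ => .const_mul _ (hg k).polyGrowth
  have hS : PolyGrowth fun x : ℝ => (x ^ 2 - 1) / 2 :=
    PolyGrowth.div_const (.sub (.pow .id 2) (.const 1)) 2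
  rw [integral_sub (hG.sub (.const_mul _ (.const_mul _ .id))).integrable
    (hS.const_mul _).integrable, integral_sub hG.integrable
    (PolyGrowth.const_mul _ (.const_mul _ .id)).integrable, integral_const_mul, integral_const_mul,
    integral_const_mul, integral_gaussian_one, integral_div, integral_sq_sub_one,
    integral_finsetSum _ fun k _ => ((hg k).polyGrowth.const_mul _).integrable]
  simp_rw [integral_const_mul, (hg _).integral_eq_zero]
  simp

/-- With A and B the coefficients of the combination along x and x², the x-terms give A²w² - 2A²w,
and the (x² - 1)-terms give B²/4 · 2 - B² = -B²/2; the products of x with x² - 1 vanish by parity.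
-/
theorem integral_projFn_sq (hg : ∀ k, IsTestFn (g k) (g' k) L)
    (horth : ∀ k l, ∫ x, g k x * g l x ∂gaussianReal 0 1 = if k = l then 1 else 0)
    (u : Fin K → ℝ) (w : ℝ) :
    ∫ x, projFn g u w x ^ 2 ∂gaussianReal 0 1 =
      covForm (fun k => ∫ y, g k y * y ∂gaussianReal 0 1)
        (fun k => ∫ y, g k y * y ^ 2 ∂gaussianReal 0 1) (w ^ 2 - 2 * w) u := by
  simp only [projFn_eq, covForm]
  have hG : PolyGrowth fun x => ∑ k, u k * g k x :=
    .sum _ fun k _ => .const_mul _ (hg k).polyGrowth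
  set G : ℝ → ℝ := fun x => ∑ k, u k * g k x with hGdef
  have hG2 : ∫ x, G x ^ 2 ∂gaussianReal 0 1 = ∑ k, u k ^ 2 := integral_sum_mul_sq hg horth u
  have hG0 : ∫ x, G x ∂gaussianReal 0 1 = 0 := by
    rw [integral_finsetSum _ fun k _ => ((hg k).polyGrowth.const_mul _).integrable]
    simp_rw [integral_const_mul, (hg _).integral_eq_zero]
    simp
  have hGx : ∫ x, G x * x ∂gaussianReal 0 1 =
      ∑ k, u k * ∫ y, g k y * y ∂gaussianReal 0 1 := by
    simp only [hGdef, Finset.sum_mul, mul_assoc]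
    rw [integral_finsetSum _ fun k _ => (((hg k).polyGrowth.mul .id).const_mul _).integrable]
    simp_rw [integral_const_mul]
  have hGxx : ∫ x, G x * x ^ 2 ∂gaussianReal 0 1 =
      ∑ k, u k * ∫ y, g k y * y ^ 2 ∂gaussianReal 0 1 := by
    simp only [hGdef, Finset.sum_mul, mul_assoc]
    rw [integral_finsetSum _ fun k _ =>
      (((hg k).polyGrowth.mul (.pow .id 2)).const_mul _).integrable]
    simp_rw [integral_const_mul]
  rw [← hGx, ← hGxx, ← hG2]
  set A := ∫ x, G x * x ∂gaussianReal 0 1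
  set B := ∫ x, G x * x ^ 2 ∂gaussianReal 0 1
  have h1 : ∀ x, (G x - A * (w * x) - B * ((x ^ 2 - 1) / 2)) ^ 2 =
      G x ^ 2 + (-(2 * A * w) * (G x * x) + (-B * (G x * x ^ 2) + (B * G x
        + (A ^ 2 * w ^ 2 * x ^ 2 + (A * w * B * x ^ 3 + (-(A * w * B) * x
          + B ^ 2 / 4 * (x ^ 2 - 1) ^ 2)))))) := fun x => by ring
  change ∫ x, (G x - A * (w * x) - B * ((x ^ 2 - 1) / 2)) ^ 2 ∂gaussianReal 0 1 = _
  simp_rw [h1]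
  have p1 : PolyGrowth fun x => G x ^ 2 := hG.pow 2
  have p2 : PolyGrowth fun x => -(2 * A * w) * (G x * x) := .const_mul _ (hG.mul .id)
  have p3 : PolyGrowth fun x => -B * (G x * x ^ 2) := .const_mul _ (hG.mul (.pow .id 2))
  have p4 : PolyGrowth fun x => B * G x := .const_mul _ hG
  have p5 : PolyGrowth fun x => A ^ 2 * w ^ 2 * x ^ 2 := .const_mul _ (.pow .id 2)
  have p6 : PolyGrowth fun x => A * w * B * x ^ 3 := .const_mul _ (.pow .id 3)
  have p7 : PolyGrowth fun x => -(A * w * B) * x := .const_mul _ .id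
  have p8 : PolyGrowth fun x : ℝ => B ^ 2 / 4 * (x ^ 2 - 1) ^ 2 :=
    .const_mul _ (.pow (.sub (.pow .id 2) (.const 1)) 2)
  have q7 := p7.add p8
  have q6 := p6.add q7
  have q5 := p5.add q6
  have q4 := p4.add q5
  have q3 := p3.add q4
  have q2 := p2.add q3
  rw [integral_add p1.integrable q2.integrable, integral_add p2.integrable q3.integrable,
    integral_add p3.integrable q4.integrable, integral_add p4.integrable q5.integrable,
    integral_add p5.integrable q6.integrable, integral_add p6.integrable q7.integrable,
    integral_add p7.integrable p8.integrable]
  simp only [integral_const_mul]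
  rw [integral_sq_sub_one_sq, integral_const_mul (-(A * w * B)) (fun x : ℝ => x),
    integral_gaussian_one, integral_gaussian_cube, integral_gaussian_sq,
    hG0]
  ring

/-- At w = 1 the form is the second moment of ∑ u_k g_k minus a multiple of x and of x² - 1. If it
vanished, the bounded function ∑ u_k g_k would be a quadratic polynomial; then both coefficients are
0, the combination is 0, and orthonormality forces u = 0. -/
theorem covForm_pos (hg : ∀ k, IsTestFn (g k) (g' k) L)
    (horth : ∀ k l, ∫ x, g k x * g l x ∂gaussianReal 0 1 = if k = l then 1 else 0)
    {u : Fin K → ℝ} (hu : u ≠ 0) :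
    0 < covForm (fun k => ∫ y, g k y * y ∂gaussianReal 0 1)
        (fun k => ∫ y, g k y * y ^ 2 ∂gaussianReal 0 1) (-1) u := by
  have hsq := integral_projFn_sq hg horth u 1
  norm_num only at hsq
  rw [← hsq]
  have hpg := polyGrowth_projFn hg u 1
  refine lt_of_le_of_ne (integral_nonneg fun x => sq_nonneg _) fun h0 => hu ?_
  have hae := (integral_eq_zero_iff_of_nonneg (fun x => sq_nonneg _) (hpg.pow 2).integrable).1
    h0.symm
  -- Lebesgue measure is absolutely continuous with respect to the normal law, and continuous
  -- functions equal almost everywhere are equal.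
  have hae2 : (fun x => projFn g u 1 x) =ᵐ[volume] fun _ => 0 := by
    filter_upwards [(gaussianReal_absolutelyContinuous' 0 one_ne_zero).ae_le hae] with x hx
    simpa using hx
  have hgc : ∀ k, Continuous (g k) := fun k => (hg k).continuous
  have hcont : Continuous fun x => projFn g u 1 x := by
    unfold projFn
    fun_prop
  have hz : ∀ x, projFn g u 1 x = 0 :=
    fun x => congrFun ((hcont.ae_eq_iff_eq volume continuous_const).1 hae2) x
  simp only [projFn_eq, one_mul] at hz
  set A := ∑ k, u k * ∫ y, g k y * y ∂gaussianReal 0 1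
  set B := ∑ k, u k * ∫ y, g k y * y ^ 2 ∂gaussianReal 0 1
  set C := ∑ k, |u k| * L
  have hb : ∀ x, |A * x + B * ((x ^ 2 - 1) / 2)| ≤ C := fun x => by
    have : A * x + B * ((x ^ 2 - 1) / 2) = ∑ k, u k * g k x := by linarith [hz x]
    rw [this]
    refine (Finset.abs_sum_le_sum_abs _ _).trans (Finset.sum_le_sum fun k _ => ?_)
    rw [abs_mul]
    exact mul_le_mul_of_nonneg_left ((hg k).abs_le x) (abs_nonneg _)
  have hC : 0 ≤ C := (abs_nonneg _).trans (hb 0)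
  have hB : B = 0 := by
    by_contra hB
    have hB' : 0 < |B| := abs_pos.2 hB
    -- Adding the bounds at x and -x removes the linear term and leaves |B(x² - 1)| ≤ 2C; this x
    -- makes the left side 2C + 1.
    set x := √(1 + (2 * C + 1) / |B|)
    have hx : x ^ 2 - 1 = (2 * C + 1) / |B| := by
      rw [Real.sq_sqrt (by positivity)]; ring
    have h1 := hb x
    have h2 := hb (-x)
    have h3 : |B * (x ^ 2 - 1)| ≤ 2 * C := by
      rw [abs_le] at h1 h2 ⊢
      constructor <;> linarith [h1.1, h1.2, h2.1, h2.2, neg_sq x]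
    rw [abs_mul, hx, abs_of_pos (show 0 < (2 * C + 1) / |B| by positivity),
      mul_div_cancel₀ _ hB'.ne'] at h3
    linarith
  have hA : A = 0 := by
    by_contra hA
    have hA' : 0 < |A| := abs_pos.2 hA
    have h1 := hb ((C + 1) / |A|)
    rw [hB, zero_mul, add_zero, abs_mul, abs_of_pos (show 0 < (C + 1) / |A| by positivity),
      mul_div_cancel₀ _ hA'.ne'] at h1
    linarith
  have hG : ∀ x, ∑ k, u k * g k x = 0 := fun x => by
    have := hz x
    rw [hA, hB] at this
    linarith
  have h2 := integral_sum_mul_sq hg horth u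
  simp_rw [hG] at h2
  have h3 : ∑ k, u k ^ 2 = 0 := by rw [← h2]; simp
  ext k
  have := (Finset.sum_eq_zero_iff_of_nonneg fun k _ => sq_nonneg (u k)).1 h3 k (Finset.mem_univ k)
  simpa using this

/-- Minimum over the compact unit sphere of the sup norm, extended by homogeneity of degree 2. A
coordinatewise bound is all that bounding the whitening matrices requires. -/
theorem exists_le_covForm (hg : ∀ k, IsTestFn (g k) (g' k) L)
    (horth : ∀ k l, ∫ x, g k x * g l x ∂gaussianReal 0 1 = if k = l then 1 else 0) :
    ∃ lam : ℝ, 0 < lam ∧ ∀ (u : Fin K → ℝ) k, lam * u k ^ 2 ≤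
      covForm (fun k => ∫ y, g k y * y ∂gaussianReal 0 1)
        (fun k => ∫ y, g k y * y ^ 2 ∂gaussianReal 0 1) (-1) u := by
  set F : (Fin K → ℝ) → ℝ := covForm (fun k => ∫ y, g k y * y ∂gaussianReal 0 1)
    (fun k => ∫ y, g k y * y ^ 2 ∂gaussianReal 0 1) (-1) with hF
  have hFc : Continuous F := by
    unfold F covForm
    fun_prop
  have hFpos : ∀ u, u ≠ 0 → 0 < F u := fun u hu => covForm_pos hg horth hu
  have hF0 : ∀ u, 0 ≤ F u := fun u => by
    rcases eq_or_ne u 0 with rfl | hu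
    · simp [hF, covForm]
    · exact (hFpos u hu).le
  obtain ⟨lam, hlam, hmin⟩ : ∃ lam : ℝ, 0 < lam ∧ ∀ u ∈ Metric.sphere (0 : Fin K → ℝ) 1,
      lam ≤ F u := by
    -- The sphere is empty when K = 0.
    rcases (Metric.sphere (0 : Fin K → ℝ) 1).eq_empty_or_nonempty with he | hne
    · exact ⟨1, one_pos, fun u hu => by simp [he] at hu⟩
    · obtain ⟨v, hv, hvmin⟩ := (isCompact_sphere (0 : Fin K → ℝ) 1).exists_isMinOn hne
        hFc.continuousOn
      refine ⟨F v, hFpos v fun h => ?_, fun u hu => hvmin hu⟩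
      simp [h] at hv
  refine ⟨lam, hlam, fun u k => ?_⟩
  rcases eq_or_ne u 0 with rfl | hu
  · simpa using hF0 0
  have hn : 0 < ‖u‖ := norm_pos_iff.2 hu
  have h1 := hmin (‖u‖⁻¹ • u) (by simp [norm_smul, hn.ne'])
  have h2 : F (‖u‖⁻¹ • u) = ‖u‖⁻¹ ^ 2 * F u := by
    simp only [hF, covForm, Pi.smul_apply, smul_eq_mul, mul_assoc, ← Finset.mul_sum, mul_pow]
    ring
  rw [h2, inv_pow, inv_mul_eq_div, le_div_iff₀ (by positivity)] at h1
  refine le_trans ?_ h1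
  have h3 : |u k| ≤ ‖u‖ := norm_le_pi_norm u k
  have h4 : u k ^ 2 ≤ ‖u‖ ^ 2 := by rw [← sq_abs]; gcongr
  gcongr

theorem covMat_posDef (hg : ∀ k, IsTestFn (g k) (g' k) L)
    (horth : ∀ k l, ∫ x, g k x * g l x ∂gaussianReal 0 1 = if k = l then 1 else 0)
    {t : ℝ} (ht : -1 ≤ t) :
    (covMat (fun k => ∫ y, g k y * y ∂gaussianReal 0 1)
      (fun k => ∫ y, g k y * y ^ 2 ∂gaussianReal 0 1) t).PosDef := by
  refine .of_dotProduct_mulVec_pos (covMat_isHermitian _ _ _) fun u hu => ?_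
  rw [star_trivial, dotProduct_covMat_mulVec]
  exact (covForm_pos hg horth hu).trans_le (covForm_mono _ _ u ht)

end CovMat

open scoped MatrixOrder in
/-- A positive definite matrix can be whitened. -/
theorem exists_whitening {K : ℕ} {S : Matrix (Fin K) (Fin K) ℝ} (hS : S.PosDef) {lam : ℝ}
    (hlam : 0 < lam) (hle : ∀ (u : Fin K → ℝ) k, lam * u k ^ 2 ≤ u ⬝ᵥ S.mulVec u) :
    ∃ B : Matrix (Fin K) (Fin K) ℝ,
      (∀ v, v ⬝ᵥ S⁻¹.mulVec v = ∑ i, B.mulVec v i ^ 2) ∧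
      (∀ t, B.transpose.mulVec t ⬝ᵥ S.mulVec (B.transpose.mulVec t) = ∑ i, t i ^ 2) ∧
      ∀ i k, |B i k| ≤ 1 + 1 / lam := by
  obtain ⟨B, hB⟩ := CStarAlgebra.nonneg_iff_eq_star_mul_self.1 hS.inv.posSemidef.nonneg
  have hBt : S⁻¹ = B.transpose * B := by
    rw [hB]; rfl
  have hSu : IsUnit S.det := (Matrix.isUnit_iff_isUnit_det S).1 hS.isUnit
  refine ⟨B, fun v => ?_, fun t => ?_, fun i k => ?_⟩
  · rw [hBt, ← Matrix.mulVec_mulVec, Matrix.dotProduct_mulVec, Matrix.vecMul_transpose]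
    simp [dotProduct, sq]
  · have h1 : B.transpose * (B * S) = 1 := by
      rw [← mul_assoc, ← hBt, Matrix.nonsing_inv_mul _ hSu]
    -- A one-sided inverse of a square matrix is two-sided.
    have h2 : B * S * B.transpose = 1 := mul_eq_one_comm.1 h1
    rw [Matrix.mulVec_transpose B, ← Matrix.dotProduct_mulVec, ← Matrix.mulVec_transpose,
      Matrix.mulVec_mulVec, Matrix.mulVec_mulVec, h2, Matrix.one_mulVec]
    simp [dotProduct, sq]
  -- For the column v = S⁻¹e_k one has lam v_k² ≤ vᵀSv = v_k, so v_k ≤ 1/lam; and v_k is the sum of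
  -- the squares of column k of B.
  · set v : Fin K → ℝ := fun l => S⁻¹ l k
    have hSv : S.mulVec v = Pi.single k 1 := by
      have : S.mulVec v = fun l => (S * S⁻¹) l k := rfl
      rw [this, Matrix.mul_nonsing_inv _ hSu]
      ext l
      simp [Matrix.one_apply, Pi.single_apply]
    have h1 := hle v k
    rw [hSv, dotProduct_single, mul_one] at h1
    have hvk : v k = ∑ l, B l k ^ 2 := by
      simp only [v]
      rw [hBt, Matrix.mul_apply]
      simp [sq]
    have h2 : B i k ^ 2 ≤ v k := by
      rw [hvk]
      exact Finset.single_le_sum (f := fun l => B l k ^ 2) (fun l _ => sq_nonneg _)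
        (Finset.mem_univ i)
    have h3 : v k ≤ 1 / lam := by
      rw [le_div_iff₀ hlam]
      by_contra hcon
      push Not at hcon
      have hv0 : 0 < v k := by
        by_contra h; push Not at h; nlinarith
      nlinarith
    refine abs_le_of_sq_le_sq (le_trans (h2.trans h3) ?_) (by positivity)
    have : 0 < 1 / lam := by positivity
    nlinarith

/-! ### A central limit theorem for weighted sums -/

-- For |x| ≤ 1 this is the Taylor bound; for |x| ≥ 1 the terms are estimated separately by powers of
-- |x|. The constant 4 covers both.
open Complex in
theorem norm_cexp_mul_I_sub_le (x : ℝ) :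
    ‖cexp (x * I) - (1 + x * I - x ^ 2 / 2)‖ ≤ 4 * |x| ^ 3 := by
  have hn : ‖(x : ℂ) * I‖ = |x| := by simp
  rcases le_total |x| 1 with hx | hx
  · have h := Complex.exp_bound (x := (x : ℂ) * I) (by rwa [hn]) (n := 3) (by norm_num)
    have e : ∑ m ∈ Finset.range 3, ((x : ℂ) * I) ^ m / m.factorial = 1 + x * I - x ^ 2 / 2 := by
      simp [Finset.sum_range_succ, mul_pow]
      ring
    rw [e, hn] at h
    refine h.trans ?_
    rw [mul_comm (4 : ℝ)]
    gcongr
    norm_num [Nat.factorial]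
  · calc ‖cexp (x * I) - (1 + x * I - x ^ 2 / 2)‖
        ≤ ‖cexp (x * I)‖ + (‖(1 : ℂ)‖ + ‖(x : ℂ) * I‖ + ‖(x : ℂ) ^ 2 / 2‖) := by
          refine (norm_sub_le _ _).trans ?_
          gcongr
          refine (norm_sub_le _ _).trans ?_
          gcongr
          exact norm_add_le _ _
      _ = 1 + (1 + |x| + |x| ^ 2 / 2) := by
          rw [norm_exp_ofReal_mul_I, hn]
          simp
      _ ≤ 4 * |x| ^ 3 := by
          have h2 : |x| ≤ |x| ^ 2 := by nlinarith
          have h3 : |x| ^ 2 ≤ |x| ^ 3 := by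
            have := mul_le_mul_of_nonneg_left hx (sq_nonneg |x|)
            nlinarith
          linarith

/-- Telescoping: factors are exchanged one at a time, the others having norm at most 1. -/
theorem norm_prod_sub_prod_le {ι : Type*} (s : Finset ι) {z w : ι → ℂ} (hz : ∀ a, ‖z a‖ ≤ 1)
    (hw : ∀ a, ‖w a‖ ≤ 1) : ‖∏ a ∈ s, z a - ∏ a ∈ s, w a‖ ≤ ∑ a ∈ s, ‖z a - w a‖ := by
  classical
  induction s using Finset.induction_on with
  | empty => simp
  | insert b s hb ih =>
    rw [Finset.prod_insert hb, Finset.prod_insert hb, Finset.sum_insert hb]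
    have e : z b * ∏ a ∈ s, z a - w b * ∏ a ∈ s, w a =
        (z b - w b) * ∏ a ∈ s, z a + w b * (∏ a ∈ s, z a - ∏ a ∈ s, w a) := by ring
    rw [e]
    refine (norm_add_le _ _).trans ?_
    rw [norm_mul, norm_mul]
    have h1 : ‖∏ a ∈ s, z a‖ ≤ 1 := by
      rw [norm_prod]
      exact Finset.prod_le_one (fun _ _ => norm_nonneg _) fun a _ => hz a
    have h2 := hw b
    refine add_le_add (mul_le_of_le_one_right (norm_nonneg _) h1) ?_
    exact (mul_le_of_le_one_left (norm_nonneg _) h2).trans ih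

theorem abs_exp_neg_sub_le {u : ℝ} (hu : 0 ≤ u) : |Real.exp (-u) - (1 - u)| ≤ u ^ 2 := by
  rcases le_total u 1 with h | h
  · have := Real.abs_exp_sub_one_sub_id_le (x := -u) (by rwa [abs_neg, abs_of_nonneg hu])
    rw [neg_sq] at this
    calc _ = |Real.exp (-u) - 1 - -u| := by congr 1; ring
      _ ≤ _ := this
  · have h1 := Real.exp_pos (-u)
    have h2 : Real.exp (-u) ≤ 1 := Real.exp_le_one_iff.2 (by linarith)
    rw [abs_le]
    constructor <;> nlinarith

theorem integrable_cexp_mul_I {Ω : Type*} [MeasurableSpace Ω] {P : Measure Ω} [IsFiniteMeasure P]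
    {U : Ω → ℝ} (hU : AEMeasurable U P) : Integrable (fun ω => Complex.exp (U ω * Complex.I)) P :=
  Integrable.of_bound (C := 1)
    (Complex.measurable_exp.comp_aemeasurable
      ((Complex.measurable_ofReal.comp_aemeasurable hU).mul_const _)).aestronglyMeasurable
    (ae_of_all _ fun ω => by rw [Complex.norm_exp_ofReal_mul_I])

-- For one summand, both the characteristic function and the normal one are close to 1 - s²v/2.
open Complex in
theorem norm_charFun_sub_gaussian_le {f : ℝ → ℝ} (hf : PolyGrowth f)
    (h0 : ∫ x, f x ∂gaussianReal 0 1 = 0) {s : ℝ} (hs : 0 ≤ s) :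
    ‖∫ x, cexp ((s * f x : ℝ) * I) ∂gaussianReal 0 1 -
        (Real.exp (-(s ^ 2 * ∫ x, f x ^ 2 ∂gaussianReal 0 1) / 2) : ℝ)‖ ≤
      4 * s ^ 3 * ∫ x, |f x| ^ 3 ∂gaussianReal 0 1 +
        s ^ 4 * (∫ x, f x ^ 2 ∂gaussianReal 0 1) ^ 2 := by
  set v := ∫ x, f x ^ 2 ∂gaussianReal 0 1 with hv
  have hv0 : 0 ≤ v := integral_nonneg fun x => sq_nonneg _
  have hi1 : Integrable (fun x => cexp ((s * f x : ℝ) * I)) (gaussianReal 0 1) :=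
    integrable_cexp_mul_I (hf.1.const_mul s).aemeasurable
  have hr1 : Integrable (fun x => ((s * f x : ℝ) : ℂ) * I) (gaussianReal 0 1) :=
    ((hf.const_mul s).integrable.ofReal).mul_const I
  have hr2 : Integrable (fun x => ((s * f x : ℝ) : ℂ) ^ 2 / 2) (gaussianReal 0 1) := by
    have := (((hf.const_mul s).pow 2).integrable.ofReal (𝕜 := ℂ)).div_const 2
    simpa using this
  have hr : Integrable (fun x => 1 + ((s * f x : ℝ) : ℂ) * I - ((s * f x : ℝ) : ℂ) ^ 2 / 2)
      (gaussianReal 0 1) := ((integrable_const _).add hr1).sub hr2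
  have hint : ∫ x, (1 + ((s * f x : ℝ) : ℂ) * I - ((s * f x : ℝ) : ℂ) ^ 2 / 2) ∂gaussianReal 0 1 =
      ((1 - s ^ 2 * v / 2 : ℝ) : ℂ) := by
    have hr1' : Integrable (fun x => 1 + ((s * f x : ℝ) : ℂ) * I) (gaussianReal 0 1) :=
      (integrable_const _).add hr1
    rw [integral_sub hr1' hr2, integral_add (integrable_const _) hr1, integral_mul_const,
      integral_complex_ofReal, integral_const_mul, h0, integral_div]
    have : ∫ x, ((s * f x : ℝ) : ℂ) ^ 2 ∂gaussianReal 0 1 = ((s ^ 2 * v : ℝ) : ℂ) := by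
      rw [hv, ← integral_const_mul, ← integral_complex_ofReal]
      congr with x
      push_cast
      ring
    rw [this]
    simp
  have h1 : ‖∫ x, cexp ((s * f x : ℝ) * I) ∂gaussianReal 0 1 - ((1 - s ^ 2 * v / 2 : ℝ) : ℂ)‖ ≤
      4 * s ^ 3 * ∫ x, |f x| ^ 3 ∂gaussianReal 0 1 := by
    rw [← hint, ← integral_sub hi1 hr, ← integral_const_mul]
    refine norm_integral_le_of_norm_le ((hf.abs.pow 3).const_mul _).integrable
      (ae_of_all _ fun x => ?_)
    refine (norm_cexp_mul_I_sub_le (s * f x)).trans (le_of_eq ?_)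
    rw [abs_mul, abs_of_nonneg hs]
    ring
  have h2 : ‖((1 - s ^ 2 * v / 2 : ℝ) : ℂ) - (Real.exp (-(s ^ 2 * v) / 2) : ℝ)‖ ≤
      s ^ 4 * v ^ 2 := by
    rw [← ofReal_sub, norm_real, Real.norm_eq_abs, abs_sub_comm, neg_div]
    refine (abs_exp_neg_sub_le (by positivity)).trans ?_
    have : 0 ≤ s ^ 4 * v ^ 2 := by positivity
    calc (s ^ 2 * v / 2) ^ 2 = s ^ 4 * v ^ 2 / 4 := by ring
      _ ≤ _ := by linarith
  exact (norm_sub_le_norm_sub_add_norm_sub _ _ _).trans (add_le_add h1 h2)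

-- Independence factors the characteristic function, and the factors are exchanged for normal ones
-- by `norm_prod_sub_prod_le`. The explicit error allows summands that change with the layout and
-- differ within it.
open Complex in
theorem IsGaussianSample.norm_charFun_sum_sub_le {ι Ω : Type*} [Fintype ι] [MeasurableSpace Ω]
    {X : ι → Ω → ℝ} {P : Measure Ω} (hX : IsGaussianSample X P) {f : ι → ℝ → ℝ}
    (hf : ∀ a, PolyGrowth (f a)) (h0 : ∀ a, ∫ x, f a x ∂gaussianReal 0 1 = 0) {M V : ℝ}
    (hM : ∀ a, ∫ x, |f a x| ^ 3 ∂gaussianReal 0 1 ≤ M)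
    (hV : ∀ a, ∫ x, f a x ^ 2 ∂gaussianReal 0 1 ≤ V) {s : ℝ} (hs : 0 ≤ s) :
    ‖∫ ω, cexp ((s * ∑ a, f a (X a ω) : ℝ) * I) ∂P -
        (Real.exp (-(s ^ 2 * ∑ a, ∫ x, f a x ^ 2 ∂gaussianReal 0 1) / 2) : ℝ)‖ ≤
      Fintype.card ι * (4 * s ^ 3 * M + s ^ 4 * V ^ 2) := by
  have e1 : ∫ ω, cexp ((s * ∑ a, f a (X a ω) : ℝ) * I) ∂P =
      ∏ a, ∫ x, cexp ((s * f a x : ℝ) * I) ∂gaussianReal 0 1 := by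
    have hm : ∀ a, Measurable fun x => cexp ((s * f a x : ℝ) * I) := fun a =>
      measurable_exp.comp ((measurable_ofReal.comp ((hf a).1.const_mul s)).mul_const _)
    have := hX.indep.integral_fun_prod_comp (f := fun a x => cexp ((s * f a x : ℝ) * I))
      (fun a => (hX.law a).aemeasurable) fun a => (hm a).aestronglyMeasurable
    have e : ∀ ω, cexp ((s * ∑ a, f a (X a ω) : ℝ) * I) =
        ∏ a, cexp ((s * f a (X a ω) : ℝ) * I) := fun ω => by
      rw [← exp_sum, ← Finset.sum_mul, ← ofReal_sum, ← Finset.mul_sum]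
    simp_rw [e]
    rw [this]
    exact Finset.prod_congr rfl fun a _ =>
      (hX.law a).integral_comp (f := fun x => cexp ((s * f a x : ℝ) * I)) (hm a).aestronglyMeasurable
  have e2 : ((Real.exp (-(s ^ 2 * ∑ a, ∫ x, f a x ^ 2 ∂gaussianReal 0 1) / 2) : ℝ) : ℂ) =
      ∏ a, ((Real.exp (-(s ^ 2 * ∫ x, f a x ^ 2 ∂gaussianReal 0 1) / 2) : ℝ) : ℂ) := by
    rw [← ofReal_prod, ← Real.exp_sum, ← Finset.sum_div, Finset.sum_neg_distrib, Finset.mul_sum]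
  rw [e1, e2]
  have hv0 : ∀ a, 0 ≤ ∫ x, f a x ^ 2 ∂gaussianReal 0 1 := fun a =>
    integral_nonneg fun x => sq_nonneg _
  refine (norm_prod_sub_prod_le _ (fun a => ?_) fun a => ?_).trans
    ((Finset.sum_le_sum (g := fun _ => 4 * s ^ 3 * M + s ^ 4 * V ^ 2) fun a _ => ?_).trans ?_)
  · refine (norm_integral_le_of_norm_le (integrable_const 1) (ae_of_all _ fun x => ?_)).trans
      (le_of_eq ?_)
    · rw [norm_exp_ofReal_mul_I]
    · simp
  · rw [norm_real, Real.norm_eq_abs, abs_of_pos (Real.exp_pos _), Real.exp_le_one_iff]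
    have := mul_nonneg (sq_nonneg s) (hv0 a)
    linarith
  · refine (norm_charFun_sub_gaussian_le (hf a) (h0 a) hs).trans ?_
    have := hM a
    have := hV a
    have := hv0 a
    gcongr
  · rw [Finset.sum_const, Finset.card_univ, nsmul_eq_mul]

-- Lets a statistic be replaced by its linear approximation: x ↦ e^{ix} is 1-Lipschitz, and on the
-- exceptional set the difference is at most 2.
open Complex in
theorem norm_integral_cexp_sub_le {Ω : Type*} [MeasurableSpace Ω] {P : Measure Ω}
    [IsProbabilityMeasure P] {U V : Ω → ℝ} (hU : AEMeasurable U P) (hV : AEMeasurable V P)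
    {ε : ℝ} (hε : 0 ≤ ε) :
    ‖∫ ω, cexp (U ω * I) ∂P - ∫ ω, cexp (V ω * I) ∂P‖ ≤
      ε + 2 * P.real {ω | ε ≤ |U ω - V ω|} := by
  set A := {ω | ε ≤ |U ω - V ω|} with hA
  -- U and V are only almost everywhere measurable, so A is replaced by a measurable hull of the
  -- same measure.
  have hAm := measurableSet_toMeasurable P A
  rw [← integral_sub (integrable_cexp_mul_I hU) (integrable_cexp_mul_I hV)]
  have hb : Integrable (fun ω => ε + (toMeasurable P A).indicator (fun _ => (2 : ℝ)) ω) P :=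
    (integrable_const ε).add ((integrable_const 2).indicator hAm)
  refine (norm_integral_le_of_norm_le hb (ae_of_all _ fun ω => ?_)).trans (le_of_eq ?_)
  · by_cases hω : ω ∈ A
    · rw [Set.indicator_of_mem (subset_toMeasurable P A hω)]
      refine (norm_sub_le _ _).trans ?_
      rw [norm_exp_ofReal_mul_I, norm_exp_ofReal_mul_I]
      linarith
    · have h1 : |U ω - V ω| < ε := lt_of_not_ge hω
      have h2 : ‖cexp (U ω * I) - cexp (V ω * I)‖ ≤ |U ω - V ω| := by
        have e : cexp (U ω * I) - cexp (V ω * I) =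
            cexp (V ω * I) * (cexp (I * (U ω - V ω : ℝ)) - 1) := by
          rw [mul_sub, ← exp_add, mul_one]
          congr 2
          push_cast
          ring
        rw [e, norm_mul, norm_exp_ofReal_mul_I, one_mul]
        exact Real.norm_exp_I_mul_ofReal_sub_one_le
      have h3 : 0 ≤ (toMeasurable P A).indicator (fun _ => (2 : ℝ)) ω :=
        Set.indicator_nonneg (fun _ _ => by norm_num) ω
      linarith
  · rw [integral_add (integrable_const ε) ((integrable_const 2).indicator hAm),
      integral_indicator hAm]
    simp [measureReal_def, mul_comm]

/-! ### Asymptotic normality and the quadratic form. -/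

section Core

variable {K : ℕ} {g g' : Fin K → ℝ → ℝ} {L : ℝ}

/-- An envelope uniform over bounded directions u and weights w, whence uniform second and third
moments. -/
theorem abs_projFn_le (hg : ∀ k, IsTestFn (g k) (g' k) L) {u : Fin K → ℝ} {b : ℝ}
    (hu : ∀ k, |u k| ≤ b) (hb : 0 ≤ b) (hL : 0 ≤ L) {w c : ℝ} (hw : |w| ≤ c) (x : ℝ) :
    |projFn g u w x| ≤ K * (b * (L * (2 + c))) * (1 + x ^ 2) := by
  have hc : 0 ≤ c := (abs_nonneg w).trans hw
  have hx : |x| ≤ 1 + x ^ 2 := by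
    rw [abs_le]; constructor <;> nlinarith [sq_nonneg (x - 1), sq_nonneg (x + 1)]
  have h1 : ∀ k, |g k x - (∫ y, g k y * y ∂gaussianReal 0 1) * (w * x)
      - (∫ y, g k y * y ^ 2 ∂gaussianReal 0 1) * (x ^ 2 - 1) / 2| ≤
        L * (2 + c) * (1 + x ^ 2) := fun k => by
    have a1 := (hg k).abs_le x
    have a2 : |∫ y, g k y * y ∂gaussianReal 0 1| ≤ L := by
      rw [← (hg k).integral_deriv]
      refine (norm_integral_le_of_norm_le (f := g' k) (integrable_const L)
        (ae_of_all _ fun x => (hg k).abs_deriv_le x)).trans (le_of_eq ?_)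
      simp
    have a3 := (hg k).abs_integral_mul_sq_le
    set p := ∫ y, g k y * y ∂gaussianReal 0 1
    set q := ∫ y, g k y * y ^ 2 ∂gaussianReal 0 1
    have b1 : |p * (w * x)| ≤ L * (c * (1 + x ^ 2)) := by
      rw [abs_mul, abs_mul]
      gcongr
    have b2 : |q * (x ^ 2 - 1) / 2| ≤ L * (1 + x ^ 2) := by
      rw [mul_div_assoc, abs_mul]
      gcongr
      rw [abs_le]
      constructor <;> nlinarith [sq_nonneg x]
    calc _ ≤ |g k x| + |p * (w * x)| + |q * (x ^ 2 - 1) / 2| :=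
          (abs_sub _ _).trans (by gcongr; exact abs_sub _ _)
      _ ≤ L + L * (c * (1 + x ^ 2)) + L * (1 + x ^ 2) := by gcongr
      _ ≤ _ := by nlinarith [mul_nonneg hL (sq_nonneg x)]
  refine (Finset.abs_sum_le_sum_abs _ _).trans ((Finset.sum_le_sum
    (g := fun _ => b * (L * (2 + c) * (1 + x ^ 2))) fun k _ => ?_).trans (le_of_eq ?_))
  · rw [abs_mul]
    have := h1 k
    have := hu k
    gcongr
  · simp
    ring

open Complex in
/-- Asymptotic normality of the linear statistics. -/
theorem tendsto_charFun_projFn {Ω : ℕ → Type*} [∀ n, MeasurableSpace (Ω n)]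
    {P : ∀ n, Measure (Ω n)} [∀ n, IsProbabilityMeasure (P n)]
    {ι : ℕ → Type*} [∀ n, Fintype (ι n)] {X : ∀ n, ι n → Ω n → ℝ}
    (hX : ∀ n, IsGaussianSample (X n) (P n))
    (hN : Tendsto (fun n => Fintype.card (ι n)) atTop atTop)
    (hg : ∀ k, IsTestFn (g k) (g' k) L) (hL : 0 ≤ L)
    {w : ∀ n, ι n → ℝ} {c : ℝ} (hw : ∀ᶠ n in atTop, ∀ a, |w n a| ≤ c)
    {u : ℕ → Fin K → ℝ} {b : ℝ} (hb : 0 ≤ b) (hu : ∀ n k, |u n k| ≤ b) {v : ℝ}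
    (hv : Tendsto (fun n => (∑ a, ∫ x, projFn g (u n) (w n a) x ^ 2 ∂gaussianReal 0 1) /
      Fintype.card (ι n)) atTop (𝓝 v)) :
    Tendsto (fun n => ∫ ω, cexp (((√(Fintype.card (ι n) : ℝ))⁻¹ *
      ∑ a, projFn g (u n) (w n a) (X n a ω) : ℝ) * I) ∂P n) atTop
      (𝓝 (Real.exp (-v / 2) : ℝ)) := by
  have hN' : Tendsto (fun n => (Fintype.card (ι n) : ℝ)) atTop atTop :=
    tendsto_natCast_atTop_atTop.comp hN
  have hpoly : ∀ m : ℕ, Integrable (fun x : ℝ => (1 + x ^ 2) ^ m) (gaussianReal 0 1) := fun m =>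
    (PolyGrowth.pow (.add (.const 1) (.pow .id 2)) m).integrable
  set C := K * (b * (L * (2 + c)))
  set M := C ^ 3 * ∫ x : ℝ, (1 + x ^ 2) ^ 3 ∂gaussianReal 0 1
  set V := C ^ 2 * ∫ x : ℝ, (1 + x ^ 2) ^ 2 ∂gaussianReal 0 1
  have hgauss : Tendsto (fun n => ((Real.exp (-((√(Fintype.card (ι n) : ℝ))⁻¹ ^ 2 *
      ∑ a, ∫ x, projFn g (u n) (w n a) x ^ 2 ∂gaussianReal 0 1) / 2) : ℝ) : ℂ)) atTop
      (𝓝 (Real.exp (-v / 2) : ℝ)) := by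
    refine (continuous_ofReal.tendsto _).comp ((Real.continuous_exp.tendsto _).comp ?_)
    refine (hv.neg.div_const 2).congr fun n => ?_
    rw [inv_pow, Real.sq_sqrt (Nat.cast_nonneg _)]
    ring
  have hdiff : Tendsto (fun n => ∫ ω, cexp (((√(Fintype.card (ι n) : ℝ))⁻¹ *
      ∑ a, projFn g (u n) (w n a) (X n a ω) : ℝ) * I) ∂P n -
      ((Real.exp (-((√(Fintype.card (ι n) : ℝ))⁻¹ ^ 2 *
      ∑ a, ∫ x, projFn g (u n) (w n a) x ^ 2 ∂gaussianReal 0 1) / 2) : ℝ) : ℂ)) atTop (𝓝 0) := by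
    -- With s = N^(-1/2) the error N(4s³M + s⁴V²) equals 4M N^(-1/2) + V²/N.
    have hz : Tendsto (fun n => 4 * M * (√(Fintype.card (ι n) : ℝ))⁻¹ +
        V ^ 2 * (Fintype.card (ι n) : ℝ)⁻¹) atTop (𝓝 0) := by
      have h1 := (tendsto_inv_atTop_zero.comp (Real.tendsto_sqrt_atTop.comp hN')).const_mul (4 * M)
      have h2 := (tendsto_inv_atTop_zero.comp hN').const_mul (V ^ 2)
      simpa using h1.add h2
    refine squeeze_zero_norm' ?_ hz
    filter_upwards [hw, hN'.eventually_gt_atTop 0] with n hwn hNn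
    have hC : ∀ a x, |projFn g (u n) (w n a) x| ≤ C * (1 + x ^ 2) := fun a x =>
      abs_projFn_le hg (hu n) hb hL (hwn a) x
    refine ((hX n).norm_charFun_sum_sub_le (fun a => polyGrowth_projFn hg (u n) (w n a))
      (fun a => integral_projFn hg (u n) (w n a)) (M := M) (V := V) (fun a => ?_) (fun a => ?_)
      (inv_nonneg.2 (Real.sqrt_nonneg _))).trans (le_of_eq ?_)
    · simp only [M]
      rw [← integral_const_mul]
      refine integral_mono ((polyGrowth_projFn hg (u n) (w n a)).abs.pow 3).integrable
        ((hpoly 3).const_mul _) fun x => ?_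
      simp only
      rw [← mul_pow]
      have := hC a x
      gcongr
    · simp only [V]
      rw [← integral_const_mul]
      refine integral_mono ((polyGrowth_projFn hg (u n) (w n a)).pow 2).integrable
        ((hpoly 2).const_mul _) fun x => ?_
      simp only
      rw [← mul_pow]
      exact sq_le_sq.2 ((hC a x).trans (le_abs_self _))
    · set r := √(Fintype.card (ι n) : ℝ)
      have hr : 0 < r := Real.sqrt_pos.2 hNn
      have : (Fintype.card (ι n) : ℝ) = r ^ 2 := (Real.sq_sqrt hNn.le).symm
      rw [this]
      field_simp
  have := hdiff.add hgauss
  simpa using this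

/-- The limit law of the quadratic form. -/
theorem tendstoInDistribution_quadForm {Ω : ℕ → Type*} [∀ n, MeasurableSpace (Ω n)]
    {P : ∀ n, Measure (Ω n)} [∀ n, IsProbabilityMeasure (P n)]
    {ι : ℕ → Type*} [∀ n, Fintype (ι n)] {X : ∀ n, ι n → Ω n → ℝ}
    (hX : ∀ n, IsGaussianSample (X n) (P n))
    (hN : Tendsto (fun n => Fintype.card (ι n)) atTop atTop)
    (hg : ∀ k, IsTestFn (g k) (g' k) L) (hL : 0 ≤ L)
    (horth : ∀ k l, ∫ x, g k x * g l x ∂gaussianReal 0 1 = if k = l then 1 else 0)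
    {w : ∀ n, ι n → ℝ} {c : ℝ} (hw : ∀ᶠ n in atTop, ∀ a, |w n a| ≤ c)
    {t : ℕ → ℝ} (ht : ∀ᶠ n in atTop, -1 ≤ t n)
    (hlim : Tendsto (fun n => (∑ a, (w n a ^ 2 - 2 * w n a)) / Fintype.card (ι n) - t n)
      atTop (𝓝 0))
    {V : ∀ n, Ω n → Fin K → ℝ} (hVm : ∀ n k, AEMeasurable (fun ω => V n ω k) (P n))
    (hV : ∀ k, ∀ ε > 0, Tendsto (fun n => (P n).real {ω | ε ≤ |√(Fintype.card (ι n) : ℝ) * V n ω k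
      - (√(Fintype.card (ι n) : ℝ))⁻¹ * ∑ a, (g k (X n a ω)
        - (∫ y, g k y * y ∂gaussianReal 0 1) * (w n a * X n a ω)
        - (∫ y, g k y * y ^ 2 ∂gaussianReal 0 1) * (X n a ω ^ 2 - 1) / 2)|}) atTop (𝓝 0)) :
    TendstoInDistribution (fun n ω => (Fintype.card (ι n) : ℝ) * (V n ω ⬝ᵥ
      (covMat (fun k => ∫ y, g k y * y ∂gaussianReal 0 1)
        (fun k => ∫ y, g k y * y ^ 2 ∂gaussianReal 0 1) (t n))⁻¹.mulVec (V n ω)))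
      atTop id P (chiSquared K) := by
  set c₁ : Fin K → ℝ := fun k => ∫ y, g k y * y ∂gaussianReal 0 1 with hc₁
  set c₂ : Fin K → ℝ := fun k => ∫ y, g k y * y ^ 2 ∂gaussianReal 0 1 with hc₂
  set N : ℕ → ℝ := fun n => (Fintype.card (ι n) : ℝ) with hNdef
  have hN0 : ∀ n, 0 ≤ N n := fun n => Nat.cast_nonneg _
  have hNtop : Tendsto N atTop atTop := tendsto_natCast_atTop_atTop.comp hN
  obtain ⟨lam, hlam, hle⟩ := exists_le_covForm hg horth
  have hB : ∀ n, ∃ B : Matrix (Fin K) (Fin K) ℝ, (∀ i k, |B i k| ≤ 1 + 1 / lam) ∧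
      (-1 ≤ t n →
        (∀ v, v ⬝ᵥ (covMat c₁ c₂ (t n))⁻¹.mulVec v = ∑ i, B.mulVec v i ^ 2) ∧
        ∀ z : Fin K → ℝ, covForm c₁ c₂ (t n) (B.transpose.mulVec z) = ∑ i, z i ^ 2) := fun n => by
    by_cases htn : -1 ≤ t n
    · obtain ⟨B, h1, h2, h3⟩ := exists_whitening (covMat_posDef hg horth htn) hlam fun u k => by
        rw [dotProduct_covMat_mulVec]
        exact (hle u k).trans (covForm_mono _ _ u htn)
      exact ⟨B, h3, fun _ => ⟨h1, fun z => by rw [← dotProduct_covMat_mulVec]; exact h2 z⟩⟩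
    · exact ⟨0, fun i k => by simp; positivity, fun h => absurd h htn⟩
  choose B hBb hBw using hB
  set b₀ := 1 + 1 / lam
  have hb₀ : 0 ≤ b₀ := by positivity
  set Z : ∀ n, Ω n → EuclideanSpace ℝ (Fin K) := fun n ω =>
    WithLp.toLp 2 ((B n).mulVec fun k => √(N n) * V n ω k) with hZ
  have hZm : ∀ n, AEMeasurable (Z n) (P n) := fun n => by
    refine (PiLp.continuous_toLp 2 _).measurable.comp_aemeasurable (aemeasurable_pi_lambda _ fun i => ?_)
    simp only [Matrix.mulVec, dotProduct]
    exact Finset.aemeasurable_fun_sum _ fun k _ => ((hVm n k).const_mul _).const_mul _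
  have hYm : Measurable (WithLp.toLp 2 : (Fin K → ℝ) → EuclideanSpace ℝ (Fin K)) := (PiLp.continuous_toLp 2 _).measurable
  -- asymptotic normality of the whitened vectors
  have hnormal : TendstoInDistribution Z atTop (WithLp.toLp 2) P (Measure.pi fun _ => gaussianReal 0 1) := by
    refine ⟨hZm, hYm.aemeasurable, ?_⟩
    refine ProbabilityMeasure.tendsto_iff_tendsto_charFun.2 fun z => ?_
    simp only [ProbabilityMeasure.coe_mk]
    rw [map_pi_eq_stdGaussian, charFun_stdGaussian]
    set u : ℕ → Fin K → ℝ := fun n => (B n).transpose.mulVec z with hu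
    set b := ∑ i, b₀ * |z i|
    have hb : 0 ≤ b := Finset.sum_nonneg fun i _ => by positivity
    have hub : ∀ n k, |u n k| ≤ b := fun n k => by
      simp only [hu, Matrix.mulVec, dotProduct, Matrix.transpose_apply]
      refine (Finset.abs_sum_le_sum_abs _ _).trans (Finset.sum_le_sum fun i _ => ?_)
      rw [abs_mul]
      exact mul_le_mul_of_nonneg_right (hBb n i k) (abs_nonneg _)
    have hinner : ∀ n ω, inner ℝ (Z n ω) z = ∑ k, u n k * (√(N n) * V n ω k) := fun n ω => by
      have : inner ℝ (Z n ω) z = ∑ i, z i * (B n).mulVec (fun k => √(N n) * V n ω k) i := by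
        simp [hZ, PiLp.inner_apply]
      rw [this]
      simp only [hu, Matrix.mulVec, dotProduct, Matrix.transpose_apply, Finset.mul_sum,
        Finset.sum_mul]
      rw [Finset.sum_comm]
      exact Finset.sum_congr rfl fun i _ => Finset.sum_congr rfl fun j _ => by ring
    have hlin := tendsto_charFun_projFn hX hN hg hL hw hb hub (v := ‖z‖ ^ 2) (by
      -- The average variance is affine in the average of w² - 2w, so replacing that average by t n
      -- costs only the vanishing difference times a bounded square.
      have hav : ∀ᶠ n in atTop, covForm c₁ c₂ (t n) (u n)
          + ((∑ a, (w n a ^ 2 - 2 * w n a)) / N n - t n) * (∑ k, u n k * c₁ k) ^ 2 =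
          (∑ a, ∫ x, projFn g (u n) (w n a) x ^ 2 ∂gaussianReal 0 1) / N n := by
        filter_upwards [hNtop.eventually_gt_atTop 0] with n hn
        have e1 : ∀ a, ∫ x, projFn g (u n) (w n a) x ^ 2 ∂gaussianReal 0 1 =
            (w n a ^ 2 - 2 * w n a) * (∑ k, u n k * c₁ k) ^ 2 +
              (∑ k, u n k ^ 2 - (∑ k, u n k * c₂ k) ^ 2 / 2) := fun a => by
          rw [integral_projFn_sq hg horth, covForm]
          ring
        rw [Finset.sum_congr rfl fun a _ => e1 a, Finset.sum_add_distrib, ← Finset.sum_mul,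
          Finset.sum_const, Finset.card_univ, nsmul_eq_mul, covForm]
        change _ = (_ + N n * _) / N n
        field_simp
        ring
      refine Tendsto.congr' hav ?_
      have h1 : Tendsto (fun n => ((∑ a, (w n a ^ 2 - 2 * w n a)) / N n - t n) *
          (∑ k, u n k * c₁ k) ^ 2) atTop (𝓝 0) := by
        refine hlim.zero_mul_isBoundedUnder_le ⟨(∑ k, b * |c₁ k|) ^ 2, ?_⟩
        refine eventually_map.2 (Eventually.of_forall fun n => ?_)
        simp only [Function.comp_apply, Real.norm_eq_abs, abs_pow]
        gcongr
        refine (Finset.abs_sum_le_sum_abs _ _).trans (Finset.sum_le_sum fun k _ => ?_)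
        rw [abs_mul]
        exact mul_le_mul_of_nonneg_right (hub n k) (abs_nonneg _)
      -- Whitening makes this variance exactly |z|² for each late n, so t n need not converge.
      have h2 : Tendsto (fun n => covForm c₁ c₂ (t n) (u n)) atTop (𝓝 (‖z‖ ^ 2)) := by
        refine tendsto_const_nhds.congr' ?_
        filter_upwards [ht] with n hn
        rw [(hBw n hn).2, EuclideanSpace.real_norm_sq_eq]
      simpa using h2.add h1)
    set U : ∀ n, Ω n → ℝ := fun n ω => ∑ k, u n k * (√(N n) * V n ω k)
    set W : ∀ n, Ω n → ℝ := fun n ω => (√(N n))⁻¹ * ∑ a, projFn g (u n) (w n a) (X n a ω)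
    have hUm : ∀ n, AEMeasurable (U n) (P n) := fun n =>
      Finset.aemeasurable_fun_sum _ fun k _ => ((hVm n k).const_mul _).const_mul _
    have hWm : ∀ n, AEMeasurable (W n) (P n) := fun n =>
      (Finset.aemeasurable_fun_sum _ fun a _ => (polyGrowth_projFn hg (u n) (w n a)).1.comp_aemeasurable
        ((hX n).law a).aemeasurable).const_mul _
    have hchar : ∀ n, charFun ((P n).map (Z n)) z = ∫ ω, Complex.exp (U n ω * Complex.I) ∂P n :=
      fun n => by
        rw [charFun_apply, integral_map (hZm n) (by fun_prop)]
        simp_rw [hinner]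
        rfl
    simp_rw [hchar]
    set R : ∀ n, Fin K → Ω n → ℝ := fun n k ω => √(N n) * V n ω k
      - (√(N n))⁻¹ * ∑ a, (g k (X n a ω) - c₁ k * (w n a * X n a ω)
        - c₂ k * (X n a ω ^ 2 - 1) / 2)
    have hUW : ∀ n ω, U n ω - W n ω = ∑ k, u n k * R n k ω := fun n ω => by
      have h1 : W n ω = ∑ k, u n k * ((√(N n))⁻¹ * ∑ a, (g k (X n a ω) - c₁ k * (w n a * X n a ω)
          - c₂ k * (X n a ω ^ 2 - 1) / 2)) := by
        simp only [W, projFn]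
        rw [Finset.sum_comm, Finset.mul_sum]
        refine Finset.sum_congr rfl fun k _ => ?_
        rw [← Finset.mul_sum]
        ring
      rw [h1, ← Finset.sum_sub_distrib]
      exact Finset.sum_congr rfl fun k _ => (mul_sub _ _ _).symm
    have hsmall : Tendsto (fun n => ∫ ω, Complex.exp (U n ω * Complex.I) ∂P n -
        ∫ ω, Complex.exp (W n ω * Complex.I) ∂P n) atTop (𝓝 0) := by
      rw [Metric.tendsto_nhds]
      intro ε hε
      -- If all |R k| < η then |U - W| ≤ K b η < ε/4. The characteristic functions then differ by
      -- less than ε/4 + 2 · ε/8.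
      set η := ε / 4 / ((b + 1) * (K + 1)) with hη
      have hη0 : 0 < η := by positivity
      have hsum : Tendsto (fun n => ∑ k, (P n).real {ω | η ≤ |R n k ω|}) atTop (𝓝 0) := by
        have h : Tendsto (fun n => ∑ k, (P n).real {ω | η ≤ |R n k ω|}) atTop
            (𝓝 (∑ _k : Fin K, (0 : ℝ))) := tendsto_finsetSum _ fun k _ => hV k η hη0
        simpa only [Finset.sum_const_zero] using h
      filter_upwards [hsum.eventually_lt_const (show (0 : ℝ) < ε / 8 by positivity)] with n hn
      rw [dist_zero_right]
      refine (norm_integral_cexp_sub_le (hUm n) (hWm n)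
        (show (0 : ℝ) ≤ ε / 4 by positivity)).trans_lt ?_
      have hsub : {ω | ε / 4 ≤ |U n ω - W n ω|} ⊆ ⋃ k, {ω | η ≤ |R n k ω|} := fun ω hω => by
        by_contra hcon
        simp only [Set.mem_iUnion, Set.mem_ofPred_eq, not_exists, not_le] at hcon
        have h1 : |U n ω - W n ω| ≤ K * (b * η) := by
          rw [hUW]
          refine (Finset.abs_sum_le_sum_abs _ _).trans ((Finset.sum_le_sum
            (g := fun _ => b * η) fun k _ => ?_).trans (le_of_eq (by simp)))
          rw [abs_mul]
          have := hub n k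
          have := (hcon k).le
          gcongr
        have h2 : K * (b * η) < (b + 1) * (K + 1) * η := by
          have hK0 : (0 : ℝ) ≤ K := Nat.cast_nonneg _
          nlinarith [mul_nonneg hK0 hη0.le, mul_nonneg hb hη0.le]
        have h3 : (b + 1) * (K + 1) * η = ε / 4 := by rw [hη]; field_simp
        have h4 : ε / 4 ≤ |U n ω - W n ω| := hω
        linarith
      have := (measureReal_mono (μ := P n) hsub).trans (measureReal_iUnion_le' _)
      linarith
    have hfin := hsmall.add hlin
    rw [zero_add] at hfin
    refine (hfin.congr fun n => sub_add_cancel _ _).trans (le_of_eq ?_)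
    push_cast
    rfl
  -- the continuous mapping theorem
  have hcm := hnormal.continuous_comp (g := fun x : EuclideanSpace ℝ (Fin K) => ∑ k, x k ^ 2)
    (by fun_prop)
  have hQm : ∀ n, AEMeasurable (fun ω => N n * (V n ω ⬝ᵥ
      (covMat c₁ c₂ (t n))⁻¹.mulVec (V n ω))) (P n) := fun n => by
    simp only [Matrix.mulVec, dotProduct]
    exact (Finset.aemeasurable_fun_sum _ fun k _ => (hVm n k).mul
      (Finset.aemeasurable_fun_sum _ fun l _ => (hVm n l).const_mul _)).const_mul _
  refine ⟨hQm, measurable_id.aemeasurable, ?_⟩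
  have hlaw : (chiSquared K).map id = (Measure.pi fun _ : Fin K => gaussianReal 0 1).map
      ((fun x : EuclideanSpace ℝ (Fin K) => ∑ k, x k ^ 2) ∘ WithLp.toLp 2) := by
    rw [Measure.map_id]; rfl
  have hconv := hcm.tendsto
  have hT : (⟨(chiSquared K).map id, Measure.isProbabilityMeasure_map measurable_id.aemeasurable⟩ :
      ProbabilityMeasure ℝ) = ⟨(Measure.pi fun _ : Fin K => gaussianReal 0 1).map
      ((fun x : EuclideanSpace ℝ (Fin K) => ∑ k, x k ^ 2) ∘ WithLp.toLp 2),
      Measure.isProbabilityMeasure_map hcm.aemeasurable_limit⟩ := Subtype.ext hlaw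
  rw [hT]
  refine hconv.congr' ?_
  filter_upwards [ht] with n hn
  refine Subtype.ext ?_
  simp only
  congr 1
  ext ω
  simp only [Function.comp_apply, hZ]
  rw [(hBw n hn).1, Finset.mul_sum]
  refine Finset.sum_congr rfl fun i _ => ?_
  have : (B n).mulVec (fun k => √(N n) * V n ω k) = √(N n) • (B n).mulVec (V n ω) := by
    rw [← Matrix.mulVec_smul]; rfl
  rw [this, Pi.smul_apply, smul_eq_mul, mul_pow, Real.sq_sqrt (hN0 n)]

end Core

/-! ### Limit laws for the two ways of standardizing -/

section Models

variable {K : ℕ} {g g' : Fin K → ℝ → ℝ} {L : ℝ}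
  {Ω : ℕ → Type*} [∀ n, MeasurableSpace (Ω n)]
  {P : ∀ n, Measure (Ω n)} [∀ n, IsProbabilityMeasure (P n)]
  {ι κ : ℕ → Type*} [∀ n, Fintype (ι n)] [∀ n, DecidableEq (κ n)]
  {X : ∀ n, ι n → Ω n → ℝ}

/-- Since ∑ d = ∑ w x, the difference between √N V and the linear statistic is exactly N^(-1/2)
times the remainder. -/
theorem tendstoInDistribution_of_remainder (hX : ∀ n, IsGaussianSample (X n) (P n))
    (hN : Tendsto (fun n => Fintype.card (ι n)) atTop atTop)
    (hg : ∀ k, IsTestFn (g k) (g' k) L) (hL : 0 ≤ L)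
    (horth : ∀ k l, ∫ x, g k x * g l x ∂gaussianReal 0 1 = if k = l then 1 else 0)
    {w : ∀ n, ι n → ℝ} {c : ℝ} (hw : ∀ᶠ n in atTop, ∀ a, |w n a| ≤ c)
    {t : ℕ → ℝ} (ht : ∀ᶠ n in atTop, -1 ≤ t n)
    (hlim : Tendsto (fun n => (∑ a, (w n a ^ 2 - 2 * w n a)) / Fintype.card (ι n) - t n)
      atTop (𝓝 0))
    {r : ∀ n, ι n → κ n} {d : ∀ n, ι n → Ω n → ℝ}
    (hd : ∀ᶠ n in atTop, ∀ ω, ∑ a, d n a ω = ∑ a, w n a * X n a ω)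
    (hrem : ∀ k, ∀ ε > 0, Tendsto (fun n => (P n).real {ω | ε * √(Fintype.card (ι n) : ℝ) ≤
      |remainder (g k) (r n) (fun a => X n a ω) fun a => d n a ω|}) atTop (𝓝 0))
    {V : ∀ n, Ω n → Fin K → ℝ} (hVm : ∀ n k, AEMeasurable (fun ω => V n ω k) (P n))
    (hV : ∀ᶠ n in atTop, ∀ ω k, V n ω k =
      (∑ a, g k (standardize (r n) (fun a => X n a ω) (fun a => d n a ω) a)) /
        (Fintype.card (ι n) : ℝ)) :
    TendstoInDistribution (fun n ω => (Fintype.card (ι n) : ℝ) * (V n ω ⬝ᵥ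
      (covMat (fun k => ∫ y, g k y * y ∂gaussianReal 0 1)
        (fun k => ∫ y, g k y * y ^ 2 ∂gaussianReal 0 1) (t n))⁻¹.mulVec (V n ω)))
      atTop id P (chiSquared K) := by
  refine tendstoInDistribution_quadForm hX hN hg hL horth hw ht hlim hVm fun k ε hε => ?_
  refine (hrem k ε hε).congr' ?_
  filter_upwards [hd, hV, hN.eventually_gt_atTop 0] with n hdn hVn hNn
  have hN0 : (0 : ℝ) < Fintype.card (ι n) := Nat.cast_pos.2 hNn
  congr 1
  ext ω
  simp only [Set.mem_ofPred_eq]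
  set c₁ := ∫ y, g k y * y ∂gaussianReal 0 1
  set c₂ := ∫ y, g k y * y ^ 2 ∂gaussianReal 0 1
  set ρ := √(Fintype.card (ι n) : ℝ) with hρ
  have hρ0 : 0 < ρ := Real.sqrt_pos.2 hN0
  have hρ2 : (Fintype.card (ι n) : ℝ) = ρ ^ 2 := (Real.sq_sqrt hN0.le).symm
  have e : ρ * V n ω k - ρ⁻¹ * ∑ a, (g k (X n a ω) - c₁ * (w n a * X n a ω)
      - c₂ * (X n a ω ^ 2 - 1) / 2) =
      ρ⁻¹ * remainder (g k) (r n) (fun a => X n a ω) fun a => d n a ω := by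
    rw [remainder, hVn]
    simp only [Finset.sum_add_distrib, Finset.sum_sub_distrib, ← Finset.mul_sum, hdn]
    rw [hρ2]
    field_simp
    ring
  rw [e, abs_mul, abs_of_pos (inv_pos.2 hρ0), ← div_eq_inv_mul, le_div_iff₀ hρ0]

variable [∀ n, Fintype (κ n)]

/-- Group means as centres and a pooled scale. -/
theorem tendstoInDistribution_groupMeans (hX : ∀ n, IsGaussianSample (X n) (P n))
    (hN : Tendsto (fun n => Fintype.card (ι n)) atTop atTop)
    (hg : ∀ k, IsTestFn (g k) (g' k) L) (hL : 0 ≤ L)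
    (horth : ∀ k l, ∫ x, g k x * g l x ∂gaussianReal 0 1 = if k = l then 1 else 0)
    {r : ∀ n, ι n → κ n} (hr : ∀ᶠ n in atTop, ∀ k, 0 < (fiber (r n) k).card)
    (hκ : Tendsto (fun n => (Fintype.card (κ n) : ℝ) / √(Fintype.card (ι n) : ℝ)) atTop (𝓝 0))
    {V : ∀ n, Ω n → Fin K → ℝ} (hVm : ∀ n k, AEMeasurable (fun ω => V n ω k) (P n))
    (hV : ∀ᶠ n in atTop, ∀ ω k, V n ω k =
      (∑ a, g k (standardize (fun _ => ()) (fun a => X n a ω)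
        (fun a => fiberMean (r n) (fun b => X n b ω) (r n a)) a)) / (Fintype.card (ι n) : ℝ)) :
    TendstoInDistribution (fun n ω => (Fintype.card (ι n) : ℝ) * (V n ω ⬝ᵥ
      (covMat (fun k => ∫ y, g k y * y ∂gaussianReal 0 1)
        (fun k => ∫ y, g k y * y ^ 2 ∂gaussianReal 0 1) (-1))⁻¹.mulVec (V n ω)))
      atTop id P (chiSquared K) := by
  have hN' : Tendsto (fun n => (Fintype.card (ι n) : ℝ)) atTop atTop :=
    tendsto_natCast_atTop_atTop.comp hN
  have hs := tendsto_inv_atTop_zero.comp (Real.tendsto_sqrt_atTop.comp hN')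
  have hi := tendsto_inv_atTop_zero.comp hN'
  -- Group means, counted once per observation, add up to the sum of the observations; so w = 1 and
  -- w² - 2w = -1.
  refine tendstoInDistribution_of_remainder hX hN hg hL horth (w := fun _ _ => 1) (c := 1)
    (by simp) (t := fun _ => -1) (by simp) ?_ (r := fun _ _ => ())
    (d := fun n a ω => fiberMean (r n) (fun b => X n b ω) (r n a)) ?_ (fun k ε hε => ?_) hVm hV
  · refine tendsto_const_nhds.congr' ?_
    filter_upwards [hN'.eventually_gt_atTop 0] with n hn
    rw [Finset.sum_const, Finset.card_univ, nsmul_eq_mul]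
    field_simp
    norm_num
  · filter_upwards [hr] with n hrn ω
    simp only [one_mul]
    exact sum_fiberMean (r n) hrn fun b => X n b ω
  · set C := (71 * L + 16) / ε
    have hz : Tendsto (fun n => 64 * ((Fintype.card (κ n) : ℝ) / √(Fintype.card (ι n) : ℝ)) *
        (√(Fintype.card (ι n) : ℝ))⁻¹ + 128 * (Fintype.card (ι n) : ℝ)⁻¹ +
        C * ((2 + L ^ 2) * (√(Fintype.card (ι n) : ℝ))⁻¹ +
          (3 + L ^ 2) * ((Fintype.card (κ n) : ℝ) / √(Fintype.card (ι n) : ℝ)))) atTop (𝓝 0) := by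
      have := (((hκ.const_mul 64).mul hs).add (hi.const_mul 128)).add
        (((hs.const_mul (2 + L ^ 2)).add (hκ.const_mul (3 + L ^ 2))).const_mul C)
      simpa using this
    refine squeeze_zero' (Eventually.of_forall fun n => measureReal_nonneg) ?_ hz
    filter_upwards [hr, hN'.eventually_gt_atTop 0] with n hrn hNn
    have hρ0 : 0 < √(Fintype.card (ι n) : ℝ) := Real.sqrt_pos.2 hNn
    refine (measureReal_remainder_groupMeans_le (hX n) (hg k) (r n) hrn (Nat.cast_pos.1 hNn)
      (mul_pos hε hρ0)).trans (le_of_eq ?_)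
    set ρ := √(Fintype.card (ι n) : ℝ)
    have hρ2 : (Fintype.card (ι n) : ℝ) = ρ ^ 2 := (Real.sq_sqrt hNn.le).symm
    rw [hρ2]
    simp only [C]
    field_simp

/-- The weights of the observations when a common centre is estimated by the mean of the group
means and every group has its own scale. -/
noncomputable def scaleWeight {ι κ : Type*} [Fintype ι] [Fintype κ] [DecidableEq κ] (r : ι → κ)
    (σ : κ → ℝ) (k : κ) : ℝ :=
  σ k / (Fintype.card κ * ((fiber r k).card : ℝ) / Fintype.card ι) *
    ∑ l, ((fiber r l).card : ℝ) / Fintype.card ι / σ l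

/-- A common centre and group scales. -/
theorem tendstoInDistribution_groupScales (hX : ∀ n, IsGaussianSample (X n) (P n))
    (hN : Tendsto (fun n => Fintype.card (ι n)) atTop atTop)
    (hg : ∀ k, IsTestFn (g k) (g' k) L) (hL : 0 ≤ L)
    (horth : ∀ k l, ∫ x, g k x * g l x ∂gaussianReal 0 1 = if k = l then 1 else 0)
    {r : ∀ n, ι n → κ n} (hr : ∀ᶠ n in atTop, ∀ k, 0 < (fiber (r n) k).card)
    (hκ0 : ∀ᶠ n in atTop, 0 < Fintype.card (κ n))
    (hκ : Tendsto (fun n => (Fintype.card (κ n) : ℝ) / √(Fintype.card (ι n) : ℝ)) atTop (𝓝 0))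
    {σ : ∀ n, κ n → ℝ} {α β c : ℝ} (hα : 0 < α)
    (hσ : ∀ᶠ n in atTop, ∀ k, α ≤ σ n k ∧ σ n k ≤ β) (hc : 0 < c)
    (hq : ∀ᶠ n in atTop, ∀ k,
      c ≤ Fintype.card (κ n) * ((fiber (r n) k).card : ℝ) / Fintype.card (ι n))
    {t : ℕ → ℝ} (ht : ∀ᶠ n in atTop, -1 ≤ t n)
    (hlim : Tendsto (fun n => ∑ k, ((fiber (r n) k).card : ℝ) / Fintype.card (ι n) *
      (scaleWeight (r n) (σ n) k ^ 2 - 2 * scaleWeight (r n) (σ n) k) - t n) atTop (𝓝 0))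
    {V : ∀ n, Ω n → Fin K → ℝ} (hVm : ∀ n k, AEMeasurable (fun ω => V n ω k) (P n))
    (hV : ∀ᶠ n in atTop, ∀ ω k, V n ω k =
      (∑ a, g k (standardize (r n) (fun a => X n a ω) (fun a =>
        (∑ k, σ n k * fiberMean (r n) (fun b => X n b ω) k) / Fintype.card (κ n) / σ n (r n a)) a))
          / (Fintype.card (ι n) : ℝ)) :
    TendstoInDistribution (fun n ω => (Fintype.card (ι n) : ℝ) * (V n ω ⬝ᵥ
      (covMat (fun k => ∫ y, g k y * y ∂gaussianReal 0 1)
        (fun k => ∫ y, g k y * y ^ 2 ∂gaussianReal 0 1) (t n))⁻¹.mulVec (V n ω)))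
      atTop id P (chiSquared K) := by
  have hN' : Tendsto (fun n => (Fintype.card (ι n) : ℝ)) atTop atTop :=
    tendsto_natCast_atTop_atTop.comp hN
  have hs := tendsto_inv_atTop_zero.comp (Real.tendsto_sqrt_atTop.comp hN')
  have hi := tendsto_inv_atTop_zero.comp hN'
  refine tendstoInDistribution_of_remainder hX hN hg hL horth
    (w := fun n a => scaleWeight (r n) (σ n) (r n a)) (c := β / c * (1 / α)) ?_ ht ?_
    (r := r) (d := fun n a ω => (∑ k, σ n k * fiberMean (r n) (fun b => X n b ω) k) /
      Fintype.card (κ n) / σ n (r n a)) ?_ (fun k ε hε => ?_) hVm hV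
  -- The weight is σ_k/q_k, at most β/c, times an average of the 1/σ_l, at most 1/α.
  · filter_upwards [hσ, hq, hN'.eventually_gt_atTop 0] with n hσn hqn hNn a
    have h1 : ∀ k, 0 < σ n k := fun k => hα.trans_le (hσn k).1
    have h2 : (0 : ℝ) < Fintype.card (κ n) * ((fiber (r n) (r n a)).card : ℝ) /
      Fintype.card (ι n) := hc.trans_le (hqn _)
    have h3 : ∑ l, ((fiber (r n) l).card : ℝ) / Fintype.card (ι n) / σ n l ≤ 1 / α := by
      calc _ ≤ ∑ l, ((fiber (r n) l).card : ℝ) / Fintype.card (ι n) / α := by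
            refine Finset.sum_le_sum fun l _ => ?_
            have := (hσn l).1
            gcongr
        _ = 1 / α := by
            rw [← Finset.sum_div, ← Finset.sum_div, sum_card_fiber, div_self hNn.ne']
    have h4 : 0 ≤ ∑ l, ((fiber (r n) l).card : ℝ) / Fintype.card (ι n) / σ n l :=
      Finset.sum_nonneg fun l _ => by have := h1 l; positivity
    have h5 := h1 (r n a)
    rw [scaleWeight, abs_of_nonneg (by positivity)]
    have h6 := (hσn (r n a)).2
    have h7 := hqn (r n a)
    have h8 : 0 ≤ β := h5.le.trans h6
    gcongr
  · refine hlim.congr fun n => ?_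
    rw [sum_comp (r n) fun k => scaleWeight (r n) (σ n) k ^ 2 - 2 * scaleWeight (r n) (σ n) k,
      Finset.sum_div]
    congr 1
    exact Finset.sum_congr rfl fun k _ => by ring
  -- Summing centre/σ over all observations gives the centre times N T; expanding the centre into
  -- group means then exhibits the coefficient of each observation.
  · filter_upwards [hr, hN'.eventually_gt_atTop 0, hκ0] with n hrn hNn hκn ω
    have hJ : (0 : ℝ) < Fintype.card (κ n) := Nat.cast_pos.2 hκn
    have e1 := sum_mul_comp (r n) (fun a => X n a ω) (scaleWeight (r n) (σ n))
    simp_rw [mul_comm (X n _ ω)] at e1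
    rw [e1, sum_comp (r n) fun k => (∑ k, σ n k * fiberMean (r n) (fun b => X n b ω) k) /
      Fintype.card (κ n) / σ n k]
    set δ := ∑ k, σ n k * fiberMean (r n) (fun b => X n b ω) k with hδ
    set T := ∑ l, ((fiber (r n) l).card : ℝ) / Fintype.card (ι n) / σ n l with hT
    have e2 : ∑ k, ((fiber (r n) k).card : ℝ) * (δ / Fintype.card (κ n) / σ n k) =
        δ / Fintype.card (κ n) * (Fintype.card (ι n) * T) := by
      rw [hT, Finset.mul_sum, Finset.mul_sum]
      refine Finset.sum_congr rfl fun k _ => ?_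
      field_simp
    rw [e2, hδ, Finset.sum_div, Finset.sum_mul]
    refine Finset.sum_congr rfl fun k _ => ?_
    have hk : (0 : ℝ) < (fiber (r n) k).card := Nat.cast_pos.2 (hrn k)
    rw [scaleWeight, fiberMean, ← hT]
    field_simp
  · set C := (71 * L + 16) / ε
    set C' := (2 + 1 / α ^ 2) * (β ^ 2 / c) + (1 + L ^ 2) / α ^ 2
    have hz : Tendsto (fun n => 64 * β ^ 2 / (c * α ^ 2) * (Fintype.card (ι n) : ℝ)⁻¹ +
        128 / c * ((Fintype.card (κ n) : ℝ) / √(Fintype.card (ι n) : ℝ)) ^ 2 +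
        C * ((2 + L ^ 2) * ((Fintype.card (κ n) : ℝ) / √(Fintype.card (ι n) : ℝ)) +
          C' * (√(Fintype.card (ι n) : ℝ))⁻¹)) atTop (𝓝 0) := by
      have := ((hi.const_mul (64 * β ^ 2 / (c * α ^ 2))).add ((hκ.pow 2).const_mul (128 / c))).add
        (((hκ.const_mul (2 + L ^ 2)).add (hs.const_mul C')).const_mul C)
      simpa using this
    refine squeeze_zero' (Eventually.of_forall fun n => measureReal_nonneg) ?_ hz
    filter_upwards [hr, hN'.eventually_gt_atTop 0, hκ0, hσ, hq] with n hrn hNn hκn hσn hqn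
    have hρ0 : 0 < √(Fintype.card (ι n) : ℝ) := Real.sqrt_pos.2 hNn
    refine (measureReal_remainder_groupScales_le (hX n) (hg k) (r n) hrn hκn hα hσn hc hqn
      (mul_pos hε hρ0)).trans (le_of_eq ?_)
    change _ + _ + (71 * L + 16) * ((2 + L ^ 2) * (Fintype.card (κ n) : ℝ) + C') / _ = _
    generalize C' = D
    set ρ := √(Fintype.card (ι n) : ℝ)
    have hρ2 : (Fintype.card (ι n) : ℝ) = ρ ^ 2 := (Real.sq_sqrt hNn.le).symm
    rw [hρ2]
    simp only [C]
    field_simp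

end Models

/-! ### One-way layouts as Gaussian samples -/

section Layout

variable {J : ℕ} {m : ℕ → ℕ}

theorem sum_layout (J : ℕ) (m : ℕ → ℕ) (f : ℕ → ℕ → ℝ) :
    ∑ j ∈ Finset.range J, ∑ i ∈ Finset.range (m j), f j i =
      ∑ a : (Σ j : Fin J, Fin (m j)), f a.1 a.2 := by
  rw [Fintype.sum_sigma, Finset.sum_range]
  exact Finset.sum_congr rfl fun j _ => by rw [Finset.sum_range]

theorem card_layout (J : ℕ) (m : ℕ → ℕ) : Fintype.card (Σ j : Fin J, Fin (m j)) = total J m := by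
  rw [Fintype.card_sigma, total, Finset.sum_range]
  simp

theorem sum_fiber_fst (j : Fin J) (f : ℕ → ℕ → ℝ) :
    ∑ a ∈ fiber (Sigma.fst : (Σ j : Fin J, Fin (m j)) → Fin J) j, f a.1 a.2 =
      ∑ i ∈ Finset.range (m j), f j i := by
  rw [fiber, Finset.sum_filter, Fintype.sum_sigma, Finset.sum_range]
  rw [Finset.sum_eq_single j (fun b _ hb => by simp [hb]) (by simp)]
  simp

theorem card_fiber_fst (j : Fin J) :
    (fiber (Sigma.fst : (Σ j : Fin J, Fin (m j)) → Fin J) j).card = m j := by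
  have h := sum_fiber_fst (m := m) j fun _ _ => 1
  simp only [Finset.sum_const, nsmul_eq_mul, mul_one, Finset.card_range] at h
  exact_mod_cast h

theorem fiber_unit {ι : Type*} [Fintype ι] (u : Unit) :
    fiber (fun _ : ι => ()) u = Finset.univ := by
  simp [fiber]

/-- The factor s cancels. The relation is required only on the group of a, so s may differ between
groups. -/
theorem standardize_of_affine {ι κ : Type*} [Fintype ι] [DecidableEq κ] {r : ι → κ} {x d : ι → ℝ}
    {y b : ι → ℝ} {s : ℝ} (hs : 0 < s) (a : ι) (ha : y a - b a = s * (x a - d a))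
    (h : ∀ c ∈ fiber r (r a), y c - b c = s * (x c - d c)) :
    (y a - b a) / √((∑ c ∈ fiber r (r a), (y c - b c) ^ 2) / ((fiber r (r a)).card : ℝ)) =
      standardize r x d a := by
  rw [Finset.sum_congr rfl fun c hc => by rw [h c hc, mul_pow], ← Finset.mul_sum, mul_div_assoc,
    Real.sqrt_mul (sq_nonneg s), Real.sqrt_sq hs.le, ha, mul_div_mul_left _ _ hs.ne', standardize]

theorem fiberMean_fst (x : ℕ → ℕ → ℝ) (j : Fin J) :
    fiberMean (Sigma.fst : (Σ j : Fin J, Fin (m j)) → Fin J) (fun a => x a.1 a.2) j =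
      groupMean m x j := by
  rw [fiberMean, sum_fiber_fst j x, card_fiber_fst, groupMean]

theorem fiberMean_unit (x : ℕ → ℕ → ℝ) (u : Unit) :
    fiberMean (fun _ => ()) (fun a : (Σ j : Fin J, Fin (m j)) => x a.1 a.2) u =
      grandMean J m x := by
  rw [fiberMean, fiber_unit, Finset.card_univ, card_layout, grandMean, sum_layout]

theorem grandMean_affine (hN : 0 < total J m) (x : ℕ → ℕ → ℝ) (μ σ : ℝ) :
    grandMean J m (fun j i => μ + σ * x j i) = μ + σ * grandMean J m x := by
  have h : (total J m : ℝ) ≠ 0 := (Nat.cast_pos.2 hN).ne'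
  rw [grandMean, grandMean, sum_layout J m x, sum_layout J m fun j i => μ + σ * x j i,
    Finset.sum_add_distrib, ← Finset.mul_sum, Finset.sum_const, Finset.card_univ, card_layout,
    nsmul_eq_mul]
  field_simp

theorem groupMean_affine {j : ℕ} (hj : 0 < m j) (x : ℕ → ℕ → ℝ) (μ σ : ℕ → ℝ) :
    groupMean m (fun j i => μ j + σ j * x j i) j = μ j + σ j * groupMean m x j := by
  have h : (m j : ℝ) ≠ 0 := (Nat.cast_pos.2 hj).ne'
  rw [groupMean, groupMean, Finset.sum_add_distrib, ← Finset.mul_sum, Finset.sum_const,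
    Finset.card_range, nsmul_eq_mul]
  field_simp

theorem meanOfMeans_affine (hJ : 0 < J) (hm : ∀ j < J, 0 < m j) (x : ℕ → ℕ → ℝ) (μ : ℝ)
    (σ : ℕ → ℝ) : meanOfMeans J m (fun j i => μ + σ j * x j i) =
      μ + (∑ j ∈ Finset.range J, σ j * groupMean m x j) / J := by
  have h : (J : ℝ) ≠ 0 := (Nat.cast_pos.2 hJ).ne'
  rw [meanOfMeans, Finset.sum_congr rfl fun j hj =>
    groupMean_affine (hm j (Finset.mem_range.1 hj)) x (fun _ => μ) σ, Finset.sum_add_distrib,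
    Finset.sum_const, Finset.card_range, nsmul_eq_mul]
  field_simp

theorem residSame_eq_standardize (hN : 0 < total J m) {σ : ℝ} (hσ : 0 < σ) (μ : ℝ)
    (x : ℕ → ℕ → ℝ) (a : Σ j : Fin J, Fin (m j)) :
    residSame J m (fun j i => μ + σ * x j i) a.1 a.2 =
      standardize (fun _ : (Σ j : Fin J, Fin (m j)) => ()) (fun a => x a.1 a.2)
        (fun _ => fiberMean (fun _ => ()) (fun a : (Σ j : Fin J, Fin (m j)) => x a.1 a.2) ()) a := by
  have h : ∀ b : (Σ j : Fin J, Fin (m j)), (μ + σ * x b.1 b.2) -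
      grandMean J m (fun j i => μ + σ * x j i) = σ * (x b.1 b.2 -
        fiberMean (fun _ => ()) (fun a : (Σ j : Fin J, Fin (m j)) => x a.1 a.2) ()) := fun b => by
    rw [fiberMean_unit, grandMean_affine hN]
    ring
  rw [← standardize_of_affine (r := fun _ => ())
    (y := fun b : (Σ j : Fin J, Fin (m j)) => μ + σ * x b.1 b.2)
    (b := fun _ => grandMean J m (fun j i => μ + σ * x j i)) hσ a (h a) fun b _ => h b,
    fiber_unit, Finset.card_univ, card_layout, residSame, pooledSd,
    sum_layout J m fun j i => (μ + σ * x j i - grandMean J m fun j i => μ + σ * x j i) ^ 2]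

theorem residMeans_eq_standardize (hm : ∀ j < J, 0 < m j) {σ : ℝ} (hσ : 0 < σ) (μ : ℕ → ℝ)
    (x : ℕ → ℕ → ℝ) (a : Σ j : Fin J, Fin (m j)) :
    residMeans J m (fun j i => μ j + σ * x j i) a.1 a.2 =
      standardize (fun _ : (Σ j : Fin J, Fin (m j)) => ()) (fun a => x a.1 a.2)
        (fun a => fiberMean Sigma.fst (fun a : (Σ j : Fin J, Fin (m j)) => x a.1 a.2) a.1) a := by
  have h : ∀ b : (Σ j : Fin J, Fin (m j)), (μ b.1 + σ * x b.1 b.2) -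
      groupMean m (fun j i => μ j + σ * x j i) b.1 = σ * (x b.1 b.2 -
        fiberMean Sigma.fst (fun a : (Σ j : Fin J, Fin (m j)) => x a.1 a.2) b.1) := fun b => by
    rw [fiberMean_fst, groupMean_affine (hm _ b.1.2) x μ fun _ => σ]
    ring
  rw [← standardize_of_affine (r := fun _ => ())
    (y := fun b : (Σ j : Fin J, Fin (m j)) => μ b.1 + σ * x b.1 b.2)
    (b := fun b => groupMean m (fun j i => μ j + σ * x j i) b.1) hσ a (h a) fun b _ => h b,
    fiber_unit, Finset.card_univ, card_layout, residMeans, pooledSd,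
    sum_layout J m fun j i => (μ j + σ * x j i - groupMean m (fun j i => μ j + σ * x j i) j) ^ 2]

/-- Dividing by σ_j turns the common centre of the observations into a centre of the errors that
depends on the group. -/
theorem residVars_eq_standardize (hJ : 0 < J) (hm : ∀ j < J, 0 < m j) {σ : ℕ → ℝ}
    (hσ : ∀ j, 0 < σ j) (μ : ℝ) (x : ℕ → ℕ → ℝ) (a : Σ j : Fin J, Fin (m j)) :
    residVars J m (fun j i => μ + σ j * x j i) a.1 a.2 =
      standardize Sigma.fst (fun a : (Σ j : Fin J, Fin (m j)) => x a.1 a.2)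
        (fun a => (∑ j : Fin J, σ j * fiberMean Sigma.fst
          (fun a : (Σ j : Fin J, Fin (m j)) => x a.1 a.2) j) / J / σ a.1) a := by
  have h : ∀ b ∈ fiber (Sigma.fst : (Σ j : Fin J, Fin (m j)) → Fin J) a.1,
      (μ + σ b.1 * x b.1 b.2) - meanOfMeans J m (fun j i => μ + σ j * x j i) =
        σ a.1 * (x b.1 b.2 - (∑ j : Fin J, σ j * fiberMean Sigma.fst
          (fun a : (Σ j : Fin J, Fin (m j)) => x a.1 a.2) j) / J / σ b.1) := fun b hb => by
    have hb' : σ a.1 = σ b.1 := by rw [(Finset.mem_filter.1 hb).2]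
    have hs := (hσ b.1).ne'
    simp_rw [fiberMean_fst]
    rw [meanOfMeans_affine hJ hm, hb', Finset.sum_range]
    field_simp
    ring
  rw [← standardize_of_affine (r := Sigma.fst)
    (y := fun b : (Σ j : Fin J, Fin (m j)) => μ + σ b.1 * x b.1 b.2)
    (b := fun b => meanOfMeans J m (fun j i => μ + σ j * x j i)) (hσ a.1) a
    (h a (Finset.mem_filter.2 ⟨Finset.mem_univ _, rfl⟩)) h,
    card_fiber_fst, residVars, groupSd,
    sum_fiber_fst a.1 fun j i => (μ + σ j * x j i - meanOfMeans J m fun j i => μ + σ j * x j i) ^ 2]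

theorem avgPi_eq (π : ℕ → ℝ → ℝ) (K : ℕ) (y : ℕ → ℕ → ℝ) (k : Fin K) :
    avgPi π K J m y k =
      (∑ a : (Σ j : Fin J, Fin (m j)), π (k + 1) (Phi (y a.1 a.2))) /
        (Fintype.card (Σ j : Fin J, Fin (m j)) : ℝ) := by
  rw [avgPi, card_layout, sum_layout J m fun j i => π (k + 1) (Phi (y j i))]

variable {Ω : Type*} [MeasurableSpace Ω] {P : Measure Ω} {e : ℕ → ℕ → Ω → ℝ}

theorem AssumptionA1.isGaussianSample (h : AssumptionA1 J m e P (gaussianReal 0 1)) :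
    IsGaussianSample (fun (a : Σ j : Fin J, Fin (m j)) => e a.1 a.2) P :=
  ⟨h.indep, fun a => h.law a.1 a.1.2 a.2 a.2.2⟩

theorem aemeasurable_sum_layout {y : ℕ → ℕ → Ω → ℝ}
    (hy : ∀ j < J, ∀ i < m j, AEMeasurable (y j i) P) :
    AEMeasurable (fun ω => ∑ j ∈ Finset.range J, ∑ i ∈ Finset.range (m j), y j i ω) P :=
  Finset.aemeasurable_fun_sum _ fun j hj => Finset.aemeasurable_fun_sum _ fun i hi =>
    hy j (Finset.mem_range.1 hj) i (Finset.mem_range.1 hi)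

theorem aemeasurable_groupMean {y : ℕ → ℕ → Ω → ℝ}
    (hy : ∀ j < J, ∀ i < m j, AEMeasurable (y j i) P) {j : ℕ} (hj : j < J) :
    AEMeasurable (fun ω => groupMean m (fun j i => y j i ω) j) P :=
  (Finset.aemeasurable_fun_sum _ fun i hi => hy j hj i (Finset.mem_range.1 hi)).div_const _

theorem aemeasurable_pooledSd {y : ℕ → ℕ → Ω → ℝ} {b : ℕ → Ω → ℝ}
    (hy : ∀ j < J, ∀ i < m j, AEMeasurable (y j i) P) (hb : ∀ j < J, AEMeasurable (b j) P) :
    AEMeasurable (fun ω => pooledSd J m (fun j i => y j i ω) fun j => b j ω) P :=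
  ((aemeasurable_sum_layout fun j hj i hi =>
    ((hy j hj i hi).sub (hb j hj)).pow_const 2).div_const _).sqrt

theorem aemeasurable_residSame {y : ℕ → ℕ → Ω → ℝ}
    (hy : ∀ j < J, ∀ i < m j, AEMeasurable (y j i) P) {j i : ℕ} (hj : j < J) (hi : i < m j) :
    AEMeasurable (fun ω => residSame J m (fun j i => y j i ω) j i) P := by
  have h : AEMeasurable (fun ω => grandMean J m fun j i => y j i ω) P :=
    (aemeasurable_sum_layout hy).div_const _
  exact ((hy j hj i hi).sub h).div (aemeasurable_pooledSd hy fun _ _ => h)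

theorem aemeasurable_residMeans {y : ℕ → ℕ → Ω → ℝ}
    (hy : ∀ j < J, ∀ i < m j, AEMeasurable (y j i) P) {j i : ℕ} (hj : j < J) (hi : i < m j) :
    AEMeasurable (fun ω => residMeans J m (fun j i => y j i ω) j i) P :=
  ((hy j hj i hi).sub (aemeasurable_groupMean hy hj)).div
    (aemeasurable_pooledSd hy fun _ h => aemeasurable_groupMean hy h)

theorem aemeasurable_residVars {y : ℕ → ℕ → Ω → ℝ}
    (hy : ∀ j < J, ∀ i < m j, AEMeasurable (y j i) P) {j i : ℕ} (hj : j < J) (hi : i < m j) :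
    AEMeasurable (fun ω => residVars J m (fun j i => y j i ω) j i) P := by
  have h : AEMeasurable (fun ω => meanOfMeans J m fun j i => y j i ω) P :=
    (Finset.aemeasurable_fun_sum _ fun j hj =>
      aemeasurable_groupMean hy (Finset.mem_range.1 hj)).div_const _
  exact ((hy j hj i hi).sub h).div ((Finset.aemeasurable_fun_sum _ fun i hi =>
    ((hy j hj i (Finset.mem_range.1 hi)).sub h).pow_const 2).div_const _).sqrt

theorem AssumptionA1.aemeasurable_residVars {ν : Measure ℝ} (h : AssumptionA1 J m e P ν) (μ : ℝ)
    (σ : ℕ → ℝ) : ∀ j < J, ∀ i < m j,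
      AEMeasurable (fun ω => residVars J m (fun j i => μ + σ j * e j i ω) j i) P :=
  fun _ hj _ hi => SmoothAnova.aemeasurable_residVars (fun j hj i hi =>
    ((h.law j hj i hi).aemeasurable.const_mul (σ j)).const_add μ) hj hi

theorem aemeasurable_avgPi {π : ℕ → ℝ → ℝ} {K : ℕ} {k : Fin K}
    (hπ : Measurable fun x => π (k + 1) (Phi x)) {y : Ω → ℕ → ℕ → ℝ}
    (hy : ∀ j < J, ∀ i < m j, AEMeasurable (fun ω => y ω j i) P) :
    AEMeasurable (fun ω => avgPi π K J m (y ω) k) P :=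
  (aemeasurable_sum_layout fun j hj i hi => hπ.comp_aemeasurable (hy j hj i hi)).div_const _

theorem aemeasurable_psiSq {π : ℕ → ℝ → ℝ} {K : ℕ}
    (hπ : ∀ k : Fin K, Measurable fun x => π (k + 1) (Phi x)) (S : Matrix (Fin K) (Fin K) ℝ)
    {y : Ω → ℕ → ℕ → ℝ} (hy : ∀ j < J, ∀ i < m j, AEMeasurable (fun ω => y ω j i) P) :
    AEMeasurable (fun ω => psiSq π K J m S (y ω)) P := by
  unfold psiSq dotProduct Matrix.mulVec dotProduct
  exact Finset.aemeasurable_fun_sum _ fun k _ => (aemeasurable_avgPi (hπ k) hy).mul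
    (Finset.aemeasurable_fun_sum _ fun l _ => (aemeasurable_avgPi (hπ l) hy).const_mul _)

end Layout

/-! ### The normalizing matrices -/

section Matrices

variable {π : ℕ → ℝ → ℝ} {K : ℕ}

theorem c1_eq (π : ℕ → ℝ → ℝ) (k : ℕ) : c1 π k = ∫ y, π k (Phi y) * y ∂gaussianReal 0 1 := by
  rw [c1, integral_unit_eq fun z => π k z * PhiInv z]
  simp_rw [PhiInv_Phi]

theorem c2_eq (π : ℕ → ℝ → ℝ) (k : ℕ) : c2 π k = ∫ y, π k (Phi y) * y ^ 2 ∂gaussianReal 0 1 := by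
  rw [c2, integral_unit_eq fun z => π k z * PhiInv z ^ 2]
  simp_rw [PhiInv_Phi]

theorem sigmaMat_eq (π : ℕ → ℝ → ℝ) (K : ℕ) : sigmaMat π K =
    covMat (fun k => c1 π (k + 1)) (fun k => c2 π (k + 1)) (-1) := by
  ext k l
  simp only [sigmaMat, covMat]
  ring

/-- The coefficient of `c_{1k} c_{1l}` in `omegaMix`. -/
noncomputable def mixCoeff (J : ℕ) (σ p q : ℕ → ℝ) : ℝ :=
  ∑ j ∈ Finset.range J, p j * ((σ j / q j * ∑ r ∈ Finset.range J, p r / σ r) ^ 2 -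
    2 * (σ j / q j * ∑ r ∈ Finset.range J, p r / σ r))

/-- As the p_j sum to 1, averaging the Ω^{(j)} changes only the coefficient of c_{1k}c_{1l}. -/
theorem omegaMix_eq {J : ℕ} {σ p q : ℕ → ℝ} (hp : ∑ j ∈ Finset.range J, p j = 1) :
    omegaMix π K J σ p q =
      covMat (fun k => c1 π (k + 1)) (fun k => c2 π (k + 1)) (mixCoeff J σ p q) := by
  ext k l
  have h : ∀ j ∈ Finset.range J, p j * omegaMat π K J σ p q j k l =
      p j * ((if k = l then 1 else 0) - c2 π (k + 1) * c2 π (l + 1) / 2) +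
        p j * ((σ j / q j * ∑ r ∈ Finset.range J, p r / σ r) ^ 2 -
          2 * (σ j / q j * ∑ r ∈ Finset.range J, p r / σ r)) *
            (c1 π (k + 1) * c1 π (l + 1)) := fun j _ => by
    simp only [omegaMat]
    ring
  simp only [omegaMix, Matrix.sum_apply, Matrix.smul_apply, smul_eq_mul]
  rw [Finset.sum_congr rfl h, Finset.sum_add_distrib, ← Finset.sum_mul, ← Finset.sum_mul, hp]
  simp only [covMat, mixCoeff]
  ring

/-- Completing the square: the coefficient plus 1 is ∑ p_j (w_j - 1)². -/
theorem neg_one_le_mixCoeff {J : ℕ} {σ p q : ℕ → ℝ} (hp0 : ∀ j < J, 0 ≤ p j)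
    (hp : ∑ j ∈ Finset.range J, p j = 1) : -1 ≤ mixCoeff J σ p q := by
  have h : mixCoeff J σ p q + 1 = ∑ j ∈ Finset.range J,
      p j * (σ j / q j * ∑ r ∈ Finset.range J, p r / σ r - 1) ^ 2 := by
    rw [show mixCoeff J σ p q + 1 = mixCoeff J σ p q + ∑ j ∈ Finset.range J, p j by rw [hp],
      mixCoeff, ← Finset.sum_add_distrib]
    exact Finset.sum_congr rfl fun j _ => by ring
  have : 0 ≤ mixCoeff J σ p q + 1 := h ▸ Finset.sum_nonneg fun j hj =>
    mul_nonneg (hp0 j (Finset.mem_range.1 hj)) (sq_nonneg _)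
  linarith

theorem exists_isTestFn_family (hπ : IsOrthonormalSystem π) (hA2 : AssumptionA2 K π) :
    ∃ (g' : Fin K → ℝ → ℝ) (L : ℝ), 0 ≤ L ∧
      ∀ k : Fin K, IsTestFn (fun x => π (k + 1) (Phi x)) (g' k) L := by
  have h := fun k : Fin K => exists_isTestFn hπ hA2 (k := k + 1) (by omega) (by omega)
  choose g' L hL using h
  exact ⟨g', ∑ k, L k, Finset.sum_nonneg fun k _ => (hL k).nonneg, fun k => (hL k).mono
    (Finset.single_le_sum (f := L) (fun k _ => (hL k).nonneg) (Finset.mem_univ k))⟩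

theorem integral_comp_Phi_mul (hπ : IsOrthonormalSystem π) (k l : Fin K) :
    ∫ x, π (k + 1) (Phi x) * π (l + 1) (Phi x) ∂gaussianReal 0 1 = if k = l then 1 else 0 := by
  rw [← integral_unit_eq fun z => π (k + 1) z * π (l + 1) z, hπ.orthonormal]
  simp [Fin.ext_iff]

theorem isUnit_det_covMat (hπ : IsOrthonormalSystem π) (hA2 : AssumptionA2 K π) {t : ℝ}
    (ht : -1 ≤ t) :
    IsUnit (covMat (fun k : Fin K => c1 π (k + 1)) (fun k => c2 π (k + 1)) t).det := by
  obtain ⟨g', L, -, hg⟩ := exists_isTestFn_family hπ hA2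
  have h := covMat_posDef hg (integral_comp_Phi_mul hπ) ht
  simp_rw [c1_eq, c2_eq]
  exact (Matrix.isUnit_iff_isUnit_det _).1 h.isUnit

end Matrices

/-- Needed because the empirical normalizing matrix has the form `covMat` only once the layout is
nonempty. -/
theorem tendstoInDistribution_congr {Ω : ℕ → Type*} [∀ n, MeasurableSpace (Ω n)]
    {P : ∀ n, Measure (Ω n)} [∀ n, IsProbabilityMeasure (P n)] {ρ : Measure ℝ}
    [IsProbabilityMeasure ρ] {X Y : ∀ n, Ω n → ℝ} (h : TendstoInDistribution X atTop id P ρ)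
    (hY : ∀ n, AEMeasurable (Y n) (P n)) (hXY : ∀ᶠ n in atTop, X n = Y n) :
    TendstoInDistribution Y atTop id P ρ where
  forall_aemeasurable := hY
  aemeasurable_limit := h.aemeasurable_limit
  tendsto := h.tendsto.congr' <| hXY.mono fun n hn => by
    congr 1
    rw [hn]

/-! ### Consequences of the asymptotic regimes -/

section Regimes

variable {J : ℕ → ℕ} {m : ℕ → ℕ → ℕ} {p q : ℕ → ℝ}

theorem GroupRegime.eventually_pos (h : GroupRegime J m) :
    ∀ᶠ n in atTop, ∀ j < J n, 0 < m n j :=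
  h.size 1

theorem GroupRegime.tendsto_total (h : GroupRegime J m) :
    Tendsto (fun n => total (J n) (m n)) atTop atTop := by
  -- Group 0 occurs in every layout and eventually has at least M observations.
  refine tendsto_atTop.2 fun M => ?_
  filter_upwards [h.size M] with n hn
  exact (hn 0 (h.pos n)).trans (Finset.single_le_sum (f := m n) (fun _ _ => Nat.zero_le _)
    (Finset.mem_range.2 (h.pos n)))

theorem sum_pHat {J : ℕ} {m : ℕ → ℕ} (hN : 0 < total J m) :
    ∑ j ∈ Finset.range J, pHat J m j = 1 := by
  have h : (total J m : ℝ) ≠ 0 := (Nat.cast_pos.2 hN).ne'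
  simp only [pHat]
  rw [← Finset.sum_div, div_eq_one_iff_eq h, total, Nat.cast_sum]

theorem pHat_nonneg (J : ℕ) (m : ℕ → ℕ) (j : ℕ) : 0 ≤ pHat J m j := by
  unfold pHat
  positivity

theorem exists_pos_le {f : ℕ → ℝ} (hf : ∀ j, 0 < f j) (n : ℕ) :
    ∃ a > 0, ∀ j < n, a ≤ f j := by
  induction n with
  | zero => exact ⟨1, one_pos, fun j hj => absurd hj (Nat.not_lt_zero j)⟩
  | succ n ih =>
    obtain ⟨a, ha, h⟩ := ih
    refine ⟨min a (f n), lt_min ha (hf n), fun j hj => ?_⟩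
    rcases Nat.lt_succ_iff_lt_or_eq.1 hj with hj | rfl
    · exact (min_le_left _ _).trans (h j hj)
    · exact min_le_right _ _

/-- Once J is constant, the restriction to layouts containing group j is eventually vacuous. -/
theorem WeightRegime.tendsto_pHat (h : WeightRegime J m p q) {J₀ : ℕ}
    (hJ : ∀ᶠ n in atTop, J n = J₀) {j : ℕ} (hj : j < J₀) :
    Tendsto (fun n => pHat (J n) (m n) j) atTop (𝓝 (p j)) :=
  (h.p_lim j).mono_left (le_inf le_rfl (le_principal_iff.2 (hJ.mono fun n hn => by
    simpa only [Set.mem_ofPred_eq, hn] using hj)))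

theorem WeightRegime.tendsto_qHat (h : WeightRegime J m p q) {J₀ : ℕ}
    (hJ : ∀ᶠ n in atTop, J n = J₀) {j : ℕ} (hj : j < J₀) :
    Tendsto (fun n => qHat (J n) (m n) j) atTop (𝓝 (q j)) :=
  (h.q_lim j).mono_left (le_inf le_rfl (le_principal_iff.2 (hJ.mono fun n hn => by
    simpa only [Set.mem_ofPred_eq, hn] using hj)))

/-- A finite sum of limits inherits the total mass 1 of the empirical weights. -/
theorem WeightRegime.sum_eq_one (h : WeightRegime J m p q) {J₀ : ℕ}
    (hJ : ∀ᶠ n in atTop, J n = J₀) : ∑ j ∈ Finset.range J₀, p j = 1 := by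
  refine tendsto_nhds_unique (tendsto_finsetSum _ fun j hj =>
    h.tendsto_pHat hJ (Finset.mem_range.1 hj)) (tendsto_const_nhds.congr' ?_)
  filter_upwards [hJ, h.tendsto_total.eventually_gt_atTop 0] with n hn hN
  rw [← hn, sum_pHat hN]

theorem WeightRegime.tendsto_mixCoeff (h : WeightRegime J m p q) {J₀ : ℕ}
    (hJ : ∀ᶠ n in atTop, J n = J₀) (σ : ℕ → ℝ) :
    Tendsto (fun n => mixCoeff (J n) σ (pHat (J n) (m n)) (qHat (J n) (m n))) atTop
      (𝓝 (mixCoeff J₀ σ p q)) := by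
  have h1 : Tendsto (fun n => ∑ r ∈ Finset.range J₀, pHat (J n) (m n) r / σ r) atTop
      (𝓝 (∑ r ∈ Finset.range J₀, p r / σ r)) :=
    tendsto_finsetSum _ fun r hr => (h.tendsto_pHat hJ (Finset.mem_range.1 hr)).div_const _
  have h2 : Tendsto (fun n => mixCoeff J₀ σ (pHat (J n) (m n)) (qHat (J n) (m n))) atTop
      (𝓝 (mixCoeff J₀ σ p q)) := by
    refine tendsto_finsetSum _ fun j hj => ?_
    have hj' := Finset.mem_range.1 hj
    have h3 := ((tendsto_const_nhds (x := σ j)).div (h.tendsto_qHat hJ hj') (h.q_pos j).ne').mul h1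
    exact (h.tendsto_pHat hJ hj').mul ((h3.pow 2).sub (h3.const_mul 2))
  refine h2.congr' (hJ.mono fun n hn => ?_)
  rw [← hn]

/-- For finitely many groups, positivity of each σ_j and q_j already gives the uniform bounds that
are assumed when J → ∞. The value β = ∑ σ_j is a convenient upper bound. -/
theorem WeightRegime.exists_bounds (h : WeightRegime J m p q) {J₀ : ℕ}
    (hJ : ∀ᶠ n in atTop, J n = J₀) {σ : ℕ → ℝ} (hσ : ∀ j, 0 < σ j) :
    ∃ α β c : ℝ, 0 < α ∧ 0 < c ∧ (∀ᶠ n in atTop, ∀ j < J n, α ≤ σ j ∧ σ j ≤ β) ∧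
      ∀ᶠ n in atTop, ∀ j < J n, c ≤ qHat (J n) (m n) j := by
  obtain ⟨α, hα, h1⟩ := exists_pos_le hσ J₀
  obtain ⟨c, hc, h2⟩ := exists_pos_le (fun j => half_pos (h.q_pos j)) J₀
  refine ⟨α, ∑ j ∈ Finset.range J₀, σ j, c, hα, hc, ?_, ?_⟩
  · filter_upwards [hJ] with n hn j hj
    rw [hn] at hj
    exact ⟨h1 j hj, Finset.single_le_sum (fun i _ => (hσ i).le) (Finset.mem_range.2 hj)⟩
  · have h3 : ∀ᶠ n in atTop, ∀ j ∈ Finset.range J₀, q j / 2 < qHat (J n) (m n) j :=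
      (Filter.eventually_all_finset _).2 fun j hj =>
        (h.tendsto_qHat hJ (Finset.mem_range.1 hj)).eventually_const_lt (half_lt_self (h.q_pos j))
    filter_upwards [hJ, h3] with n hn h4 j hj
    rw [hn] at hj
    exact (h2 j hj).trans (h4 j (Finset.mem_range.2 hj)).le

end Regimes

/-! ### Limit laws of the test statistics -/

section Statistics

variable {K : ℕ} {π : ℕ → ℝ → ℝ} {Ω : ℕ → Type*} [∀ n, MeasurableSpace (Ω n)]
  {P : ∀ n, Measure (Ω n)} [∀ n, IsProbabilityMeasure (P n)]
  {J : ℕ → ℕ} {m : ℕ → ℕ → ℕ} {e : ∀ n, ℕ → ℕ → Ω n → ℝ}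

theorem tendstoInDistribution_residSame
    (hπ : IsOrthonormalSystem π) (hA2 : AssumptionA2 K π)
    (hA1 : ∀ n, AssumptionA1 (J n) (m n) (e n) (P n) (gaussianReal 0 1))
    (μ : ℝ) {σ : ℝ} (hσ : 0 < σ) (hN : Tendsto (fun n => total (J n) (m n)) atTop atTop) :
    TendstoInDistribution (fun n ω => (total (J n) (m n) : ℝ) *
      psiSq π K (J n) (m n) (sigmaMat π K)
        (residSame (J n) (m n) fun j i => μ + σ * e n j i ω)) atTop id P (chiSquared K) := by
  obtain ⟨g', L, hL, hg⟩ := exists_isTestFn_family hπ hA2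
  have hN' : Tendsto (fun n => Fintype.card (Σ j : Fin (J n), Fin (m n j))) atTop atTop := by
    simpa only [card_layout] using hN
  have h := tendstoInDistribution_groupMeans (fun n => (hA1 n).isGaussianSample) hN' hg hL
    -- A common mean is the case of group means with the whole sample as the only group.
    (integral_comp_Phi_mul hπ) (κ := fun _ => Unit) (r := fun _ _ => ())
    (V := fun n ω => avgPi π K (J n) (m n)
      (residSame (J n) (m n) fun j i => μ + σ * e n j i ω)) ?_ ?_ (fun n k => ?_) ?_
  · rw [sigmaMat_eq]
    simp_rw [c1_eq, c2_eq]
    simpa only [card_layout, psiSq] using h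
  · filter_upwards [hN'.eventually_gt_atTop 0] with n hn u
    rwa [fiber_unit, Finset.card_univ]
  · simp only [Fintype.card_unit, Nat.cast_one, one_div]
    exact tendsto_inv_atTop_zero.comp
      (Real.tendsto_sqrt_atTop.comp (tendsto_natCast_atTop_atTop.comp hN'))
  · exact aemeasurable_avgPi (hg k).continuous.measurable fun j hj i hi =>
      aemeasurable_residSame (fun j hj i hi =>
        (((hA1 n).law j hj i hi).aemeasurable.const_mul σ).const_add μ) hj hi
  · filter_upwards [hN.eventually_gt_atTop 0] with n hn ω k
    rw [avgPi_eq]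
    simp_rw [residSame_eq_standardize hn hσ μ fun j i => e n j i ω]

theorem tendstoInDistribution_residMeans
    (hπ : IsOrthonormalSystem π) (hA2 : AssumptionA2 K π)
    (hA1 : ∀ n, AssumptionA1 (J n) (m n) (e n) (P n) (gaussianReal 0 1))
    (μ : ℕ → ℝ) {σ : ℝ} (hσ : 0 < σ) (hJ : GroupRegime J m) :
    TendstoInDistribution (fun n ω => (total (J n) (m n) : ℝ) *
      psiSq π K (J n) (m n) (sigmaMat π K)
        (residMeans (J n) (m n) fun j i => μ j + σ * e n j i ω)) atTop id P (chiSquared K) := by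
  obtain ⟨g', L, hL, hg⟩ := exists_isTestFn_family hπ hA2
  have hN' : Tendsto (fun n => Fintype.card (Σ j : Fin (J n), Fin (m n j))) atTop atTop := by
    simpa only [card_layout] using hJ.tendsto_total
  have h := tendstoInDistribution_groupMeans (fun n => (hA1 n).isGaussianSample) hN' hg hL
    (integral_comp_Phi_mul hπ) (κ := fun n => Fin (J n)) (r := fun _ => Sigma.fst)
    (V := fun n ω => avgPi π K (J n) (m n)
      (residMeans (J n) (m n) fun j i => μ j + σ * e n j i ω)) ?_ ?_ (fun n k => ?_) ?_
  · rw [sigmaMat_eq]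
    simp_rw [c1_eq, c2_eq]
    simpa only [card_layout, psiSq] using h
  · filter_upwards [hJ.eventually_pos] with n hn j
    rw [card_fiber_fst]
    exact hn j j.2
  · simpa only [Fintype.card_fin, card_layout] using hJ.groups.tendsto_div_nhds_zero
  · exact aemeasurable_avgPi (hg k).continuous.measurable fun j hj i hi =>
      aemeasurable_residMeans (fun j hj i hi =>
        (((hA1 n).law j hj i hi).aemeasurable.const_mul σ).const_add (μ j)) hj hi
  · filter_upwards [hJ.eventually_pos] with n hn ω k
    rw [avgPi_eq]
    simp_rw [residMeans_eq_standardize hn hσ μ fun j i => e n j i ω]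

/-- The sequence t stands both for the limiting coefficient and for the empirical one, so this
covers both normalizing matrices. -/
theorem tendstoInDistribution_residVars
    (hπ : IsOrthonormalSystem π) (hA2 : AssumptionA2 K π)
    (hA1 : ∀ n, AssumptionA1 (J n) (m n) (e n) (P n) (gaussianReal 0 1))
    (μ : ℝ) {σ : ℕ → ℝ} (hσ : ∀ j, 0 < σ j) (hJ : GroupRegime J m) {α β c : ℝ} (hα : 0 < α)
    (hσb : ∀ᶠ n in atTop, ∀ j < J n, α ≤ σ j ∧ σ j ≤ β) (hc : 0 < c)
    (hq : ∀ᶠ n in atTop, ∀ j < J n, c ≤ qHat (J n) (m n) j)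
    {t : ℕ → ℝ} (ht : ∀ᶠ n in atTop, -1 ≤ t n)
    (hlim : Tendsto (fun n => mixCoeff (J n) σ (pHat (J n) (m n)) (qHat (J n) (m n)) - t n)
      atTop (𝓝 0)) :
    TendstoInDistribution (fun n ω => (total (J n) (m n) : ℝ) *
      psiSq π K (J n) (m n) (covMat (fun k => c1 π (k + 1)) (fun k => c2 π (k + 1)) (t n))
        (residVars (J n) (m n) fun j i => μ + σ j * e n j i ω)) atTop id P (chiSquared K) := by
  obtain ⟨g', L, hL, hg⟩ := exists_isTestFn_family hπ hA2
  have hN' : Tendsto (fun n => Fintype.card (Σ j : Fin (J n), Fin (m n j))) atTop atTop := by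
    simpa only [card_layout] using hJ.tendsto_total
  have h := tendstoInDistribution_groupScales (fun n => (hA1 n).isGaussianSample) hN' hg hL
    (integral_comp_Phi_mul hπ) (κ := fun n => Fin (J n)) (r := fun _ => Sigma.fst)
    (σ := fun n j => σ j) (β := β) (t := t) ?_ ?_ ?_ hα ?_ hc ?_ ht ?_
    (V := fun n ω => avgPi π K (J n) (m n)
      (residVars (J n) (m n) fun j i => μ + σ j * e n j i ω)) (fun n k => ?_) ?_
  · simp_rw [c1_eq, c2_eq]
    simpa only [card_layout, psiSq] using h
  · filter_upwards [hJ.eventually_pos] with n hn j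
    rw [card_fiber_fst]
    exact hn j j.2
  · exact Eventually.of_forall fun n => by simpa only [Fintype.card_fin] using hJ.pos n
  · simpa only [Fintype.card_fin, card_layout] using hJ.groups.tendsto_div_nhds_zero
  · exact hσb.mono fun n hn j => hn j j.2
  · filter_upwards [hq] with n hn j
    rw [card_fiber_fst, card_layout, Fintype.card_fin]
    exact hn j j.2
  · refine hlim.congr fun n => ?_
    simp only [mixCoeff, scaleWeight, card_fiber_fst, card_layout, Fintype.card_fin,
      Finset.sum_range, pHat, qHat]
  · exact aemeasurable_avgPi (hg k).continuous.measurable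
      ((hA1 n).aemeasurable_residVars μ σ)
  · filter_upwards [hJ.eventually_pos] with n hn ω k
    rw [avgPi_eq]
    simp_rw [residVars_eq_standardize (hJ.pos n) hn hσ μ fun j i => e n j i ω, Fintype.card_fin]

theorem tendstoInDistribution_residVars_limitWeights
    (hπ : IsOrthonormalSystem π) (hA2 : AssumptionA2 K π)
    (hA1 : ∀ n, AssumptionA1 (J n) (m n) (e n) (P n) (gaussianReal 0 1))
    (μ : ℝ) {σ p q : ℕ → ℝ} (hσ : ∀ j, 0 < σ j) (hJ : WeightRegime J m p q) {J₀ : ℕ}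
    (hJ₀ : ∀ᶠ n in atTop, J n = J₀) :
    IsUnit (omegaMix π K J₀ σ p q).det ∧
      TendstoInDistribution (fun n ω => (total (J n) (m n) : ℝ) *
        psiSq π K (J n) (m n) (omegaMix π K J₀ σ p q)
          (residVars (J n) (m n) fun j i => μ + σ j * e n j i ω)) atTop id P (chiSquared K) := by
  obtain ⟨α, β, c, hα, hc, h1, h2⟩ := hJ.exists_bounds hJ₀ hσ
  have hp := hJ.sum_eq_one hJ₀
  have ht : -1 ≤ mixCoeff J₀ σ p q := neg_one_le_mixCoeff (fun j _ => hJ.p_nonneg j) hp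
  rw [omegaMix_eq hp]
  refine ⟨isUnit_det_covMat hπ hA2 ht, tendstoInDistribution_residVars hπ hA2 hA1 μ hσ
    hJ.toGroupRegime hα h1 hc h2 (Eventually.of_forall fun _ => ht) ?_⟩
  simpa only [sub_self] using (hJ.tendsto_mixCoeff hJ₀ σ).sub_const (mixCoeff J₀ σ p q)

theorem tendstoInDistribution_residVars_empiricalWeights
    (hπ : IsOrthonormalSystem π) (hA2 : AssumptionA2 K π)
    (hA1 : ∀ n, AssumptionA1 (J n) (m n) (e n) (P n) (gaussianReal 0 1))
    (μ : ℝ) {σ : ℕ → ℝ} (hσ : ∀ j, 0 < σ j) (hJ : GroupRegime J m) {α β c : ℝ} (hα : 0 < α)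
    (hσb : ∀ᶠ n in atTop, ∀ j < J n, α ≤ σ j ∧ σ j ≤ β) (hc : 0 < c)
    (hq : ∀ᶠ n in atTop, ∀ j < J n, c ≤ qHat (J n) (m n) j) :
    (∀ᶠ n in atTop,
      IsUnit (omegaMix π K (J n) σ (pHat (J n) (m n)) (qHat (J n) (m n))).det) ∧
      TendstoInDistribution (fun n ω => (total (J n) (m n) : ℝ) *
        psiSq π K (J n) (m n) (omegaMix π K (J n) σ (pHat (J n) (m n)) (qHat (J n) (m n)))
          (residVars (J n) (m n) fun j i => μ + σ j * e n j i ω)) atTop id P (chiSquared K) := by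
  have hN := hJ.tendsto_total.eventually_gt_atTop 0
  have ht : ∀ᶠ n in atTop, -1 ≤ mixCoeff (J n) σ (pHat (J n) (m n)) (qHat (J n) (m n)) :=
    hN.mono fun n hn => neg_one_le_mixCoeff (fun j _ => pHat_nonneg _ _ j) (sum_pHat hn)
  obtain ⟨g', L, -, hg⟩ := exists_isTestFn_family hπ hA2
  refine ⟨?_, tendstoInDistribution_congr (tendstoInDistribution_residVars hπ hA2 hA1 μ hσ
    hJ hα hσb hc hq ht (by simp only [sub_self, tendsto_const_nhds])) (fun n => ?_) ?_⟩
  · filter_upwards [hN, ht] with n hn htn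
    rw [omegaMix_eq (sum_pHat hn)]
    exact isUnit_det_covMat hπ hA2 htn
  · exact (aemeasurable_psiSq (fun k => (hg k).continuous.measurable) _
      ((hA1 n).aemeasurable_residVars μ σ)).const_mul _
  · filter_upwards [hN] with n hn
    rw [omegaMix_eq (sum_pHat hn)]

end Statistics

end SmoothAnova

theorem corollary1
    (K : ℕ) (hK : 0 < K) (π : ℕ → ℝ → ℝ)
    (hπ : SmoothAnova.IsOrthonormalSystem π) (hA2 : SmoothAnova.AssumptionA2 K π)
    {Ω : ℕ → Type*} [∀ n, MeasurableSpace (Ω n)]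
    (P : ∀ n, Measure (Ω n)) [∀ n, IsProbabilityMeasure (P n)]
    (J : ℕ → ℕ) (m : ℕ → ℕ → ℕ) (e : ∀ n, ℕ → ℕ → Ω n → ℝ)
    (ν : Measure ℝ) [IsProbabilityMeasure ν]
    (hA1 : ∀ n, SmoothAnova.AssumptionA1 (J n) (m n) (e n) (P n) ν)
    (hH0 : ν = gaussianReal 0 1) :
    -- the matrix of the first two models is invertible
    IsUnit (SmoothAnova.sigmaMat π K).det ∧
    -- common mean and common variance
    (∀ μ σ : ℝ, 0 < σ →
      Tendsto (fun n => SmoothAnova.total (J n) (m n)) atTop atTop →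
      TendstoInDistribution
        (fun n ω => (SmoothAnova.total (J n) (m n) : ℝ) *
          SmoothAnova.psiSq π K (J n) (m n) (SmoothAnova.sigmaMat π K)
            (SmoothAnova.residSame (J n) (m n) fun j i => μ + σ * e n j i ω))
        atTop id P (SmoothAnova.chiSquared K)) ∧
    -- different means and common variance
    (∀ (μ : ℕ → ℝ) (σ : ℝ), 0 < σ →
      SmoothAnova.GroupRegime J m →
      TendstoInDistribution
        (fun n ω => (SmoothAnova.total (J n) (m n) : ℝ) *
          SmoothAnova.psiSq π K (J n) (m n) (SmoothAnova.sigmaMat π K)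
            (SmoothAnova.residMeans (J n) (m n) fun j i => μ j + σ * e n j i ω))
        atTop id P (SmoothAnova.chiSquared K)) ∧
    -- common mean and different variances
    (∀ (μ : ℝ) (σ p q : ℕ → ℝ), (∀ j, 0 < σ j) →
      SmoothAnova.WeightRegime J m p q →
      -- a fixed number of groups, limiting weights in the normalizing matrix
      (∀ J₀ : ℕ, (∀ᶠ n in atTop, J n = J₀) →
        IsUnit (SmoothAnova.omegaMix π K J₀ σ p q).det ∧
        TendstoInDistribution
          (fun n ω => (SmoothAnova.total (J n) (m n) : ℝ) *
            SmoothAnova.psiSq π K (J n) (m n) (SmoothAnova.omegaMix π K J₀ σ p q)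
              (SmoothAnova.residVars (J n) (m n) fun j i => μ + σ j * e n j i ω))
          atTop id P (SmoothAnova.chiSquared K)) ∧
      -- a fixed number of groups, or a number of groups that tends to infinity; empirical weights
      (((∃ J₀ : ℕ, ∀ᶠ n in atTop, J n = J₀) ∨
        (Tendsto J atTop atTop ∧
          (∃ a b : ℝ, 0 < a ∧ ∀ j, a ≤ σ j ∧ σ j ≤ b) ∧
          (∃ c : ℝ, 0 < c ∧ ∀ᶠ n in atTop, ∀ j < J n,
            c ≤ SmoothAnova.qHat (J n) (m n) j))) →
        (∀ᶠ n in atTop, IsUnit (SmoothAnova.omegaMix π K (J n) σ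
          (SmoothAnova.pHat (J n) (m n)) (SmoothAnova.qHat (J n) (m n))).det) ∧
        TendstoInDistribution
          (fun n ω => (SmoothAnova.total (J n) (m n) : ℝ) *
            SmoothAnova.psiSq π K (J n) (m n)
              (SmoothAnova.omegaMix π K (J n) σ
                (SmoothAnova.pHat (J n) (m n)) (SmoothAnova.qHat (J n) (m n)))
              (SmoothAnova.residVars (J n) (m n) fun j i => μ + σ j * e n j i ω))
          atTop id P (SmoothAnova.chiSquared K))) := by
  subst hH0
  refine ⟨?_, fun μ σ hσ hN => SmoothAnova.tendstoInDistribution_residSame hπ hA2 hA1 μ hσ hN,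
    fun μ σ hσ hJ => SmoothAnova.tendstoInDistribution_residMeans hπ hA2 hA1 μ hσ hJ,
    fun μ σ p q hσ hJ => ⟨fun J₀ hJ₀ =>
      SmoothAnova.tendstoInDistribution_residVars_limitWeights hπ hA2 hA1 μ hσ hJ hJ₀, ?_⟩⟩
  · rw [SmoothAnova.sigmaMat_eq]
    exact SmoothAnova.isUnit_det_covMat hπ hA2 le_rfl
  -- For fixed J the uniform bounds are derived, otherwise they are given; the same limit law
  -- applies to both.
  · rintro (⟨J₀, hJ₀⟩ | ⟨-, ⟨α, β, hα, hσb⟩, c, hc, hq⟩)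
    · obtain ⟨α, β, c, hα, hc, h1, h2⟩ := hJ.exists_bounds hJ₀ hσ
      exact SmoothAnova.tendstoInDistribution_residVars_empiricalWeights hπ hA2 hA1 μ hσ
        hJ.toGroupRegime hα h1 hc h2
    · exact SmoothAnova.tendstoInDistribution_residVars_empiricalWeights hπ hA2 hA1 μ hσ
        hJ.toGroupRegime hα (Eventually.of_forall fun n j _ => hσb j) hc hq
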